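/- For every $n\in\mathbb N$ (including $n=0$) there exist $\sigma_0=\sigma_0(n)>0$, $C=C(n)>0$ and constants $C_{n,k}$ ($k\ge 2$), depending only on the indicated indices, such that the following holds. Let $E$ be a real Hilbert space, not necessarily separable, let $X\subset E$, $0<\varepsilon<r/10$ and $0<\delta<\sigma_0 r$. Write $B_r(x)$ for the open ball and $U_\rho(Y)=\{z\in E:\exists y\in Y,\ |z-y|<\rho\}$ for the $\rho$-neighbourhood of $Y\subset E$; an $\varepsilon$-net of $Y$ is a subset $S\subset Y$ with $Y\subset U_\varepsilon(S)$. Suppose that for every $x\in X$ there exists an $n$-dimensional affine subspace $A_x\subset E$ such that $X\cap B_r(x)$ is within Hausdorff distance $\delta$ from an $\varepsilon$-net of the affine $n$-ball $A_x\cap B_r(x)$. Then there exists a smooth embedded $n$-dimensional submanifold $M\subset E$ which is a closed subset of $E$ (and may be empty or disconnected, with uncountably many components if $E$ is not separable), such that: 1. The second fundamental form of $M$ is bounded in norm by $C\delta r^{-2}$ at every point. 2. The normal injectivity radius of $M$ is at least $r/3$; here the normal injectivity radius is the supremum of all $\rho>0$ such that the normal exponential map $(p,v)\mapsto p+v$ ($p\in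 M$, $v\perp T_pM$) is a diffeomorphism of the $\rho$-neighbourhood $\{|v|<\rho\}$ of the null section of the normal bundle onto an open subset of $E$. 3. Every $x\in U_{r/3}(M)$ has a unique nearest point $P_M(x)$ in $M$, and the normal projection $P_M\colon U_{r/3}(M)\to M$ is smooth, satisfies $|P_M(x)-P_M(y)|\le C|x-y|$ for all $x,y\in U_{r/3}(M)$, and satisfies $\|d^k_xP_M\|<C_{n,k}\,\delta\, r^{-k}$ for all $k\ge 2$ and $x\in U_{r/3}(M)$. 4. $X$ is within Hausdorff distance $C\delta$ from an $\varepsilon$-net of $M$. -/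

import Mathlib

open scoped ENNReal ContDiff InnerProductSpace

/-- `S` is an `ε`-net of `Y`: a subset of `Y` whose `ε`-neighbourhood covers `Y`. -/
def IsNet {E : Type*} [PseudoMetricSpace E] (ε : ℝ) (S Y : Set E) : Prop :=
  S ⊆ Y ∧ Y ⊆ Metric.thickening ε S

/-- The Hausdorff distance of `A` and `B` is at most `δ`. The extended distance is used, so that a
nonempty set is at infinite distance from the empty one. -/
def HausdorffWithin {E : Type*} [PseudoEMetricSpace E] (δ : ℝ) (A B : Set E) : Prop :=
  Metric.hausdorffEDist A B ≤ ENNReal.ofReal δ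

section Submanifolds

variable {E : Type*} [NormedAddCommGroup E] [InnerProductSpace ℝ E]

/-- `A` is a nonempty affine subspace of dimension exactly `n`. -/
def IsAffineFlat (n : ℕ) (A : AffineSubspace ℝ E) : Prop :=
  (A : Set E).Nonempty ∧ FiniteDimensional ℝ A.direction ∧ Module.finrank ℝ A.direction = n

/-- `φ`, restricted to the open set `V ⊆ ℝⁿ`, is a smooth local parametrization of `M`: a smooth
injective immersion that is a homeomorphism of `V` onto a relatively open subset of `M`
(relatively open subsets of `V` have relatively open images in `M`). -/
structure IsLocalParametrization (n : ℕ) (M : Set E) (φ : EuclideanSpace ℝ (Fin n) → E)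
    (V : Set (EuclideanSpace ℝ (Fin n))) : Prop where
  isOpen : IsOpen V
  contDiffOn : ContDiffOn ℝ ∞ φ V
  immersion : ∀ u ∈ V, Function.Injective (fderiv ℝ φ u)
  injOn : Set.InjOn φ V
  image_open : ∀ W ⊆ V, IsOpen W → ∃ U : Set E, IsOpen U ∧ φ '' W = M ∩ U

/-- `M` is a closed `n`-dimensional submanifold of `E`: a smooth embedded submanifold of dimension
`n` that is a closed subset of `E`. -/
def IsClosedSubmanifold (n : ℕ) (M : Set E) : Prop :=
  IsClosed M ∧ ∀ p ∈ M, ∃ (φ : EuclideanSpace ℝ (Fin n) → E) (V : Set (EuclideanSpace ℝ (Fin n))),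
    IsLocalParametrization n M φ V ∧ p ∈ φ '' V

/-- The tangent space of `M` at `p`, consisting of the velocities of smooth curves in `M` through
`p`. For a submanifold these velocities already form a linear subspace. -/
def tangentSpaceAt (M : Set E) (p : E) : Submodule ℝ E :=
  Submodule.span ℝ {v | ∃ γ : ℝ → E, ContDiff ℝ ∞ γ ∧ (∀ t, γ t ∈ M) ∧ γ 0 = p ∧ deriv γ 0 = v}

/-- The normal space of `M` at `p`. -/
noncomputable def normalSpaceAt (M : Set E) (p : E) : Submodule ℝ E := (tangentSpaceAt M p)ᗮ

instance normalSpaceAt.completeSpace [CompleteSpace E] (M : Set E) (p : E) :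
    CompleteSpace (normalSpaceAt M p) :=
  Submodule.instOrthogonalCompleteSpace (tangentSpaceAt M p)

/-- The second fundamental form of `M` at `φ u`, evaluated on the tangent vectors `dφ_u(a)` and
`dφ_u(b)`, where `φ` is a local parametrization of `M`: the normal component of `d²φ_u(a, b)`. -/
noncomputable def secondFundamentalForm [CompleteSpace E] {n : ℕ} (M : Set E)
    (φ : EuclideanSpace ℝ (Fin n) → E) (u a b : EuclideanSpace ℝ (Fin n)) : E :=
  (normalSpaceAt M (φ u)).starProjection (fderiv ℝ (fderiv ℝ φ) u a b)

/-- At every point of `M`, the second fundamental form `II` of the `n`-dimensional submanifold `M`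
satisfies `‖II(v, w)‖ ≤ κ ‖v‖ ‖w‖` for all tangent vectors `v` and `w`. -/
def SecondFundamentalFormBoundedBy [CompleteSpace E] (n : ℕ) (M : Set E) (κ : ℝ) : Prop :=
  ∀ (φ : EuclideanSpace ℝ (Fin n) → E) (V : Set (EuclideanSpace ℝ (Fin n))),
    IsLocalParametrization n M φ V → ∀ u ∈ V, ∀ a b : EuclideanSpace ℝ (Fin n),
      ‖secondFundamentalForm M φ u a b‖ ≤ κ * ‖fderiv ℝ φ u a‖ * ‖fderiv ℝ φ u b‖

/-- The `ρ`-neighbourhood of the null section in the normal bundle of `M`; the normal bundle is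
the set of pairs `(p, v)` with `p ∈ M` and `v` normal to `M` at `p`. -/
def normalTube (M : Set E) (ρ : ℝ) : Set (E × E) :=
  {q | q.1 ∈ M ∧ q.2 ∈ normalSpaceAt M q.1 ∧ ‖q.2‖ < ρ}

/-- The normal exponential map `(p, v) ↦ p + v` of `M`. -/
def normalExp (q : E × E) : E := q.1 + q.2

/-- The normal exponential map is a diffeomorphism of the `ρ`-neighbourhood of the null section
onto an open subset of `E`: it is injective there, its image is open, and its inverse is smooth.
(The map itself is smooth, being the restriction of a continuous linear map on `E × E`.) -/
def NormalExpDiffeoOn (M : Set E) (ρ : ℝ) : Prop :=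
  Set.InjOn normalExp (normalTube M ρ) ∧ IsOpen (normalExp '' normalTube M ρ) ∧
    ∃ g : E → E × E, ContDiffOn ℝ ∞ g (normalExp '' normalTube M ρ) ∧
      ∀ q ∈ normalTube M ρ, g (normalExp q) = q

/-- The normal injectivity radius of `M`. -/
noncomputable def normalInjectivityRadius (M : Set E) : ℝ≥0∞ :=
  sSup {R | ∃ ρ : ℝ, 0 < ρ ∧ NormalExpDiffeoOn M ρ ∧ R = ENNReal.ofReal ρ}

/-- On the `ρ`-neighbourhood of `M`, the map `P` is the normal projection to `M`: `P x` is the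
unique point of `M` nearest to `x`. -/
def IsNormalProjection (M : Set E) (ρ : ℝ) (P : E → E) : Prop :=
  ∀ x ∈ Metric.thickening ρ M, P x ∈ M ∧ ∀ y ∈ M, y ≠ P x → dist x (P x) < dist x y

end Submanifolds

/-!
The manifold is obtained by gluing the given flats. After rescaling to `r = 1` and translating each
flat so that it passes through its point `x ∈ X`, one has a field of isometric embeddings
`ι x : ℝⁿ → E` such that `X` is `O(d)`-close to `x + range (ι x)` in the unit ball around `x`, where
`d = 4 * δ / r` (`FlatField`, `exists_flatField`). Flats at neighbouring points are then
`O(d)`-close to each other (`FlatField.norm_perp_sub_le`).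

**Gluing.** A maximal separated subset of `X` splits into a number of classes that depends only on
`n`, each consisting of points at mutual distance at least `1` (`FlatField.exists_colouring`). For
each class there is a map `flatStep` of `E` that projects a neighbourhood of every centre in the
class to the flat of this centre and is the identity far from the class. Applied to a map that is
`O(d)`-close to an affine parametrization of a flat, in all derivatives, it yields another such map
(`NearFlat.flatStep`), with bounds that do not depend on `E`. The chart of a centre of class `k` is
its flat moved by the steps for all lower classes, those of higher index being applied first.
Because the step of a class ends on the flats of this class, two charts that come close to each
other agree: the one of the higher class is projected into the flat of the lower one, and
conversely the lower one is covered by the higher one, by a fixed point argument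
(`FlatAtlas.exists_chart_eq`). Hence the union of the charts is a closed submanifold
(`FlatAtlas.isClosedSubmanifold_gluedManifold`) which is `O(d)`-close to `X`
(`FlatAtlas.exists_mem_gluedManifold_near`, `FlatAtlas.exists_net_point`). No separability is used,
since only the centres in one ball matter for each local statement.

**Normal projection.** In a chart, the foot point of `x` solves an equation
`u = affine (x) + footRemainder (x, u)` whose nonlinear part is `O(d)` in all derivatives. The
contraction principle gives a solution, and a quantitative implicit function theorem
(`hasDerivBounds_of_implicit`) shows that it is affine up to `O(d)` in all derivatives. A chord of
the manifold deviates from the tangent space at most quadratically (`FlatAtlas.abs_inner_chord_le`),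
so that a normal vector of length slightly above `1/3` still has its foot as the unique nearest
point (`FlatAtlas.norm_lt_norm_sub`). This gives the normal projection `P` on the
`1/3`-neighbourhood with all its bounds (`FlatAtlas.exists_normalProjection`).

**Consequences.** The other two claims follow from the existence of `P`. The inverse of the
normal exponential map is `x ↦ (P x, x - P x)` (`IsNormalProjection.normalExpDiffeoOn`). A
parametrization satisfies `φ = P ∘ φ`, and as `dP` takes values in the tangent space, the second
fundamental form is the normal part of `d²P (dφ, dφ)`
(`IsNormalProjection.secondFundamentalFormBoundedBy`).
-/

/-! ### Derivative bounds -/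

section DerivBounds

variable {D E F G : Type*} [NormedAddCommGroup D] [NormedSpace ℝ D]
  [NormedAddCommGroup E] [NormedSpace ℝ E] [NormedAddCommGroup F] [NormedSpace ℝ F]
  [NormedAddCommGroup G] [NormedSpace ℝ G]

/-- `f` is smooth on `s` and its `k`-th derivative is bounded by `B k` there, for every `k`
(including the function itself, for `k = 0`). The set `s` is open in all uses. -/
def HasDerivBounds (f : E → F) (s : Set E) (B : ℕ → ℝ) : Prop :=
  ContDiffOn ℝ ∞ f s ∧ ∀ k, ∀ x ∈ s, ‖iteratedFDeriv ℝ k f x‖ ≤ B k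

/-- The bound for the derivatives of a product given by the Leibniz rule. -/
def leibnizBound (A B : ℕ → ℝ) (k : ℕ) : ℝ :=
  ∑ i ∈ Finset.range (k + 1), (k.choose i : ℝ) * A i * B (k - i)

/-- A bound for the derivatives of `g ∘ f`, where those of `g` are bounded by `B` and those of `f`
by `A`. It is linear in `B`. -/
def compBound (B A : ℕ → ℝ) (k : ℕ) : ℝ :=
  k.factorial * (∑ j ∈ Finset.range (k + 1), B j) * (1 + ∑ j ∈ Finset.range (k + 1), A j) ^ k

/-- The derivative bounds of an affine map with values bounded by `R` and linear part bounded
by `l`. -/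
def affineBound (R l : ℝ) : ℕ → ℝ
  | 0 => R
  | 1 => l
  | _ => 0

theorem leibnizBound_mul_right (A B : ℕ → ℝ) (d : ℝ) :
    leibnizBound A (fun k => B k * d) = fun k => leibnizBound A B k * d := by
  funext k
  simp only [leibnizBound, Finset.sum_mul]
  exact Finset.sum_congr rfl fun i _ => by ring

theorem leibnizBound_mul_left (A B : ℕ → ℝ) (d : ℝ) :
    leibnizBound (fun k => A k * d) B = fun k => leibnizBound A B k * d := by
  funext k
  simp only [leibnizBound, Finset.sum_mul]
  exact Finset.sum_congr rfl fun i _ => by ring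

theorem compBound_mul (B A : ℕ → ℝ) (d : ℝ) :
    compBound (fun k => B k * d) A = fun k => compBound B A k * d := by
  funext k
  simp only [compBound, ← Finset.sum_mul]
  ring

theorem affineBound_mul (R l d : ℝ) :
    affineBound (R * d) (l * d) = fun k => affineBound R l k * d := by
  funext k
  match k with
  | 0 => rfl
  | 1 => rfl
  | k + 2 => simp [affineBound]

theorem affineBound_nonneg {R l : ℝ} (hR : 0 ≤ R) (hl : 0 ≤ l) (k : ℕ) : 0 ≤ affineBound R l k := by
  match k with
  | 0 => exact hR
  | 1 => exact hl
  | k + 2 => exact le_rfl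

theorem leibnizBound_nonneg {A B : ℕ → ℝ} (hA : ∀ k, 0 ≤ A k) (hB : ∀ k, 0 ≤ B k) (k : ℕ) :
    0 ≤ leibnizBound A B k :=
  Finset.sum_nonneg fun i _ => mul_nonneg (mul_nonneg (by positivity) (hA _)) (hB _)

theorem compBound_nonneg {B A : ℕ → ℝ} (hB : ∀ k, 0 ≤ B k) (hA : ∀ k, 0 ≤ A k) (k : ℕ) :
    0 ≤ compBound B A k := by
  have h1 := Finset.sum_nonneg fun i (_ : i ∈ Finset.range (k + 1)) => hA i
  have h2 := Finset.sum_nonneg fun i (_ : i ∈ Finset.range (k + 1)) => hB i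
  unfold compBound
  positivity

namespace HasDerivBounds

variable {f f' : E → F} {s t : Set E} {A B B' : ℕ → ℝ}

theorem nonneg (h : HasDerivBounds f s B) {x : E} (hx : x ∈ s) (k : ℕ) : 0 ≤ B k :=
  (norm_nonneg _).trans (h.2 k x hx)

theorem norm_le (h : HasDerivBounds f s B) {x : E} (hx : x ∈ s) : ‖f x‖ ≤ B 0 := by
  simpa using h.2 0 x hx

theorem norm_fderiv_le (h : HasDerivBounds f s B) {x : E} (hx : x ∈ s) :
    ‖fderiv ℝ f x‖ ≤ B 1 := by
  simpa [norm_iteratedFDeriv_one] using h.2 1 x hx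

theorem mono (h : HasDerivBounds f s B) (hB : ∀ k, B k ≤ B' k) : HasDerivBounds f s B' :=
  ⟨h.1, fun k x hx => (h.2 k x hx).trans (hB k)⟩

theorem subset (h : HasDerivBounds f s B) (hst : t ⊆ s) : HasDerivBounds f t B :=
  ⟨h.1.mono hst, fun k x hx => h.2 k x (hst hx)⟩

theorem contDiffAt (hs : IsOpen s) (h : HasDerivBounds f s B) {x : E} (hx : x ∈ s) :
    ContDiffAt ℝ ∞ f x :=
  h.1.contDiffAt (hs.mem_nhds hx)

theorem differentiableAt (hs : IsOpen s) (h : HasDerivBounds f s B) {x : E} (hx : x ∈ s) :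
    DifferentiableAt ℝ f x :=
  (h.contDiffAt hs hx).differentiableAt (by simp)

/-- Derivative bounds are local. -/
theorem of_local (h : ∀ x ∈ s, ∃ (g : E → F) (u : Set E), IsOpen u ∧ x ∈ u ∧ f =ᶠ[nhds x] g ∧
    HasDerivBounds g u B) : HasDerivBounds f s B := by
  refine ⟨fun x hx => ?_, fun k x hx => ?_⟩
  · obtain ⟨g, u, hu, hxu, hfg, hg⟩ := h x hx
    exact ((hg.contDiffAt hu hxu).congr_of_eventuallyEq hfg).contDiffWithinAt
  · obtain ⟨g, u, hu, hxu, hfg, hg⟩ := h x hx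
    rw [(hfg.iteratedFDeriv ℝ k).eq_of_nhds]
    exact hg.2 k x hxu

theorem congr (hs : IsOpen s) (h : HasDerivBounds f s B) (hff : Set.EqOn f' f s) :
    HasDerivBounds f' s B :=
  of_local fun _ hx => ⟨f, s, hs, hx, hff.eventuallyEq_of_mem (hs.mem_nhds hx), h⟩

theorem zero : HasDerivBounds (fun _ : E => (0 : F)) s (fun _ => 0) :=
  ⟨contDiffOn_const, fun k _ _ => by simp [iteratedFDeriv_fun_zero]⟩

theorem add (hs : IsOpen s) (h : HasDerivBounds f s B) (h' : HasDerivBounds f' s B') :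
    HasDerivBounds (fun x => f x + f' x) s (fun k => B k + B' k) := by
  refine ⟨h.1.add h'.1, fun k x hx => ?_⟩
  have hk : (k : ℕ∞ω) ≤ (∞ : ℕ∞ω) := by exact_mod_cast le_top
  rw [show (fun x => f x + f' x) = f + f' from rfl,
    iteratedFDeriv_add_apply ((h.contDiffAt hs hx).of_le hk) ((h'.contDiffAt hs hx).of_le hk)]
  exact (norm_add_le _ _).trans (add_le_add (h.2 k x hx) (h'.2 k x hx))

theorem clm_comp (hs : IsOpen s) (h : HasDerivBounds f s B) (L : F →L[ℝ] G) (hL : ‖L‖ ≤ 1) :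
    HasDerivBounds (fun x => L (f x)) s B := by
  refine ⟨L.contDiff.comp_contDiffOn h.1, fun k x hx => ?_⟩
  have hk : (k : ℕ∞ω) ≤ (∞ : ℕ∞ω) := by exact_mod_cast le_top
  have := L.norm_iteratedFDeriv_comp_left (h.contDiffAt hs hx) hk
  refine this.trans ?_
  have h0 := norm_nonneg (iteratedFDeriv ℝ k f x)
  have h1 := h.2 k x hx
  nlinarith

theorem neg (hs : IsOpen s) (h : HasDerivBounds f s B) :
    HasDerivBounds (fun x => -f x) s B := by
  simpa using h.clm_comp hs (-ContinuousLinearMap.id ℝ F)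
    (by rw [norm_neg]; exact ContinuousLinearMap.norm_id_le)

theorem sub (hs : IsOpen s) (h : HasDerivBounds f s B) (h' : HasDerivBounds f' s B') :
    HasDerivBounds (fun x => f x - f' x) s (fun k => B k + B' k) := by
  simpa [sub_eq_add_neg] using h.add hs (h'.neg hs)

theorem fderiv (h : HasDerivBounds f s B) (hs : IsOpen s) :
    HasDerivBounds (fderiv ℝ f) s (fun k => B (k + 1)) := by
  refine ⟨h.1.fderiv_of_isOpen hs (by simp), fun k x hx => ?_⟩
  rw [norm_iteratedFDeriv_fderiv]
  exact h.2 (k + 1) x hx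

theorem bilin (hs : IsOpen s) {g : E → G} (hf : HasDerivBounds f s A) (hg : HasDerivBounds g s B)
    (L : F →L[ℝ] G →L[ℝ] D) (hL : ‖L‖ ≤ 1) :
    HasDerivBounds (fun x => L (f x) (g x)) s (leibnizBound A B) := by
  refine ⟨?_, fun k x hx => ?_⟩
  · exact L.isBoundedBilinearMap.contDiff.comp₂_contDiffOn hf.1 hg.1
  · have hk : (k : ℕ∞ω) ≤ (∞ : ℕ∞ω) := by exact_mod_cast le_top
    have := L.norm_iteratedFDerivWithin_le_of_bilinear_of_le_one hf.1 hg.1 hs.uniqueDiffOn hx hk hL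
    simp only [iteratedFDerivWithin_of_isOpen _ hs hx] at this
    refine this.trans (Finset.sum_le_sum fun i _ => ?_)
    have h1 := hf.2 i x hx
    have h2 := hg.2 (k - i) x hx
    have h3 := hf.nonneg hx i
    gcongr

theorem comp (hs : IsOpen s) {g : F → G} {t : Set F} (ht : IsOpen t)
    (hg : HasDerivBounds g t B) (hf : ContDiffOn ℝ ∞ f s)
    (hA : ∀ k, 1 ≤ k → ∀ x ∈ s, ‖iteratedFDeriv ℝ k f x‖ ≤ A k) (hA0 : 0 ≤ A 0)
    (hst : Set.MapsTo f s t) :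
    HasDerivBounds (fun x => g (f x)) s (compBound B A) := by
  refine ⟨hg.1.comp hf hst, fun k x hx => ?_⟩
  have hk : (k : ℕ∞ω) ≤ (∞ : ℕ∞ω) := by exact_mod_cast le_top
  have hA' : ∀ j, 0 ≤ A j := fun j => by
    rcases Nat.eq_zero_or_pos j with rfl | hj
    · exact hA0
    · exact (norm_nonneg _).trans (hA j hj x hx)
  have hB' : ∀ j, 0 ≤ B j := fun j => hg.nonneg (hst hx) j
  have := norm_iteratedFDerivWithin_comp_le (n := k) hg.1 hf hk ht.uniqueDiffOn hs.uniqueDiffOn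
    hst hx (C := ∑ j ∈ Finset.range (k + 1), B j) (D := 1 + ∑ j ∈ Finset.range (k + 1), A j)
    (fun i hi => ?_) (fun i hi hik => ?_)
  · rw [iteratedFDerivWithin_of_isOpen _ hs hx] at this
    exact this
  · rw [iteratedFDerivWithin_of_isOpen _ ht (hst hx)]
    refine (hg.2 i _ (hst hx)).trans ?_
    exact Finset.single_le_sum (f := B) (fun j _ => hB' j) (Finset.mem_range.2 (by omega))
  · rw [iteratedFDerivWithin_of_isOpen _ hs hx]
    have h1 : A i ≤ ∑ j ∈ Finset.range (k + 1), A j :=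
      Finset.single_le_sum (fun j _ => hA' j) (Finset.mem_range.2 (by omega))
    have h2 : 0 ≤ ∑ j ∈ Finset.range (k + 1), A j := Finset.sum_nonneg fun j _ => hA' j
    calc ‖iteratedFDeriv ℝ i f x‖ ≤ 1 + ∑ j ∈ Finset.range (k + 1), A j := by
          linarith [hA i hi x hx]
      _ ≤ _ := le_self_pow₀ (by linarith) (by omega)

theorem comp' (hs : IsOpen s) {g : F → G} {t : Set F} (ht : IsOpen t)
    (hg : HasDerivBounds g t B) (hf : HasDerivBounds f s A) (hst : Set.MapsTo f s t) :
    HasDerivBounds (fun x => g (f x)) s (compBound B A) := by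
  refine of_local fun _ hx => ⟨_, s, hs, hx, Filter.EventuallyEq.rfl, ?_⟩
  exact comp hs ht hg hf.1 (fun k _ => hf.2 k) (hf.nonneg hx 0) hst

theorem affine (L : E →L[ℝ] F) (c : F) {R l : ℝ} (hR : ∀ x ∈ s, ‖c + L x‖ ≤ R) (hl : ‖L‖ ≤ l) :
    HasDerivBounds (fun x => c + L x) s (affineBound R l) := by
  refine ⟨(contDiff_const.add L.contDiff).contDiffOn, fun k x hx => ?_⟩
  have hd : _root_.fderiv ℝ (fun x => c + L x) = fun _ => L := by
    funext y
    rw [fderiv_const_add]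
    exact L.fderiv
  match k with
  | 0 => simpa [affineBound] using hR x hx
  | 1 => simpa [affineBound, norm_iteratedFDeriv_one, hd] using hl
  | k + 2 =>
    rw [← norm_iteratedFDeriv_fderiv, hd, iteratedFDeriv_succ_const]
    simp [affineBound]

/-- Second and higher derivatives do not see an affine summand. -/
theorem iteratedFDeriv_affine_add (hs : IsOpen s) (h : HasDerivBounds f s B) (L : E →L[ℝ] F) (c : F)
    {k : ℕ} (hk : 2 ≤ k) {x : E} (hx : x ∈ s) :
    ‖iteratedFDeriv ℝ k (fun x => (c + L x) + f x) x‖ ≤ B k := by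
  have ha := affine (s := {x}) L c (R := ‖c + L x‖) (l := ‖L‖) (by simp) le_rfl
  have hk' : (k : ℕ∞ω) ≤ (∞ : ℕ∞ω) := by exact_mod_cast le_top
  have hc : ContDiff ℝ ∞ (fun x => c + L x) := contDiff_const.add L.contDiff
  rw [show (fun x => (c + L x) + f x) = (fun x => c + L x) + f from rfl,
    iteratedFDeriv_add_apply (hc.contDiffAt.of_le hk') ((h.contDiffAt hs hx).of_le hk')]
  have h0 : ‖iteratedFDeriv ℝ k (fun x => c + L x) x‖ ≤ 0 := by
    refine (ha.2 k x rfl).trans (le_of_eq ?_)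
    match k, hk with
    | k + 2, _ => rfl
  exact (norm_add_le _ _).trans (by linarith [h.2 k x hx])

/-- A function whose first derivative is bounded by `κ` on a convex open set is `κ`-Lipschitz
there. -/
theorem norm_sub_le (hs : IsOpen s) (hc : Convex ℝ s) (h : HasDerivBounds f s B) {x y : E}
    (hx : x ∈ s) (hy : y ∈ s) : ‖f y - f x‖ ≤ B 1 * ‖y - x‖ :=
  hc.norm_image_sub_le_of_norm_fderiv_le (fun _ hz => h.differentiableAt hs hz)
    (fun _ hz => h.norm_fderiv_le hz) hx hy

/-- Taylor's formula of first order, with the constant `B 2` instead of `B 2 / 2`. -/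
theorem norm_sub_sub_fderiv_le (hs : IsOpen s) (hc : Convex ℝ s) (h : HasDerivBounds f s B)
    {x y : E} (hx : x ∈ s) (hy : y ∈ s) :
    ‖f y - f x - _root_.fderiv ℝ f x (y - x)‖ ≤ B 2 * ‖y - x‖ ^ 2 := by
  have hL : ∀ z ∈ segment ℝ x y, ‖_root_.fderiv ℝ f z - _root_.fderiv ℝ f x‖ ≤ B 2 * ‖y - x‖ := by
    intro z hz
    have hzs : z ∈ s := hc.segment_subset hx hy hz
    refine ((h.fderiv hs).norm_sub_le hs hc hx hzs).trans ?_
    have : ‖z - x‖ ≤ ‖y - x‖ := by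
      obtain ⟨a, b, ha, hb, hab, rfl⟩ := hz
      have : a • x + b • y - x = b • (y - x) := by
        rw [show a = 1 - b by linarith]; module
      rw [this, norm_smul, Real.norm_of_nonneg hb]
      exact mul_le_of_le_one_left (norm_nonneg _) (by linarith)
    exact mul_le_mul_of_nonneg_left this (h.nonneg hx 2)
  have hseg : ∀ z ∈ segment ℝ x y, HasFDerivWithinAt f (_root_.fderiv ℝ f z) (segment ℝ x y) z :=
    fun z hz => (h.differentiableAt hs (hc.segment_subset hx hy hz)).hasFDerivAt.hasFDerivWithinAt
  have := (convex_segment x y).norm_image_sub_le_of_norm_hasFDerivWithin_le' hseg hL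
    (left_mem_segment ℝ x y) (right_mem_segment ℝ x y)
  nlinarith [this]

end HasDerivBounds

/-- A smooth function has derivative bounds on every bounded interval. -/
theorem exists_hasDerivBounds_Ioo {χ : ℝ → ℝ} (hχ : ContDiff ℝ ∞ χ) (a b : ℝ) :
    ∃ B : ℕ → ℝ, (∀ k, 0 ≤ B k) ∧ HasDerivBounds χ (Set.Ioo a b) B := by
  have : ∀ k : ℕ, ∃ C : ℝ, 0 ≤ C ∧ ∀ x ∈ Set.Icc a b, ‖iteratedFDeriv ℝ k χ x‖ ≤ C := by
    intro k
    have hc : Continuous (iteratedFDeriv ℝ k χ) :=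
      hχ.continuous_iteratedFDeriv (by exact_mod_cast le_top)
    obtain ⟨C, hC⟩ := isCompact_Icc.exists_bound_of_continuousOn (s := Set.Icc a b) hc.continuousOn
    exact ⟨max C 0, le_max_right _ _, fun x hx => (hC x hx).trans (le_max_left _ _)⟩
  choose B hB0 hB using this
  exact ⟨B, hB0, hχ.contDiffOn, fun k x hx => hB k x (Set.Ioo_subset_Icc_self hx)⟩

end DerivBounds

/-! ### A smooth cut-off function -/

section Bump

/-- A smooth radial cut-off function on an inner product space: it is `1` on the ball of radius
`3/10` and vanishes outside the ball of radius `4/10`. -/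
noncomputable def cutoff {E : Type*} [NormedAddCommGroup E] (z : E) : ℝ :=
  Real.smoothTransition ((16 - 100 * ‖z‖ ^ 2) / 7)

theorem cutoff_eq_one {E : Type*} [NormedAddCommGroup E] {z : E} (hz : ‖z‖ ≤ 3 / 10) :
    cutoff z = 1 := by
  apply Real.smoothTransition.one_of_one_le
  have := norm_nonneg z
  rw [le_div_iff₀ (by norm_num)]
  nlinarith

theorem cutoff_eq_zero {E : Type*} [NormedAddCommGroup E] {z : E} (hz : 4 / 10 ≤ ‖z‖) :
    cutoff z = 0 := by
  apply Real.smoothTransition.zero_of_nonpos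
  rw [div_le_iff₀ (by norm_num)]
  nlinarith

/-- The derivatives of the cut-off function have bounds that do not depend on the space. -/
theorem exists_cutoff_bounds : ∃ B : ℕ → ℝ, (∀ k, 0 ≤ B k) ∧
    ∀ (E : Type*) [NormedAddCommGroup E] [InnerProductSpace ℝ E],
      HasDerivBounds (cutoff : E → ℝ) (Metric.ball 0 1) B := by
  have hχ : ContDiff ℝ ∞ (fun t : ℝ => Real.smoothTransition ((16 - 100 * t) / 7)) :=
    Real.smoothTransition.contDiff.comp (by fun_prop)
  obtain ⟨B, hB0, hB⟩ := exists_hasDerivBounds_Ioo hχ (-1) 1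
  have ha : ∀ k, 0 ≤ affineBound 1 1 k := affineBound_nonneg zero_le_one zero_le_one
  refine ⟨compBound B (leibnizBound (affineBound 1 1) (affineBound 1 1)),
    compBound_nonneg hB0 (leibnizBound_nonneg ha ha), ?_⟩
  intro E _ _
  have hid : HasDerivBounds (fun x : E => 0 + ContinuousLinearMap.id ℝ E x) (Metric.ball 0 1)
      (affineBound 1 1) :=
    HasDerivBounds.affine _ _ (fun x hx => by simpa using (mem_ball_zero_iff.1 hx).le)
      ContinuousLinearMap.norm_id_le
  have hsq : HasDerivBounds (fun x : E => ‖x‖ ^ 2) (Metric.ball 0 1)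
      (leibnizBound (affineBound 1 1) (affineBound 1 1)) := by
    refine (HasDerivBounds.bilin Metric.isOpen_ball hid hid (innerSL ℝ)
      (norm_innerSL_le _)).congr Metric.isOpen_ball fun x _ => ?_
    simp only [zero_add, ContinuousLinearMap.id_apply]
    exact (real_inner_self_eq_norm_sq x).symm
  have hm : Set.MapsTo (fun x : E => ‖x‖ ^ 2) (Metric.ball 0 1) (Set.Ioo (-1) 1) := by
    intro x hx
    have := mem_ball_zero_iff.1 hx
    have h0 := norm_nonneg x
    constructor <;> nlinarith
  have := HasDerivBounds.comp' Metric.isOpen_ball isOpen_Ioo hB hsq hm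
  exact this

end Bump

/-! ### Derivative bounds for implicit equations -/

section Implicit

/-- Bounds for the derivatives, up to order `k`, of the solution of an implicit equation whose
nonlinear part has derivatives bounded by `B`. -/
noncomputable def implicitBound (B : ℕ → ℝ) : ℕ → ℝ
  | 0 => B 0
  | k + 1 => implicitBound B k +
      2 * (k.factorial * (∑ j ∈ Finset.range (k + 1), B (j + 1)) * (2 + implicitBound B k) ^ k) *
        (1 + 2 ^ k * implicitBound B k)

theorem implicitBound_nonneg {B : ℕ → ℝ} (hB : ∀ k, 0 ≤ B k) (k : ℕ) : 0 ≤ implicitBound B k := by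
  induction k with
  | zero => exact hB 0
  | succ k ih =>
    have := Finset.sum_nonneg fun j (_ : j ∈ Finset.range (k + 1)) => hB (j + 1)
    unfold implicitBound
    positivity

theorem implicitBound_mono {B : ℕ → ℝ} (hB : ∀ k, 0 ≤ B k) : Monotone (implicitBound B) := by
  refine monotone_nat_of_le_succ fun k => ?_
  have h1 := Finset.sum_nonneg fun j (_ : j ∈ Finset.range (k + 1)) => hB (j + 1)
  have h2 := implicitBound_nonneg hB k
  rw [implicitBound]
  have : 0 ≤ 2 * (k.factorial * (∑ j ∈ Finset.range (k + 1), B (j + 1)) *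
    (2 + implicitBound B k) ^ k) * (1 + 2 ^ k * implicitBound B k) := by positivity
  linarith

variable {E F : Type*} [NormedAddCommGroup E] [NormedSpace ℝ E] [NormedAddCommGroup F]
  [NormedSpace ℝ F]

theorem ContDiffOn.contDiffAt_nat {f : E → F} {D : Set E} (hf : ContDiffOn ℝ ∞ f D) (hD : IsOpen D)
    {x : E} (hx : x ∈ D) (m : ℕ) : ContDiffAt ℝ m f x :=
  (hf.contDiffAt (hD.mem_nhds hx)).of_le (by exact_mod_cast le_top)

/-- A continuous solution `u` of `u x = c + L x + R (x, u x)` is smooth if `R` is smooth and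
contracting in its second variable. -/
theorem contDiffOn_of_implicit [CompleteSpace E] [CompleteSpace F] {D : Set E} {U : Set F}
    (hD : IsOpen D) (hU : IsOpen U) {R : E × F → F} (hR : ContDiffOn ℝ ∞ R (D ×ˢ U))
    (hR1 : ∀ q ∈ D ×ˢ U, ‖fderiv ℝ R q‖ ≤ 1 / 2) (L : E →L[ℝ] F) (c : F) {u : E → F}
    (huc : ContinuousOn u D) (huU : Set.MapsTo u D U)
    (hu : ∀ x ∈ D, u x = (c + L x) + R (x, u x)) : ContDiffOn ℝ ∞ u D := by
  intro x hx
  refine ContDiffAt.contDiffWithinAt ?_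
  have hq : (x, u x) ∈ D ×ˢ U := ⟨hx, huU hx⟩
  have hRat : ContDiffAt ℝ ∞ R (x, u x) := hR.contDiffAt ((hD.prod hU).mem_nhds hq)
  set f : E × F → F := fun q => q.2 - (c + L q.1) - R q with hf
  have cdf : ContDiffAt ℝ ∞ f (x, u x) := by
    refine (contDiffAt_snd.sub ?_).sub hRat
    exact contDiffAt_const.add (L.contDiff.contDiffAt.comp _ contDiffAt_fst)
  have hRd : HasFDerivAt R (fderiv ℝ R (x, u x)) (x, u x) :=
    (hRat.differentiableAt (by simp)).hasFDerivAt
  have hfd : HasFDerivAt f (ContinuousLinearMap.snd ℝ E F - L ∘L ContinuousLinearMap.fst ℝ E F -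
      fderiv ℝ R (x, u x)) (x, u x) := by
    refine (hasFDerivAt_snd.sub ?_).sub hRd
    exact (L.hasFDerivAt.comp _ hasFDerivAt_fst).const_add c
  have hinr : fderiv ℝ f (x, u x) ∘L ContinuousLinearMap.inr ℝ E F =
      1 - fderiv ℝ R (x, u x) ∘L ContinuousLinearMap.inr ℝ E F := by
    rw [hfd.fderiv]
    ext v
    simp
  have hn : ‖fderiv ℝ R (x, u x) ∘L ContinuousLinearMap.inr ℝ E F‖ < 1 := by
    have h1 := (fderiv ℝ R (x, u x)).opNorm_comp_le (ContinuousLinearMap.inr ℝ E F)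
    have h2 := ContinuousLinearMap.norm_inr_le_one ℝ E F
    have h3 := hR1 _ hq
    have h4 := norm_nonneg (fderiv ℝ R (x, u x))
    nlinarith
  have inv : (fderiv ℝ f (x, u x) ∘L ContinuousLinearMap.inr ℝ E F).IsInvertible := by
    rw [hinr]
    obtain ⟨e, he⟩ := isUnit_one_sub_of_norm_lt_one hn
    exact ⟨ContinuousLinearEquiv.ofUnit e, by rw [← he]; rfl⟩
  have hev := cdf.eventually_apply_eq_iff_implicitFunction (by simp) inv
  have hcont : ContinuousAt (fun y => (y, u y)) x :=
    continuousAt_id.prodMk (huc.continuousAt (hD.mem_nhds hx))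
  have h0 : ∀ y ∈ D, f (y, u y) = 0 := by
    intro y hy
    simp only [hf]
    nth_rewrite 1 [hu y hy]
    abel
  have hev' : u =ᶠ[nhds x] cdf.implicitFunction (by simp) inv := by
    filter_upwards [hcont.eventually hev, hD.mem_nhds hx] with y hy hyD
    exact (hy.1 (by rw [h0 y hyD, h0 x hx])).symm
  exact (cdf.contDiffAt_implicitFunction (by simp) inv).congr_of_eventuallyEq hev'

/-- Quantitative implicit function theorem for a small perturbation of a linear map: if
`u x = c + L x + R (x, u x)` and all derivatives of `R` are `O(d)`, then all derivatives of
`u - c - L` are `O(d)`. -/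
theorem hasDerivBounds_of_implicit [CompleteSpace E] [CompleteSpace F] {D : Set E} {U : Set F}
    (hD : IsOpen D) (hU : IsOpen U) {R : E × F → F} {B : ℕ → ℝ} {d : ℝ} (hd0 : 0 ≤ d) (hd1 : d ≤ 1)
    (hB : ∀ k, 0 ≤ B k)
    (hR : HasDerivBounds R (D ×ˢ U) (fun k => B k * d)) (hR1 : B 1 * d ≤ 1 / 2)
    (L : E →L[ℝ] F) (hL : ‖L‖ ≤ 1) (c : F) {u : E → F}
    (huc : ContinuousOn u D) (huU : Set.MapsTo u D U)
    (hu : ∀ x ∈ D, u x = (c + L x) + R (x, u x)) :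
    HasDerivBounds (fun x => R (x, u x)) D (fun k => implicitBound B k * d) := by
  have hus : ContDiffOn ℝ ∞ u D := contDiffOn_of_implicit hD hU hR.1
    (fun q hq => (hR.norm_fderiv_le hq).trans hR1) L c huc huU hu
  have hO : IsOpen (D ×ˢ U) := hD.prod hU
  set w : E → F := fun x => R (x, u x) with hw
  have hΓm : Set.MapsTo (fun x => (x, u x)) D (D ×ˢ U) := fun x hx => ⟨hx, huU hx⟩
  have hws : ContDiffOn ℝ ∞ w D := hR.1.comp (contDiffOn_id.prodMk hus) hΓm
  refine ⟨hws, ?_⟩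
  -- The graph map `x ↦ (x, u x)` and the derivative of `R` along it.
  set N : E →L[ℝ] E × F := (ContinuousLinearMap.id ℝ E).prod L with hN
  have hN1 : ‖N‖ ≤ 1 := by
    refine ContinuousLinearMap.opNorm_le_bound _ zero_le_one fun x => ?_
    simp only [hN, ContinuousLinearMap.prod_apply, ContinuousLinearMap.id_apply, Prod.norm_def,
      one_mul]
    exact max_le le_rfl ((L.le_opNorm x).trans (mul_le_of_le_one_left (norm_nonneg _) hL))
  set J : F →L[ℝ] E × F := ContinuousLinearMap.inr ℝ E F with hJ
  have hJ1 : ‖J‖ ≤ 1 := ContinuousLinearMap.norm_inr_le_one ℝ E F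
  set Γ : E → E × F := fun x => (((0 : E), c) + N x) + J (w x) with hΓ
  have hΓe : Set.EqOn Γ (fun x => (x, u x)) D := by
    intro x hx
    simp only [hΓ, hN, hJ, ContinuousLinearMap.prod_apply, ContinuousLinearMap.id_apply,
      ContinuousLinearMap.inr_apply, Prod.mk_add_mk, zero_add, add_zero]
    rw [← hu x hx]
  have hΓm' : Set.MapsTo Γ D (D ×ˢ U) := fun x hx => by rw [hΓe hx]; exact hΓm hx
  have hΓs : ContDiffOn ℝ ∞ Γ D := by
    refine ContDiffOn.add ?_ (J.contDiff.comp_contDiffOn hws)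
    exact (contDiff_const.add N.contDiff).contDiffOn
  have hwΓ : Set.EqOn w (fun x => R (Γ x)) D := fun x hx => by
    simp only [hw]; rw [hΓe hx]
  set a : E → (E × F →L[ℝ] F) := fun x => fderiv ℝ R (Γ x) with ha
  have hR' := hR.fderiv hO
  have has : ContDiffOn ℝ ∞ a D := hR'.1.comp hΓs hΓm'
  have hw's : ContDiffOn ℝ ∞ (fderiv ℝ w) D := hws.fderiv_of_isOpen hD (by simp)
  have hderiv : ∀ x ∈ D, fderiv ℝ w x = a x ∘L N + a x ∘L (J ∘L fderiv ℝ w x) := by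
    intro x hx
    have h1 : HasFDerivAt w (fderiv ℝ w x) x :=
      ((hws.contDiffAt (hD.mem_nhds hx)).differentiableAt (by simp)).hasFDerivAt
    have h2 : HasFDerivAt Γ (N + J ∘L fderiv ℝ w x) x :=
      (N.hasFDerivAt.const_add _).add (J.hasFDerivAt.comp x h1)
    have h3 : HasFDerivAt R (a x) (Γ x) := (hR.differentiableAt hO (hΓm' hx)).hasFDerivAt
    have h4 := (h3.comp x h2).congr_of_eventuallyEq
      (hwΓ.eventuallyEq_of_mem (hD.mem_nhds hx))
    rw [← ContinuousLinearMap.comp_add]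
    exact h4.fderiv
  suffices H : ∀ k, ∀ x ∈ D, ∀ j ≤ k, ‖iteratedFDeriv ℝ j w x‖ ≤ implicitBound B k * d from
    fun k x hx => H k x hx k le_rfl
  intro k x hx
  induction k with
  | zero =>
    intro j hj
    obtain rfl : j = 0 := by omega
    have := hR.norm_le (hΓm hx)
    simpa [implicitBound, hw] using this
  | succ k ih =>
    set S := implicitBound B k with hS
    have hS0 : 0 ≤ S := implicitBound_nonneg hB k
    set SB := ∑ j ∈ Finset.range (k + 1), B (j + 1) with hSB
    have hSB0 : 0 ≤ SB := Finset.sum_nonneg fun j _ => hB (j + 1)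
    have hSd : S * d ≤ S := mul_le_of_le_one_right hS0 hd1
    have hΓk : ∀ j, 1 ≤ j → j ≤ k → ‖iteratedFDeriv ℝ j Γ x‖ ≤ (2 + S) ^ j := by
      intro j hj hjk
      have e1 : iteratedFDeriv ℝ j Γ x = iteratedFDeriv ℝ j (fun x => ((0 : E), c) + N x) x +
          iteratedFDeriv ℝ j (fun x => J (w x)) x :=
        iteratedFDeriv_add_apply ((contDiff_const.add N.contDiff).contDiffAt)
          (J.contDiff.contDiffAt.comp x (hws.contDiffAt_nat hD hx j))
      have e2 := (HasDerivBounds.affine (s := {x}) N ((0 : E), c) (R := ‖((0 : E), c) + N x‖)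
        (by simp) hN1).2 j x rfl
      have e3 : affineBound ‖((0 : E), c) + N x‖ 1 j ≤ 1 := by
        match j, hj with
        | 1, _ => exact le_rfl
        | j + 2, _ => exact zero_le_one
      have e4 := J.norm_iteratedFDeriv_comp_left (n := j) (hws.contDiffAt_nat hD hx j) le_rfl
      have e5 := ih j hjk
      have e6 : ‖J‖ * ‖iteratedFDeriv ℝ j w x‖ ≤ S :=
        (mul_le_of_le_one_left (norm_nonneg _) hJ1).trans (e5.trans hSd)
      rw [e1]
      refine (norm_add_le _ _).trans ?_
      have : (2 + S) ≤ (2 + S) ^ j := le_self_pow₀ (by linarith) (by omega)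
      have e7 : ‖iteratedFDeriv ℝ j (fun x => J (w x)) x‖ ≤ S := e4.trans e6
      linarith
    set Q := k.factorial * SB * (2 + S) ^ k with hQ
    have hQ0 : 0 ≤ Q := by positivity
    have hak : ∀ i ≤ k, ‖iteratedFDeriv ℝ i a x‖ ≤ Q * d := by
      intro i hi
      have hi' : (i : ℕ∞ω) ≤ (∞ : ℕ∞ω) := by exact_mod_cast le_top
      have := norm_iteratedFDerivWithin_comp_le (n := i) hR'.1 hΓs hi' hO.uniqueDiffOn
        hD.uniqueDiffOn hΓm' hx (C := SB * d) (D := 2 + S) ?_ ?_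
      · rw [iteratedFDerivWithin_of_isOpen _ hD hx] at this
        refine this.trans ?_
        have f1 : (i.factorial : ℝ) ≤ k.factorial := by exact_mod_cast Nat.factorial_le hi
        have f2 : (2 + S) ^ i ≤ (2 + S) ^ k := pow_le_pow_right₀ (by linarith) hi
        calc (i.factorial : ℝ) * (SB * d) * (2 + S) ^ i
            ≤ k.factorial * (SB * d) * (2 + S) ^ k := by gcongr
          _ = Q * d := by rw [hQ]; ring
      · intro j hj
        rw [iteratedFDerivWithin_of_isOpen _ hO (hΓm' hx)]
        refine (hR'.2 j _ (hΓm' hx)).trans ?_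
        refine mul_le_mul_of_nonneg_right ?_ hd0
        exact Finset.single_le_sum (f := fun j => B (j + 1)) (fun j _ => hB (j + 1))
          (Finset.mem_range.2 (by omega))
      · intro j hj hji
        rw [iteratedFDerivWithin_of_isOpen _ hD hx]
        exact hΓk j hj (hji.trans hi)
    have ha0 : ‖a x‖ ≤ 1 / 2 := (hR.norm_fderiv_le (hΓm' hx)).trans hR1
    -- Differentiate `w' = a ∘ N + a ∘ J ∘ w'` and absorb the term of highest order.
    have hcomp : fderiv ℝ w =ᶠ[nhds x] fun y => (ContinuousLinearMap.compL ℝ E (E × F) F).flip N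
        (a y) + (ContinuousLinearMap.compL ℝ E (E × F) F) (a y)
          ((ContinuousLinearMap.compL ℝ E F (E × F)) J (fderiv ℝ w y)) := by
      filter_upwards [hD.mem_nhds hx] with y hy
      exact hderiv y hy
    set P₁ := (ContinuousLinearMap.compL ℝ E (E × F) F).flip N with hP₁
    set P₂ := (ContinuousLinearMap.compL ℝ E F (E × F)) J with hP₂
    have hP₁n : ‖P₁‖ ≤ 1 := ContinuousLinearMap.opNorm_le_bound _ zero_le_one fun A => by
      refine (A.opNorm_comp_le N).trans ?_
      rw [one_mul]; exact mul_le_of_le_one_right (norm_nonneg _) hN1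
    have hP₂n : ‖P₂‖ ≤ 1 := ContinuousLinearMap.opNorm_le_bound _ zero_le_one fun A => by
      refine (J.opNorm_comp_le A).trans ?_
      exact mul_le_mul_of_nonneg_right hJ1 (norm_nonneg _)
    have hP2s : ContDiffOn ℝ ∞ (fun y => P₂ (fderiv ℝ w y)) D := P₂.contDiff.comp_contDiffOn hw's
    have t1 : ‖iteratedFDeriv ℝ k (fun y => P₁ (a y)) x‖ ≤ Q * d := by
      refine (P₁.norm_iteratedFDeriv_comp_left (has.contDiffAt_nat hD hx k) le_rfl).trans ?_
      exact (mul_le_of_le_one_left (norm_nonneg _) hP₁n).trans (hak k le_rfl)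
    have t2 : ‖iteratedFDeriv ℝ k (fun y => (ContinuousLinearMap.compL ℝ E (E × F) F) (a y)
        (P₂ (fderiv ℝ w y))) x‖ ≤ 1 / 2 * ‖iteratedFDeriv ℝ (k + 1) w x‖ +
          2 ^ k * (Q * d * S) := by
      have hk' : (k : ℕ∞ω) ≤ (∞ : ℕ∞ω) := by exact_mod_cast le_top
      have := (ContinuousLinearMap.compL ℝ E (E × F) F
        ).norm_iteratedFDerivWithin_le_of_bilinear_of_le_one has hP2s hD.uniqueDiffOn hx hk'
        (ContinuousLinearMap.norm_compL_le ℝ E (E × F) F)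
      simp only [iteratedFDerivWithin_of_isOpen _ hD hx] at this
      refine this.trans ?_
      have hterm : ∀ j, ‖iteratedFDeriv ℝ j (fun y => P₂ (fderiv ℝ w y)) x‖ ≤
          ‖iteratedFDeriv ℝ (j + 1) w x‖ := fun j => by
        refine (P₂.norm_iteratedFDeriv_comp_left (hw's.contDiffAt_nat hD hx j) le_rfl).trans ?_
        rw [norm_iteratedFDeriv_fderiv]
        exact mul_le_of_le_one_left (norm_nonneg _) hP₂n
      rw [Finset.sum_range_succ', add_comm]
      refine add_le_add ?_ ?_
      · simp only [Nat.choose_zero_right, Nat.cast_one, one_mul, norm_iteratedFDeriv_zero,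
          Nat.sub_zero]
        exact mul_le_mul ha0 (hterm k) (norm_nonneg _) (by norm_num)
      · have hch : ∑ i ∈ Finset.range k, (k.choose (i + 1) : ℝ) ≤ 2 ^ k := by
          have h1 : ∑ i ∈ Finset.range (k + 1), (k.choose i : ℝ) = 2 ^ k := by
            exact_mod_cast Nat.sum_range_choose k
          rw [Finset.sum_range_succ'] at h1
          have : (0 : ℝ) ≤ (k.choose 0 : ℝ) := by positivity
          linarith
        refine le_trans ?_ (mul_le_mul_of_nonneg_right hch (by positivity))
        rw [Finset.sum_mul]
        refine Finset.sum_le_sum fun i hi => ?_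
        have hi := Finset.mem_range.1 hi
        rw [mul_assoc]
        refine mul_le_mul_of_nonneg_left ?_ (by positivity)
        refine mul_le_mul (hak _ (by omega)) ?_ (norm_nonneg _) (by positivity)
        refine (hterm _).trans ?_
        rw [show k - (i + 1) + 1 = k - i by omega]
        exact (ih _ (by omega)).trans hSd
    have t3 : ‖iteratedFDeriv ℝ (k + 1) w x‖ ≤ Q * d + (1 / 2 * ‖iteratedFDeriv ℝ (k + 1) w x‖ +
        2 ^ k * (Q * d * S)) := by
      rw [← norm_iteratedFDeriv_fderiv]
      nth_rewrite 1 [(hcomp.iteratedFDeriv ℝ k).eq_of_nhds]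
      rw [norm_iteratedFDeriv_fderiv]
      have e1 := iteratedFDeriv_add_apply (f := fun y => P₁ (a y))
        (g := fun y => (ContinuousLinearMap.compL ℝ E (E × F) F) (a y) (P₂ (fderiv ℝ w y)))
        (P₁.contDiff.contDiffAt.comp x (has.contDiffAt_nat hD hx k))
        (((ContinuousLinearMap.compL ℝ E (E × F) F).isBoundedBilinearMap.contDiff.comp₂_contDiffOn
          has hP2s).contDiffAt_nat hD hx k)
      refine (le_of_eq (congrArg norm e1)).trans ?_
      exact (norm_add_le _ _).trans (add_le_add t1 t2)
    intro j hj
    rcases Nat.lt_or_ge k j with hkj | hkj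
    · obtain rfl : j = k + 1 := by omega
      have : implicitBound B (k + 1) * d = S * d + 2 * (Q * d + 2 ^ k * (Q * d * S)) := by
        rw [implicitBound]; ring
      rw [this]
      have : 0 ≤ S * d := by positivity
      linarith
    · exact (ih j hkj).trans (mul_le_mul_of_nonneg_right
        (implicitBound_mono hB (Nat.le_succ k)) hd0)

end Implicit

/-! ### Fields of flats and the closeness of neighbouring flats -/

section Flats

theorem norm_le_one_of_isometry {E F : Type*} [NormedAddCommGroup E] [NormedSpace ℝ E]
    [NormedAddCommGroup F] [NormedSpace ℝ F] {T : F →L[ℝ] E} (hT : ∀ u, ‖T u‖ = ‖u‖) : ‖T‖ ≤ 1 :=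
  T.opNorm_le_bound zero_le_one fun u => by rw [hT, one_mul]

variable {E F : Type*} [NormedAddCommGroup E] [InnerProductSpace ℝ E] [CompleteSpace E]
  [NormedAddCommGroup F] [InnerProductSpace ℝ F] [CompleteSpace F]

open ContinuousLinearMap (adjoint)

/-- For an isometric embedding `T`, the orthogonal projection onto the orthogonal complement of
the range of `T`. -/
noncomputable def perp (T : F →L[ℝ] E) : E →L[ℝ] E :=
  ContinuousLinearMap.id ℝ E - T ∘L adjoint T

theorem perp_apply (T : F →L[ℝ] E) (z : E) : perp T z = z - T (adjoint T z) := rfl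

section Isometry

variable {T : F →L[ℝ] E}

theorem adjoint_apply_of_isometry (hT : ∀ u, ‖T u‖ = ‖u‖) (u : F) : adjoint T (T u) = u := by
  have := (ContinuousLinearMap.norm_map_iff_adjoint_comp_self T).1 hT
  exact DFunLike.congr_fun this u

theorem norm_adjoint_apply_le (hT : ∀ u, ‖T u‖ = ‖u‖) (z : E) : ‖adjoint T z‖ ≤ ‖z‖ := by
  refine ((adjoint T).le_opNorm z).trans ?_
  have h1 : ‖adjoint T‖ ≤ 1 := by
    rw [LinearIsometryEquiv.norm_map]; exact norm_le_one_of_isometry hT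
  exact mul_le_of_le_one_left (norm_nonneg _) h1

theorem perp_apply_range (hT : ∀ u, ‖T u‖ = ‖u‖) (u : F) : perp T (T u) = 0 := by
  rw [perp_apply, adjoint_apply_of_isometry hT, sub_self]

theorem perp_perp (hT : ∀ u, ‖T u‖ = ‖u‖) (z : E) : perp T (perp T z) = perp T z := by
  conv_lhs => rw [perp_apply T z, map_sub, perp_apply_range hT, sub_zero]

theorem inner_range_perp (hT : ∀ u, ‖T u‖ = ‖u‖) (u : F) (z : E) :
    inner ℝ (T u) (perp T z) = 0 := by
  rw [← ContinuousLinearMap.adjoint_inner_right, perp_apply, map_sub,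
    adjoint_apply_of_isometry hT, sub_self, inner_zero_right]

theorem norm_sq_eq_add_perp (hT : ∀ u, ‖T u‖ = ‖u‖) (z : E) :
    ‖z‖ ^ 2 = ‖adjoint T z‖ ^ 2 + ‖perp T z‖ ^ 2 := by
  have h : z = T (adjoint T z) + perp T z := by rw [perp_apply]; abel
  conv_lhs => rw [h]
  rw [norm_add_sq_real, inner_range_perp hT, hT]
  ring

theorem norm_perp_apply_le (hT : ∀ u, ‖T u‖ = ‖u‖) (z : E) : ‖perp T z‖ ≤ ‖z‖ := by
  have := norm_sq_eq_add_perp hT z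
  have h := sq_nonneg ‖adjoint T z‖
  exact abs_le_of_sq_le_sq' (by linarith) (norm_nonneg _) |>.2

/-- The projection realizes the distance to the range. -/
theorem norm_perp_le_norm_sub (hT : ∀ u, ‖T u‖ = ‖u‖) (z : E) (u : F) : ‖perp T z‖ ≤ ‖z - T u‖ := by
  have : perp T z = perp T (z - T u) := by rw [map_sub, perp_apply_range hT, sub_zero]
  rw [this]
  exact norm_perp_apply_le hT _

theorem norm_perp_le_one (hT : ∀ u, ‖T u‖ = ‖u‖) : ‖perp T‖ ≤ 1 :=
  (perp T).opNorm_le_bound zero_le_one fun z => by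
    rw [one_mul]; exact norm_perp_apply_le hT z

end Isometry

theorem adjoint_perp (T : F →L[ℝ] E) : adjoint (perp T) = perp T := by
  rw [perp, map_sub, ContinuousLinearMap.adjoint_comp, ContinuousLinearMap.adjoint_adjoint,
    ContinuousLinearMap.adjoint_id]

/-- Two ranges each of which is close to the other have close projections. -/
theorem norm_perp_sub_perp_le {S T : F →L[ℝ] E} (hS : ∀ u, ‖S u‖ = ‖u‖) (hT : ∀ u, ‖T u‖ = ‖u‖)
    {κ : ℝ} (h1 : ‖perp S ∘L T‖ ≤ κ) (h2 : ‖perp T ∘L S‖ ≤ κ) : ‖perp S - perp T‖ ≤ 2 * κ := by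
  have e : perp S - perp T =
      (perp S ∘L T) ∘L adjoint T - S ∘L adjoint (perp T ∘L S) := by
    rw [ContinuousLinearMap.adjoint_comp, adjoint_perp]
    ext z
    simp only [perp_apply, _root_.sub_apply, ContinuousLinearMap.comp_apply, map_sub]
    abel
  have hT' : ‖adjoint T‖ ≤ 1 := by
    rw [LinearIsometryEquiv.norm_map]; exact norm_le_one_of_isometry hT
  have i1 : ‖(perp S ∘L T) ∘L adjoint T‖ ≤ κ :=
    (ContinuousLinearMap.opNorm_comp_le _ _).trans
      ((mul_le_of_le_one_right (norm_nonneg _) hT').trans h1)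
  have i2 : ‖S ∘L adjoint (perp T ∘L S)‖ ≤ κ := by
    refine (ContinuousLinearMap.opNorm_comp_le _ _).trans ?_
    rw [LinearIsometryEquiv.norm_map adjoint]
    exact (mul_le_of_le_one_left (norm_nonneg _) (norm_le_one_of_isometry hS)).trans h2
  rw [e]
  exact (norm_sub_le _ _).trans (by linarith)

/-- The hypothesis of the theorem at scale `1`, with the flats translated so that they pass through
the points of `X`: the flat at `x ∈ X` is `x + range (ι x)`, the set `X` lies within `d` of that
flat in the unit ball around `x`, and a `d`-neighbourhood of `X` contains an `ε`-net of the flat. -/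
structure FlatField (X : Set E) (ε d : ℝ) (ι : E → F →L[ℝ] E) : Prop where
  isometry : ∀ x ∈ X, ∀ u, ‖ι x u‖ = ‖u‖
  near : ∀ x ∈ X, ∀ y ∈ X, ‖y - x‖ < 1 → ‖perp (ι x) (y - x)‖ ≤ d
  net : ∀ x ∈ X, ∀ w, ‖w‖ < 9 / 10 → ∃ t, ∃ y ∈ X, ‖w - t‖ < ε ∧ ‖x + ι x t - y‖ < d

namespace FlatField

variable {X : Set E} {ε d : ℝ} {ι : E → F →L[ℝ] E}

/-- The operator norm of `perp (ι x) ∘ ι y` is bounded through itself: a vector of length `1/4`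
is replaced by one pointing to `X`, at a distance less than `ε < 1/10`. -/
theorem norm_perp_comp_le (h : FlatField X ε d ι) (hε : ε < 1 / 10) (hd0 : 0 < d)
    (hd : d ≤ 1 / 1000) {x y : E} (hx : x ∈ X) (hy : y ∈ X) (hxy : ‖y - x‖ < 6 / 10) :
    ‖perp (ι x) ∘L ι y‖ ≤ 20 * d := by
  set ℓ := ‖perp (ι x) ∘L ι y‖ with hℓ
  have hℓ0 : 0 ≤ ℓ := norm_nonneg _
  have key : ∀ w : F, ‖w‖ = 1 / 4 → ‖(perp (ι x) ∘L ι y) w‖ ≤ 3 * d + ℓ / 10 := by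
    intro w hw
    obtain ⟨t, z, hz, hwt, htz⟩ := h.net y hy w (by rw [hw]; norm_num)
    have ht : ‖t‖ ≤ 1 / 4 + 1 / 10 := by
      have := norm_sub_norm_le t w
      rw [norm_sub_rev] at this
      linarith
    have hzx : ‖z - x‖ < 1 := by
      have e : z - x = (y - x) + ι y t - (y + ι y t - z) := by abel
      have h1 := norm_sub_le ((y - x) + ι y t) (y + ι y t - z)
      have h2 := norm_add_le (y - x) (ι y t)
      rw [h.isometry y hy] at h2
      rw [e]
      linarith
    have e : perp (ι x) (ι y t) = perp (ι x) (z - x) - perp (ι x) (y - x) +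
        perp (ι x) (y + ι y t - z) := by
      rw [← map_sub, ← map_add]; congr 1; abel
    have h1 := h.near x hx z hz hzx
    have h2 := h.near x hx y hy (by linarith)
    have h3 := norm_perp_apply_le (h.isometry x hx) (y + ι y t - z)
    have h4 : ‖perp (ι x) (ι y t)‖ ≤ 3 * d := by
      rw [e]
      refine (norm_add_le _ _).trans ?_
      have := norm_sub_le (perp (ι x) (z - x)) (perp (ι x) (y - x))
      linarith
    have h5 : ‖(perp (ι x) ∘L ι y) (w - t)‖ ≤ ℓ / 10 := by
      refine ((perp (ι x) ∘L ι y).le_opNorm _).trans ?_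
      rw [← hℓ]
      nlinarith [norm_nonneg (w - t)]
    have e2 : (perp (ι x) ∘L ι y) w = perp (ι x) (ι y t) + (perp (ι x) ∘L ι y) (w - t) := by
      rw [map_sub]; simp
    rw [e2]
    exact (norm_add_le _ _).trans (by linarith)
  have : ℓ ≤ 4 * (3 * d + ℓ / 10) := by
    refine ContinuousLinearMap.opNorm_le_bound _ (by positivity) fun u => ?_
    rcases eq_or_ne u 0 with rfl | hu
    · simp
    · have hu' : 0 < ‖u‖ := norm_pos_iff.2 hu
      have := key ((1 / (4 * ‖u‖)) • u) (by
        rw [norm_smul, Real.norm_of_nonneg (by positivity)]; field_simp)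
      rw [map_smul, norm_smul, Real.norm_of_nonneg (by positivity), div_mul_eq_mul_div,
        one_mul, div_le_iff₀ (by positivity)] at this
      linarith
  linarith

theorem norm_perp_sub_le_of_near (h : FlatField X ε d ι) (hε : ε < 1 / 10) (hd0 : 0 < d)
    (hd : d ≤ 1 / 1000) {x y : E} (hx : x ∈ X) (hy : y ∈ X) (hxy : ‖y - x‖ < 6 / 10) :
    ‖perp (ι x) - perp (ι y)‖ ≤ 40 * d := by
  have := norm_perp_sub_perp_le (h.isometry x hx) (h.isometry y hy)
    (h.norm_perp_comp_le hε hd0 hd hx hy hxy)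
    (h.norm_perp_comp_le hε hd0 hd hy hx (by rwa [norm_sub_rev]))
  linarith

/-- The direction of the flat varies by `O(d)` over distances less than `0.95`. -/
theorem norm_perp_sub_le (h : FlatField X ε d ι) (hε : ε < 1 / 10) (hd0 : 0 < d)
    (hd : d ≤ 1 / 1000) {x y : E} (hx : x ∈ X) (hy : y ∈ X) (hxy : ‖y - x‖ < 95 / 100) :
    ‖perp (ι x) - perp (ι y)‖ ≤ 80 * d := by
  -- An intermediate point of `X` is found near the midpoint of the segment from `x` to `y`.
  set w := (1 / 2 : ℝ) • ContinuousLinearMap.adjoint (ι x) (y - x) with hw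
  have hw' : ‖w‖ ≤ ‖y - x‖ / 2 := by
    have := norm_adjoint_apply_le (h.isometry x hx) (y - x)
    rw [hw, norm_smul, Real.norm_of_nonneg (by norm_num)]
    linarith
  obtain ⟨t, z, hz, hwt, htz⟩ := h.net x hx w (by linarith)
  have ht : ‖t‖ ≤ ‖w‖ + 1 / 10 := by
    have := norm_sub_norm_le t w
    rw [norm_sub_rev] at this
    linarith
  have h1 : ‖z - x‖ < 6 / 10 := by
    have e : z - x = ι x t - (x + ι x t - z) := by abel
    have := norm_sub_le (ι x t) (x + ι x t - z)
    rw [h.isometry x hx, ← e] at this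
    linarith
  have h2 : ‖y - z‖ < 6 / 10 := by
    have e : y - z = ((1 / 2 : ℝ) • (y - x) + (1 / 2 : ℝ) • perp (ι x) (y - x)) +
        ι x (w - t) + (x + ι x t - z) := by
      rw [hw, map_sub (ι x), map_smul, perp_apply]
      module
    have i1 := norm_add_le (((1 / 2 : ℝ) • (y - x) + (1 / 2 : ℝ) • perp (ι x) (y - x)) +
      ι x (w - t)) (x + ι x t - z)
    have i2 := norm_add_le ((1 / 2 : ℝ) • (y - x) + (1 / 2 : ℝ) • perp (ι x) (y - x)) (ι x (w - t))
    have i3 := norm_add_le ((1 / 2 : ℝ) • (y - x)) ((1 / 2 : ℝ) • perp (ι x) (y - x))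
    rw [h.isometry x hx] at i2
    rw [norm_smul, norm_smul, Real.norm_of_nonneg (by norm_num)] at i3
    have i4 := h.near x hx y hy (by linarith)
    rw [e]
    linarith
  have i1 := h.norm_perp_sub_le_of_near hε hd0 hd hx hz h1
  have i2 := h.norm_perp_sub_le_of_near hε hd0 hd hz hy h2
  have e : perp (ι x) - perp (ι y) = (perp (ι x) - perp (ι z)) + (perp (ι z) - perp (ι y)) := by
    abel
  rw [e]
  exact (norm_add_le _ _).trans (by linarith)

theorem norm_perp_apply_le_of_isometry (h : FlatField X ε d ι) (hε : ε < 1 / 10) (hd0 : 0 < d)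
    (hd : d ≤ 1 / 1000) {x y : E} (hx : x ∈ X) (hy : y ∈ X) (hxy : ‖y - x‖ < 95 / 100) (u : F) :
    ‖perp (ι x) (ι y u)‖ ≤ 80 * d * ‖u‖ := by
  have e : perp (ι x) (ι y u) = (perp (ι x) - perp (ι y)) (ι y u) := by
    rw [_root_.sub_apply, perp_apply_range (h.isometry y hy), sub_zero]
  rw [e, ← h.isometry y hy u]
  refine (ContinuousLinearMap.le_opNorm _ _).trans ?_
  exact mul_le_mul_of_nonneg_right (h.norm_perp_sub_le hε hd0 hd hx hy hxy) (norm_nonneg _)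

/-- Distances to the flats at nearby points of `X` differ by `O(d)`. -/
theorem norm_perp_sub_apply_le (h : FlatField X ε d ι) (hε : ε < 1 / 10) (hd0 : 0 < d)
    (hd : d ≤ 1 / 1000) {x y : E} (hx : x ∈ X) (hy : y ∈ X) (hxy : ‖y - x‖ < 95 / 100) (z : E) :
    ‖perp (ι x) (z - x)‖ ≤ ‖perp (ι y) (z - y)‖ + d + 80 * d * ‖z - y‖ := by
  have e : perp (ι x) (z - x) = perp (ι y) (z - y) + perp (ι x) (y - x) +
      (perp (ι x) - perp (ι y)) (z - y) := by
    rw [_root_.sub_apply, show z - x = (z - y) + (y - x) by abel, map_add]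
    abel
  have i1 := h.near x hx y hy (by linarith)
  have i2 := (perp (ι x) - perp (ι y)).le_opNorm (z - y)
  have i3 := mul_le_mul_of_nonneg_right (h.norm_perp_sub_le hε hd0 hd hx hy hxy)
    (norm_nonneg (z - y))
  have i4 := norm_add_le (perp (ι y) (z - y) + perp (ι x) (y - x))
    ((perp (ι x) - perp (ι y)) (z - y))
  have i5 := norm_add_le (perp (ι y) (z - y)) (perp (ι x) (y - x))
  rw [e]
  linarith

end FlatField

end Flats

/-! ### Colouring a net into separated classes -/

section Colouring

/-- Every set contains a maximal `r`-separated subset. -/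
theorem exists_maximal_separated {E : Type*} [PseudoMetricSpace E] (S : Set E) {r : ℝ}
    (hr : 0 < r) : ∃ T ⊆ S, (∀ x ∈ T, ∀ y ∈ T, x ≠ y → r ≤ dist x y) ∧
      ∀ x ∈ S, ∃ y ∈ T, dist x y < r := by
  obtain ⟨T, hT⟩ := zorn_subset {T : Set E | T ⊆ S ∧ ∀ x ∈ T, ∀ y ∈ T, x ≠ y → r ≤ dist x y}
    (fun c hc hchain => ⟨⋃₀ c, ⟨Set.sUnion_subset fun t ht => (hc ht).1, by
      rintro x ⟨s, hs, hxs⟩ y ⟨t, ht, hyt⟩ hxy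
      rcases hchain.total hs ht with hst | hst
      · exact (hc ht).2 x (hst hxs) y hyt hxy
      · exact (hc hs).2 x hxs y (hst hyt) hxy⟩, fun t ht => Set.subset_sUnion_of_mem ht⟩)
  refine ⟨T, hT.prop.1, hT.prop.2, fun x hx => ?_⟩
  by_contra! hfar
  have hmem : insert x T ∈ {T : Set E | T ⊆ S ∧ ∀ x ∈ T, ∀ y ∈ T, x ≠ y → r ≤ dist x y} := by
    refine ⟨Set.insert_subset hx hT.prop.1, ?_⟩
    rintro a (rfl | ha) b (rfl | hb) hab
    · exact absurd rfl hab
    · exact hfar b hb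
    · rw [dist_comm]; exact hfar a ha
    · exact hT.prop.2 a ha b hb hab
  have hxT : x ∈ T := hT.le_of_ge hmem (Set.subset_insert x T) (Set.mem_insert x T)
  have := hfar x hxT
  rw [dist_self] at this
  linarith

/-- A locally finite net, with at most `N` points in every unit ball, splits into finitely many
classes of points at mutual distance at least `1`. -/
theorem exists_colouring {E : Type*} [PseudoMetricSpace E] (X : Set E) {r : ℝ} (hr : 0 < r) (N : ℕ)
    (hN : ∀ x ∈ X, ∀ s : Finset E, ↑s ⊆ X → (∀ y ∈ s, dist x y < 1) →
      (∀ y ∈ s, ∀ z ∈ s, y ≠ z → r ≤ dist y z) → s.card ≤ N) :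
    ∃ C : ℕ → Set E, (∀ k, C k ⊆ X) ∧ (∀ k, ∀ x ∈ C k, ∀ y ∈ C k, x ≠ y → 1 ≤ dist x y) ∧
      ∀ x ∈ X, ∃ k < N + 1, ∃ y ∈ C k, dist x y < r := by
  obtain ⟨Y, hYX, hYsep, hY⟩ := exists_maximal_separated X hr
  choose sel hsel hselsep hselmax using fun S : Set E => exists_maximal_separated S one_pos
  -- `R k` is what remains after the first `k` classes have been removed.
  set R : ℕ → Set E := fun k => (fun S => S \ sel S)^[k] Y with hR
  have hR0 : R 0 = Y := rfl
  have hRs : ∀ k, R (k + 1) = R k \ sel (R k) := fun k => by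
    simp only [hR, Function.iterate_succ_apply']
  have hanti : Antitone R := antitone_nat_of_succ_le fun k => by
    rw [hRs]; exact Set.sdiff_subset
  have hRY : ∀ k, R k ⊆ Y := fun k => hanti (Nat.zero_le k)
  have hcov : ∀ k, ∀ y ∈ Y, y ∈ R k ∨ ∃ j < k, y ∈ sel (R j) := by
    intro k y hy
    induction k with
    | zero => exact Or.inl hy
    | succ k ih =>
      rcases ih with h | ⟨j, hj, hyj⟩
      · by_cases hs : y ∈ sel (R k)
        · exact Or.inr ⟨k, Nat.lt_succ_self k, hs⟩
        · exact Or.inl (by rw [hRs]; exact ⟨h, hs⟩)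
      · exact Or.inr ⟨j, by omega, hyj⟩
  have hempty : ∀ y, y ∉ R (N + 1) := by
    intro y hy
    have hc : ∀ j : Fin (N + 1), ∃ c ∈ sel (R j), dist y c < 1 := fun j =>
      hselmax (R j) y (hanti (by omega) hy)
    choose c hcs hcd using hc
    have hinj : Function.Injective c := by
      have hlt : ∀ i j : Fin (N + 1), i < j → c i ≠ c j := by
        intro i j hij he
        have h1 : c j ∈ R (i + 1) := hanti (Nat.succ_le_of_lt hij) (hsel _ (hcs j))
        rw [hRs] at h1
        exact h1.2 (he ▸ hcs i)
      intro i j he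
      rcases lt_trichotomy i j with h | h | h
      · exact absurd he (hlt i j h)
      · exact h
      · exact absurd he.symm (hlt j i h)
    have hcY : ∀ j, c j ∈ Y := fun j => hRY _ (hsel _ (hcs j))
    have := hN y (hYX (hRY _ hy)) (Finset.univ.map ⟨c, hinj⟩) (by
      intro z hz
      obtain ⟨j, _, rfl⟩ := Finset.mem_map.1 hz
      exact hYX (hcY j)) (by
      intro z hz
      obtain ⟨j, _, rfl⟩ := Finset.mem_map.1 hz
      exact hcd j) (by
      intro z hz z' hz' hne
      obtain ⟨j, _, rfl⟩ := Finset.mem_map.1 hz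
      obtain ⟨j', _, rfl⟩ := Finset.mem_map.1 hz'
      exact hYsep _ (hcY j) _ (hcY j') hne)
    simp at this
  refine ⟨fun k => sel (R k), fun k => ((hsel _).trans (hRY k)).trans hYX,
    fun k => hselsep (R k), fun x hx => ?_⟩
  obtain ⟨y, hy, hxy⟩ := hY x hx
  rcases hcov (N + 1) y hy with h | ⟨j, hj, hyj⟩
  · exact absurd h (hempty y)
  · exact ⟨j, hj, y, hyj, hxy⟩

/-- In a proper space, the size of separated subsets of a bounded set is bounded. -/
theorem exists_packing_bound (F : Type*) [PseudoMetricSpace F] [ProperSpace F] (x : F) (R : ℝ)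
    {r : ℝ} (hr : 0 < r) : ∃ N : ℕ, ∀ s : Finset F, (∀ y ∈ s, dist y x ≤ R) →
      (∀ y ∈ s, ∀ z ∈ s, y ≠ z → r ≤ dist y z) → s.card ≤ N := by
  obtain ⟨t, -, ht, hcov⟩ := (isCompact_closedBall x R).finite_cover_balls (half_pos hr)
  refine ⟨ht.toFinset.card, fun s hs hsep => ?_⟩
  have : ∀ y ∈ s, ∃ c ∈ ht.toFinset, dist y c < r / 2 := by
    intro y hy
    obtain ⟨c, hc, hyc⟩ := Set.mem_iUnion₂.1 (hcov (Metric.mem_closedBall.2 (hs y hy)))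
    exact ⟨c, ht.mem_toFinset.2 hc, hyc⟩
  choose! c hc hyc using this
  refine Finset.card_le_card_of_injOn c hc fun y hy z hz he => ?_
  by_contra hne
  have h1 := hsep y hy z hz hne
  have h2 := dist_triangle_right y z (c y)
  have h3 := hyc y hy
  have h4 := hyc z hz
  rw [← he] at h4
  linarith

variable {E F : Type*} [NormedAddCommGroup E] [InnerProductSpace ℝ E] [CompleteSpace E]
  [NormedAddCommGroup F] [InnerProductSpace ℝ F] [CompleteSpace F]

/-- The points of a separated subset of `X` in a unit ball project to a separated subset of a flat,
so their number is bounded in terms of the dimension. -/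
theorem FlatField.exists_colouring {X : Set E} {ε d : ℝ} {ι : E → F →L[ℝ] E}
    (h : FlatField X ε d ι) (hd : d ≤ 1 / 1000) {N : ℕ}
    (hN : ∀ s : Finset F, (∀ y ∈ s, dist y 0 ≤ 1) →
      (∀ y ∈ s, ∀ z ∈ s, y ≠ z → 1 / 200 ≤ dist y z) → s.card ≤ N) :
    ∃ C : ℕ → Set E, (∀ k, C k ⊆ X) ∧ (∀ k, ∀ x ∈ C k, ∀ y ∈ C k, x ≠ y → 1 ≤ ‖x - y‖) ∧
      ∀ x ∈ X, ∃ k < N + 1, ∃ y ∈ C k, ‖x - y‖ < 1 / 100 := by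
  have := _root_.exists_colouring X (r := 1 / 100) (by norm_num) N ?_
  · simpa only [dist_eq_norm] using this
  intro x hx s hsX hs1 hsep
  have hT := h.isometry x hx
  set A := ContinuousLinearMap.adjoint (ι x) with hA
  have hdist : ∀ y ∈ s, ∀ z ∈ s, y ≠ z → 1 / 200 ≤ dist (A (y - x)) (A (z - x)) := by
    intro y hy z hz hne
    have h1 := hsep y hy z hz hne
    rw [dist_eq_norm] at h1 ⊢
    have hy1 := hs1 y hy
    have hz1 := hs1 z hz
    rw [dist_comm, dist_eq_norm] at hy1 hz1
    have e : y - z = ι x (A (y - x) - A (z - x)) + (perp (ι x) (y - x) - perp (ι x) (z - x)) := by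
      rw [map_sub (ι x), perp_apply, perp_apply]; abel
    have i1 := norm_add_le (ι x (A (y - x) - A (z - x)))
      (perp (ι x) (y - x) - perp (ι x) (z - x))
    rw [← e, hT] at i1
    have i2 := norm_sub_le (perp (ι x) (y - x)) (perp (ι x) (z - x))
    have i3 := h.near x hx y (hsX hy) hy1
    have i4 := h.near x hx z (hsX hz) hz1
    linarith
  have hinj : Set.InjOn (fun y => A (y - x)) s := by
    intro y hy z hz he
    by_contra hne
    have := hdist y hy z hz hne
    simp only at he
    rw [he, dist_self] at this
    norm_num at this
  classical
  rw [← Finset.card_image_of_injOn hinj]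
  apply hN
  · intro a ha
    obtain ⟨y, hy, rfl⟩ := Finset.mem_image.1 ha
    rw [dist_zero_right]
    have hy1 := hs1 y hy
    rw [dist_comm, dist_eq_norm] at hy1
    exact (norm_adjoint_apply_le hT _).trans hy1.le
  · intro a ha b hb hab
    obtain ⟨y, hy, rfl⟩ := Finset.mem_image.1 ha
    obtain ⟨z, hz, rfl⟩ := Finset.mem_image.1 hb
    exact hdist y hy z hz fun e => hab (by rw [e])

end Colouring

/-! ### Flattening steps -/

section Flattening

variable {E F : Type*} [NormedAddCommGroup E] [InnerProductSpace ℝ E]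
  [NormedAddCommGroup F] [InnerProductSpace ℝ F]

/-- `g` is, on the ball of radius `1/4`, an `O(d)`-perturbation of the affine parametrization
`u ↦ x + T u`, including all derivatives. -/
def NearFlat (x : E) (T : F →L[ℝ] E) (B : ℕ → ℝ) (d : ℝ) (g : F → E) : Prop :=
  HasDerivBounds (fun u => g u - (x + T u)) (Metric.ball 0 (1 / 4)) (fun k => B k * d)

variable {X : Set E} {ε d : ℝ} {ι : E → F →L[ℝ] E} {B : ℕ → ℝ} {x : E} {g : F → E}

theorem NearFlat.continuousOn {T : F →L[ℝ] E} (hg : NearFlat x T B d g) :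
    ContinuousOn g (Metric.ball 0 (1 / 4)) := by
  have := hg.1.continuousOn.add (f := fun u => g u - (x + T u)) (g := fun u => x + T u)
    (by fun_prop)
  exact this.congr fun u _ => by simp

theorem NearFlat.norm_sub_le {T : F →L[ℝ] E} (hg : NearFlat x T B d g) {u : F}
    (hu : ‖u‖ < 1 / 4) : ‖g u - (x + T u)‖ ≤ B 0 * d :=
  HasDerivBounds.norm_le hg (mem_ball_zero_iff.2 hu)

theorem nearFlat_affine (x : E) (T : F →L[ℝ] E) (d : ℝ) :
    NearFlat x T (fun _ => 0) d (fun u => x + T u) := by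
  simpa [NearFlat] using HasDerivBounds.zero

variable [CompleteSpace E] [CompleteSpace F]

open ContinuousLinearMap (adjoint)

open Classical in
/-- The flattening step for a class `C` of points at mutual distance at least `1`: it is the
projection to the flat `j + range (ι j)` within distance `3/10` from any `j ∈ C`, the identity at
distance at least `4/10` from `C`, and interpolates in between. -/
noncomputable def flatStep (ι : E → F →L[ℝ] E) (C : Set E) (z : E) : E :=
  if h : ∃ j ∈ C, ‖z - j‖ < 4 / 10 then
    z - cutoff (z - h.choose) • perp (ι h.choose) (z - h.choose)
  else z

theorem flatStep_eq_self (ι : E → F →L[ℝ] E) {C : Set E} {z : E}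
    (hz : ∀ j ∈ C, 4 / 10 ≤ ‖z - j‖) : flatStep ι C z = z := by
  rw [flatStep, dif_neg]
  rintro ⟨j, hj, hlt⟩
  exact absurd (hz j hj) (not_le.2 hlt)

theorem flatStep_eq (ι : E → F →L[ℝ] E) {C : Set E}
    (hC : ∀ x ∈ C, ∀ y ∈ C, x ≠ y → 1 ≤ ‖x - y‖) {z j : E} (hj : j ∈ C) (hz : ‖z - j‖ ≤ 5 / 10) :
    flatStep ι C z = z - cutoff (z - j) • perp (ι j) (z - j) := by
  have huniq : ∀ j' ∈ C, ‖z - j'‖ < 4 / 10 → j' = j := by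
    intro j' hj' hz'
    by_contra hne
    have h1 := hC j' hj' j hj hne
    have h2 := norm_sub_le (z - j) (z - j')
    rw [show z - j - (z - j') = j' - j by abel] at h2
    linarith
  by_cases h : ∃ j ∈ C, ‖z - j‖ < 4 / 10
  · rw [flatStep, dif_pos h, huniq _ h.choose_spec.1 h.choose_spec.2]
  · push Not at h
    rw [flatStep_eq_self ι h, cutoff_eq_zero (h j hj), zero_smul, sub_zero]

theorem flatStep_eq_projection (ι : E → F →L[ℝ] E) {C : Set E}
    (hC : ∀ x ∈ C, ∀ y ∈ C, x ≠ y → 1 ≤ ‖x - y‖) {z j : E} (hj : j ∈ C) (hz : ‖z - j‖ ≤ 3 / 10) :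
    flatStep ι C z = j + ι j (adjoint (ι j) (z - j)) := by
  rw [flatStep_eq ι hC hj (by linarith), cutoff_eq_one hz, one_smul, perp_apply]
  abel

/-- The effect of a flattening step on the derivative bounds in `NearFlat`; `Bμ` bounds the
derivatives of the cut-off function. The vector from a centre `j` to the flat at a nearby `x` has
component normal to the flat at `j` at most `21 * d` with slope at most `80 * d`. -/
noncomputable def stepBound (Bμ B : ℕ → ℝ) (k : ℕ) : ℝ :=
  B k + leibnizBound (compBound Bμ (fun k => affineBound 1 1 k + B k))
    (fun k => affineBound 21 80 k + B k) k

theorem le_stepBound {Bμ B : ℕ → ℝ} (hμ : ∀ k, 0 ≤ Bμ k) (hB : ∀ k, 0 ≤ B k) (k : ℕ) :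
    B k ≤ stepBound Bμ B k := by
  refine le_add_of_nonneg_right (leibnizBound_nonneg (compBound_nonneg hμ fun k => ?_) ?_ k)
  · exact add_nonneg (affineBound_nonneg zero_le_one zero_le_one k) (hB k)
  · exact fun k => add_nonneg (affineBound_nonneg (by norm_num) (by norm_num) k) (hB k)

theorem stepBound_iterate_nonneg {Bμ B : ℕ → ℝ} (hμ : ∀ k, 0 ≤ Bμ k) (hB : ∀ k, 0 ≤ B k) (m : ℕ) :
    ∀ k, 0 ≤ (stepBound Bμ)^[m] B k := by
  induction m generalizing B with
  | zero => exact hB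
  | succ m ih => exact ih fun k => (hB k).trans (le_stepBound hμ hB k)

theorem le_stepBound_iterate {Bμ B : ℕ → ℝ} (hμ : ∀ k, 0 ≤ Bμ k) (hB : ∀ k, 0 ≤ B k) (m k : ℕ) :
    B k ≤ (stepBound Bμ)^[m] B k := by
  induction m generalizing B with
  | zero => exact le_rfl
  | succ m ih =>
    exact (le_stepBound hμ hB k).trans (ih fun k => (hB k).trans (le_stepBound hμ hB k))

/-- A flattening step preserves near-flatness. -/
theorem NearFlat.flatStep (hX : FlatField X ε d ι) (hε : ε < 1 / 10) (hd0 : 0 < d)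
    (hd : d ≤ 1 / 1000) {Bμ : ℕ → ℝ}
    (hμ : HasDerivBounds (cutoff : E → ℝ) (Metric.ball 0 1) Bμ) {C : Set E} (hCX : C ⊆ X)
    (hC : ∀ x ∈ C, ∀ y ∈ C, x ≠ y → 1 ≤ ‖x - y‖) (hx : x ∈ X)
    (hg : NearFlat x (ι x) B d g) (hB0 : ∀ k, 0 ≤ B k) (hB : B 0 * d ≤ 1 / 100) :
    NearFlat x (ι x) (stepBound Bμ B) d (fun u => flatStep ι C (g u)) := by
  have hμ0 : ∀ k, 0 ≤ Bμ k := hμ.nonneg (Metric.mem_ball_self one_pos)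
  have hcont := hg.continuousOn
  have hT := hX.isometry x hx
  refine HasDerivBounds.of_local fun u hu => ?_
  by_cases hj : ∃ j ∈ C, ‖g u - j‖ < 45 / 100
  · obtain ⟨j, hj, hju⟩ := hj
    set V : Set F := Metric.ball 0 (1 / 4) ∩ g ⁻¹' Metric.ball j (45 / 100) with hV
    have hVo : IsOpen V := hcont.isOpen_inter_preimage Metric.isOpen_ball Metric.isOpen_ball
    have hmem : ∀ {v}, v ∈ V → ‖v‖ < 1 / 4 ∧ ‖g v - j‖ < 45 / 100 := fun hv =>
      ⟨mem_ball_zero_iff.1 hv.1, mem_ball_iff_norm.1 hv.2⟩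
    have hjx : ‖j - x‖ < 95 / 100 := by
      have h1 := hg.norm_sub_le (mem_ball_zero_iff.1 hu)
      have h2 := mem_ball_zero_iff.1 hu
      have e : j - x = (g u - (x + ι x u)) + ι x u - (g u - j) := by abel
      have h3 := _root_.norm_sub_le ((g u - (x + ι x u)) + ι x u) (g u - j)
      have h4 := norm_add_le (g u - (x + ι x u)) (ι x u)
      rw [hT] at h4
      rw [e]
      linarith
    have he := HasDerivBounds.subset hg (Set.inter_subset_left : V ⊆ _)
    have hgj : HasDerivBounds (fun v => g v - j) V (fun k => affineBound 1 1 k + B k) := by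
      have h1 : HasDerivBounds (fun v => (x - j) + ι x v) V (affineBound 1 1) := by
        refine HasDerivBounds.affine _ _ (fun v hv => ?_) (norm_le_one_of_isometry hT)
        have e : (x - j) + ι x v = (g v - j) - (g v - (x + ι x v)) := by abel
        have h2 := _root_.norm_sub_le (g v - j) (g v - (x + ι x v))
        have h3 := hg.norm_sub_le (hmem hv).1
        have h4 := (hmem hv).2
        rw [e]
        linarith
      refine ((h1.add hVo he).congr hVo fun v _ => ?_).mono fun k => ?_
      · abel
      · have := mul_le_of_le_one_right (hB0 k) (by linarith : d ≤ 1)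
        linarith
    have hcut : HasDerivBounds (fun v => cutoff (g v - j)) V
        (compBound Bμ (fun k => affineBound 1 1 k + B k)) := by
      refine HasDerivBounds.comp' hVo Metric.isOpen_ball hμ hgj fun v hv => ?_
      rw [mem_ball_zero_iff]
      linarith [(hmem hv).2]
    have hperp : HasDerivBounds (fun v => perp (ι j) (g v - j)) V
        (fun k => (affineBound 21 80 k + B k) * d) := by
      have h1 : HasDerivBounds (fun v => perp (ι j) (x - j) + (perp (ι j) ∘L ι x) v) V
          (affineBound (21 * d) (80 * d)) := by
        have hxj : ‖x - j‖ < 95 / 100 := by rwa [norm_sub_rev]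
        have hop : ∀ v, ‖(perp (ι j) ∘L ι x) v‖ ≤ 80 * d * ‖v‖ := fun v =>
          hX.norm_perp_apply_le_of_isometry hε hd0 hd (hCX hj) hx hxj v
        refine HasDerivBounds.affine _ _ (fun v hv => ?_)
          (ContinuousLinearMap.opNorm_le_bound _ (by positivity) hop)
        have h2 := norm_add_le (perp (ι j) (x - j)) ((perp (ι j) ∘L ι x) v)
        have h3 := hX.near j (hCX hj) x hx (by linarith)
        have h4 := hop v
        have h5 := (hmem hv).1
        nlinarith
      have h2 := he.clm_comp hVo (perp (ι j)) (norm_perp_le_one (hX.isometry j (hCX hj)))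
      rw [affineBound_mul] at h1
      refine ((h1.add hVo h2).congr hVo fun v _ => ?_).mono fun k => ?_
      · simp only [ContinuousLinearMap.comp_apply, ← map_add]
        congr 1
        abel
      · rw [add_mul]
    have hprod := HasDerivBounds.bilin hVo hcut hperp (ContinuousLinearMap.lsmul ℝ ℝ)
      ContinuousLinearMap.opNorm_lsmul_le
    rw [leibnizBound_mul_right] at hprod
    refine ⟨_, V, hVo, ⟨hu, mem_ball_iff_norm.2 hju⟩, ?_, ((he.sub hVo hprod).mono fun k => ?_)⟩
    · filter_upwards [hVo.mem_nhds ⟨hu, mem_ball_iff_norm.2 hju⟩] with v hv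
      rw [flatStep_eq ι hC hj (by linarith [(hmem hv).2])]
      simp only [ContinuousLinearMap.lsmul_apply]
      abel
    · rw [stepBound, add_mul]
  · push Not at hj
    set V : Set F := Metric.ball 0 (1 / 4) ∩ g ⁻¹' Metric.ball (g u) (5 / 100) with hV
    have hVo : IsOpen V := hcont.isOpen_inter_preimage Metric.isOpen_ball Metric.isOpen_ball
    have huV : u ∈ V := ⟨hu, Metric.mem_ball_self (by norm_num)⟩
    refine ⟨_, V, hVo, huV, ?_, (HasDerivBounds.subset hg (Set.inter_subset_left : V ⊆ _)).mono
      fun k => mul_le_mul_of_nonneg_right (le_stepBound hμ0 hB0 k) hd0.le⟩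
    filter_upwards [hVo.mem_nhds huV] with v hv
    rw [flatStep_eq_self ι fun j hjC => ?_]
    have h1 := hj j hjC
    have h2 := mem_ball_iff_norm'.1 hv.2
    have h3 := norm_add_le (g u - g v) (g v - j)
    rw [sub_add_sub_cancel] at h3
    linarith

/-- The composition of the flattening steps for the classes `C a, …, C (a + m - 1)`, those of
higher index being applied first. -/
noncomputable def flatten (ι : E → F →L[ℝ] E) (C : ℕ → Set E) (a : ℕ) : ℕ → E → E
  | 0 => id
  | m + 1 => flatten ι C a m ∘ flatStep ι (C (a + m))

theorem flatten_add (ι : E → F →L[ℝ] E) (C : ℕ → Set E) (a m m' : ℕ) (z : E) :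
    flatten ι C a (m + m') z = flatten ι C a m (flatten ι C (a + m) m' z) := by
  induction m' generalizing z with
  | zero => rfl
  | succ m' ih =>
    rw [← add_assoc, flatten, Function.comp_apply, ih, flatten, Function.comp_apply, add_assoc]

theorem flatten_eq_of_lt (ι : E → F →L[ℝ] E) (C : ℕ → Set E) {l k : ℕ} (hlk : l < k) (z : E) :
    flatten ι C 0 k z =
      flatten ι C 0 l (flatStep ι (C l) (flatten ι C (l + 1) (k - (l + 1)) z)) := by
  have h1 := flatten_add ι C 0 (l + 1) (k - (l + 1)) z
  rw [show l + 1 + (k - (l + 1)) = k by omega, zero_add] at h1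
  rw [h1, flatten, Function.comp_apply, zero_add]

theorem NearFlat.flatten (hX : FlatField X ε d ι) (hε : ε < 1 / 10) (hd0 : 0 < d)
    (hd : d ≤ 1 / 1000) {Bμ : ℕ → ℝ}
    (hμ : HasDerivBounds (cutoff : E → ℝ) (Metric.ball 0 1) Bμ) {C : ℕ → Set E}
    (hCX : ∀ k, C k ⊆ X) (hC : ∀ k, ∀ x ∈ C k, ∀ y ∈ C k, x ≠ y → 1 ≤ ‖x - y‖) (hx : x ∈ X)
    (hg : NearFlat x (ι x) B d g) (hB0 : ∀ k, 0 ≤ B k) (a m : ℕ)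
    (hB : (stepBound Bμ)^[m] B 0 * d ≤ 1 / 100) :
    NearFlat x (ι x) ((stepBound Bμ)^[m] B) d (fun u => flatten ι C a m (g u)) := by
  have hμ0 : ∀ k, 0 ≤ Bμ k := hμ.nonneg (Metric.mem_ball_self one_pos)
  induction m generalizing B g with
  | zero => exact hg
  | succ m ih =>
    refine ih (g := fun u => _root_.flatStep ι (C (a + m)) (g u))
      (hg.flatStep hX hε hd0 hd hμ (hCX _) (hC _) hx hB0 ?_)
      (fun k => (hB0 k).trans (le_stepBound hμ0 hB0 k)) hB
    exact (mul_le_mul_of_nonneg_right (le_stepBound_iterate hμ0 hB0 (m + 1) 0) hd0.le).trans hB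

end Flattening

/-! ### Atlases of almost flat charts -/

section Manifold

variable {E F : Type*} [NormedAddCommGroup E] [InnerProductSpace ℝ E] [CompleteSpace E]
  [NormedAddCommGroup F] [InnerProductSpace ℝ F] [CompleteSpace F]

/-- Bounds for the nonlinear part of the equation for the foot point of the normal projection, in a
chart whose deviation from the flat is bounded by `B`; see `footRemainder`. -/
noncomputable def footBound (B : ℕ → ℝ) (k : ℕ) : ℝ :=
  compBound B (affineBound 1 1) k + leibnizBound (compBound (fun k => B (k + 1)) (affineBound 1 1))
    (fun k => affineBound 1 2 k + compBound B (affineBound 1 1) k) k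

theorem footBound_nonneg {B : ℕ → ℝ} (hB : ∀ k, 0 ≤ B k) (k : ℕ) : 0 ≤ footBound B k := by
  have ha := affineBound_nonneg (R := 1) (l := 1) zero_le_one zero_le_one
  refine add_nonneg (compBound_nonneg hB ha k) (leibnizBound_nonneg ?_ (fun k => ?_) k)
  · exact compBound_nonneg (fun k => hB (k + 1)) ha
  · exact add_nonneg (affineBound_nonneg zero_le_one zero_le_two k) (compBound_nonneg hB ha k)

/-- A field of flats on `X` together with finitely many classes `C 0, …, C (N - 1)` of centres
forming a `1/100`-net of `X`, such that all partial flattenings move the flats at the points of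
`X` by `O(d)` in all derivatives, with `d` small. -/
structure FlatAtlas (X : Set E) (ε d : ℝ) (ι : E → F →L[ℝ] E) (C : ℕ → Set E) (N : ℕ)
    (B : ℕ → ℝ) : Prop extends FlatField X ε d ι where
  eps_lt : ε < 1 / 10
  pos : 0 < d
  small : d ≤ 1 / 100000
  subset : ∀ k, C k ⊆ X
  separated : ∀ k, ∀ x ∈ C k, ∀ y ∈ C k, x ≠ y → 1 ≤ ‖x - y‖
  cover : ∀ x ∈ X, ∃ k < N, ∃ y ∈ C k, ‖x - y‖ < 1 / 100
  nonneg : ∀ k, 0 ≤ B k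
  bound_zero : B 0 * d ≤ 1 / 1000
  bound_one : B 1 * d ≤ 1 / 1000
  bound_two : B 2 * d ≤ 1 / 1000
  foot_zero : footBound B 0 * d ≤ 1 / 1000
  foot_one : footBound B 1 * d ≤ 1 / 4
  nearFlat : ∀ x ∈ X, ∀ a m, a + m ≤ N →
    NearFlat x (ι x) B d (fun u => flatten ι C a m (x + ι x u))

/-- Sufficiently small `d` yields an atlas whose bounds depend only on the dimension. -/
theorem exists_flatAtlas (F : Type*) [NormedAddCommGroup F] [InnerProductSpace ℝ F]
    [FiniteDimensional ℝ F] : ∃ (N : ℕ) (B : ℕ → ℝ) (σ : ℝ), 0 < σ ∧ (∀ k, 0 ≤ B k) ∧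
      ∀ (E : Type*) [NormedAddCommGroup E] [InnerProductSpace ℝ E] [CompleteSpace E]
        (X : Set E) (ε d : ℝ) (ι : E → F →L[ℝ] E), ε < 1 / 10 → 0 < d → d ≤ σ →
        FlatField X ε d ι → ∃ C : ℕ → Set E, FlatAtlas X ε d ι C N B := by
  obtain ⟨Bμ, hμ0, hμ⟩ := exists_cutoff_bounds
  obtain ⟨N, hN⟩ := exists_packing_bound F 0 1 (r := 1 / 200) (by norm_num)
  set B : ℕ → ℝ := (stepBound Bμ)^[N + 1] (fun _ => 0) with hB
  have hB0 : ∀ k, 0 ≤ B k := stepBound_iterate_nonneg hμ0 (fun _ => le_rfl) _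
  have hb0 := hB0 0
  have hb1 := hB0 1
  have hb2 := hB0 2
  have hf0 := footBound_nonneg hB0 0
  have hf1 := footBound_nonneg hB0 1
  refine ⟨N + 1, B, 1 / (100000 * (1 + B 0 + B 1 + B 2 + footBound B 0 + footBound B 1)),
    by positivity, hB0, ?_⟩
  intro E _ _ _ X ε d ι hε hd0 hdσ hX
  have hd1 : d * (1 + B 0 + B 1 + B 2 + footBound B 0 + footBound B 1) ≤ 1 / 100000 := by
    rw [le_div_iff₀ (by positivity)] at hdσ
    linarith
  have p0 : 0 ≤ d * B 0 := by positivity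
  have p1 : 0 ≤ d * B 1 := by positivity
  have p2 : 0 ≤ d * B 2 := by positivity
  have p3 : 0 ≤ d * footBound B 0 := by positivity
  have p4 : 0 ≤ d * footBound B 1 := by positivity
  have hd : d ≤ 1 / 100000 := by linarith
  obtain ⟨C, hCX, hCsep, hCcov⟩ := hX.exists_colouring (by linarith) hN
  refine ⟨C, ⟨hX, hε, hd0, hd, hCX, hCsep, hCcov, hB0, by linarith, by linarith,
    by linarith, by linarith, by linarith, ?_⟩⟩
  intro x hx a m ham
  have hle : ∀ k, (stepBound Bμ)^[m] (fun _ => 0) k ≤ B k := by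
    intro k
    rw [hB, show N + 1 = (N + 1 - m) + m by omega, Function.iterate_add_apply]
    exact le_stepBound_iterate hμ0 (stepBound_iterate_nonneg hμ0 (fun _ => le_rfl) _) _ _
  refine HasDerivBounds.mono ((nearFlat_affine x (ι x) d).flatten hX hε hd0 (by linarith) (hμ E)
    hCX hCsep hx (fun _ => le_rfl) a m ?_) fun k => mul_le_mul_of_nonneg_right (hle k) hd0.le
  have := mul_le_mul_of_nonneg_right (hle 0) hd0.le
  linarith

/-- A contraction of a closed ball has a fixed point. -/
theorem exists_fixedPoint_closedBall {F : Type*} [NormedAddCommGroup F] [CompleteSpace F]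
    {f : F → F} {r : ℝ} (hr : 0 ≤ r) (hf : ∀ u, ‖u‖ ≤ r → ‖f u‖ ≤ r)
    (hc : ∀ u v, ‖u‖ ≤ r → ‖v‖ ≤ r → ‖f u - f v‖ ≤ 1 / 2 * ‖u - v‖) :
    ∃ u, ‖u‖ ≤ r ∧ f u = u := by
  have hm : Set.MapsTo f (Metric.closedBall 0 r) (Metric.closedBall 0 r) := fun u hu =>
    mem_closedBall_zero_iff.2 (hf u (mem_closedBall_zero_iff.1 hu))
  have hK : ContractingWith (1 / 2) (hm.restrict f _ _) := by
    refine ⟨by rw [← NNReal.coe_lt_coe]; norm_num, LipschitzWith.of_dist_le_mul fun u v => ?_⟩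
    have := hc u v (mem_closedBall_zero_iff.1 u.2) (mem_closedBall_zero_iff.1 v.2)
    simpa [Subtype.dist_eq, dist_eq_norm] using this
  obtain ⟨u, hu, hfu, -⟩ := hK.exists_fixedPoint' Metric.isClosed_closedBall.isComplete hm
    (mem_closedBall_zero_iff.2 (by simpa using hr)) (edist_ne_top 0 _)
  exact ⟨u, mem_closedBall_zero_iff.1 hu, hfu⟩

end Manifold

/-! ### Charts of the glued manifold -/

section Charts

variable {E F : Type*} [NormedAddCommGroup E] [InnerProductSpace ℝ E] [CompleteSpace E]
  [NormedAddCommGroup F] [InnerProductSpace ℝ F] [CompleteSpace F]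

open ContinuousLinearMap (adjoint)

/-- The parametrization of the glued manifold around a centre `i` of class `k`: the flat at `i`,
moved by the flattening steps for the classes below `k`. -/
noncomputable def chart (ι : E → F →L[ℝ] E) (C : ℕ → Set E) (k : ℕ) (i : E) (u : F) : E :=
  flatten ι C 0 k (i + ι i u)

/-- The manifold glued from the charts around all centres. -/
def gluedManifold (ι : E → F →L[ℝ] E) (C : ℕ → Set E) (N : ℕ) : Set E :=
  {m | ∃ k < N, ∃ i ∈ C k, ∃ u, ‖u‖ < 1 / 4 ∧ m = chart ι C k i u}

namespace FlatAtlas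

variable {X : Set E} {ε d : ℝ} {ι : E → F →L[ℝ] E} {C : ℕ → Set E} {N : ℕ} {B : ℕ → ℝ}

theorem small' (h : FlatAtlas X ε d ι C N B) : d ≤ 1 / 1000 := by linarith [h.small]

theorem isometry_of_mem (h : FlatAtlas X ε d ι C N B) {k : ℕ} {i : E} (hi : i ∈ C k) (u : F) :
    ‖ι i u‖ = ‖u‖ :=
  h.isometry i (h.subset k hi) u

theorem nearFlat_chart (h : FlatAtlas X ε d ι C N B) {k : ℕ} (hk : k < N) {i : E} (hi : i ∈ C k) :
    NearFlat i (ι i) B d (chart ι C k i) :=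
  h.nearFlat i (h.subset k hi) 0 k (by omega)

theorem norm_chart_sub_le (h : FlatAtlas X ε d ι C N B) {k : ℕ} (hk : k < N) {i : E}
    (hi : i ∈ C k) {u : F} (hu : ‖u‖ < 1 / 4) : ‖chart ι C k i u - (i + ι i u)‖ ≤ B 0 * d :=
  (h.nearFlat_chart hk hi).norm_sub_le hu

theorem norm_chart_sub_le' (h : FlatAtlas X ε d ι C N B) {k : ℕ} (hk : k < N) {i : E}
    (hi : i ∈ C k) {u : F} (hu : ‖u‖ < 1 / 4) :
    ‖chart ι C k i u - (i + ι i u)‖ ≤ 1 / 1000 :=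
  (h.norm_chart_sub_le hk hi hu).trans h.bound_zero

/-- Near-flat maps differ from the embedding of the flat by a map with small Lipschitz constant. -/
theorem _root_.NearFlat.norm_sub_sub_le {E F : Type*} [NormedAddCommGroup E]
    [InnerProductSpace ℝ E] [NormedAddCommGroup F] [InnerProductSpace ℝ F] {x : E} {T : F →L[ℝ] E}
    {B : ℕ → ℝ} {d : ℝ} {g : F → E}
    (hg : NearFlat x T B d g) {u v : F} (hu : ‖u‖ < 1 / 4) (hv : ‖v‖ < 1 / 4) :
    ‖g u - g v - T (u - v)‖ ≤ B 1 * d * ‖u - v‖ := by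
  have := HasDerivBounds.norm_sub_le Metric.isOpen_ball (convex_ball _ _) hg
    (mem_ball_zero_iff.2 hv) (mem_ball_zero_iff.2 hu)
  rwa [show g u - (x + T u) - (g v - (x + T v)) = g u - g v - T (u - v) by
    rw [map_sub]; abel] at this

theorem norm_chart_sub_chart_le (h : FlatAtlas X ε d ι C N B) {k : ℕ} (hk : k < N) {i : E}
    (hi : i ∈ C k) {u v : F} (hu : ‖u‖ < 1 / 4) (hv : ‖v‖ < 1 / 4) :
    ‖chart ι C k i u - chart ι C k i v‖ ≤ (1 + B 1 * d) * ‖u - v‖ := by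
  have h1 := (h.nearFlat_chart hk hi).norm_sub_sub_le hu hv
  have h2 := norm_add_le (chart ι C k i u - chart ι C k i v - ι i (u - v)) (ι i (u - v))
  rw [sub_add_cancel, h.isometry_of_mem hi] at h2
  linarith

theorem le_norm_chart_sub_chart (h : FlatAtlas X ε d ι C N B) {k : ℕ} (hk : k < N) {i : E}
    (hi : i ∈ C k) {u v : F} (hu : ‖u‖ < 1 / 4) (hv : ‖v‖ < 1 / 4) :
    9 / 10 * ‖u - v‖ ≤ ‖chart ι C k i u - chart ι C k i v‖ := by
  have h1 := (h.nearFlat_chart hk hi).norm_sub_sub_le hu hv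
  have h2 := norm_sub_norm_le (ι i (u - v)) (ι i (u - v) - (chart ι C k i u - chart ι C k i v))
  rw [sub_sub_cancel, norm_sub_rev (ι i (u - v)), h.isometry_of_mem hi] at h2
  have h3 := mul_le_mul_of_nonneg_right h.bound_one (norm_nonneg (u - v))
  linarith [norm_nonneg (u - v)]

theorem mem_gluedManifold {k : ℕ} (hk : k < N) {i : E} (hi : i ∈ C k) {u : F} (hu : ‖u‖ < 1 / 4) :
    chart ι C k i u ∈ gluedManifold ι C N :=
  ⟨k, hk, i, hi, u, hu, rfl⟩

/-- Every point of the glued manifold is close to a centre. -/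
theorem exists_centre (h : FlatAtlas X ε d ι C N B) {m : E} (hm : m ∈ gluedManifold ι C N) :
    ∃ k < N, ∃ i ∈ C k, ‖m - i‖ < 115 / 1000 := by
  obtain ⟨l, hl, j, hj, u, hu, rfl⟩ := hm
  obtain ⟨t, y, hy, hut, hty⟩ := h.net j (h.subset l hj) u (by linarith)
  obtain ⟨k, hk, i, hi, hyi⟩ := h.cover y hy
  refine ⟨k, hk, i, hi, ?_⟩
  have h1 := h.norm_chart_sub_le' hl hj hu
  have h2 := h.isometry_of_mem hj (u - t)
  have e : chart ι C l j u - i = (chart ι C l j u - (j + ι j u)) + ι j (u - t) +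
      (j + ι j t - y) + (y - i) := by rw [map_sub]; abel
  have h3 := norm_add_le ((chart ι C l j u - (j + ι j u)) + ι j (u - t) +
      (j + ι j t - y)) (y - i)
  have h4 := norm_add_le ((chart ι C l j u - (j + ι j u)) + ι j (u - t)) (j + ι j t - y)
  have h5 := norm_add_le (chart ι C l j u - (j + ι j u)) (ι j (u - t))
  have h6 := h.small
  have h7 := h.eps_lt
  rw [e]
  linarith

/-- Near a centre `i` of class `k`, the chart at `i` covers the part of another chart, at `j` of a
lower class `l`. The parameter is found as a fixed point: the two charts agree if the flattening
steps strictly between `l` and `k`, followed by the projection to the flat at `j`, take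
`i + ι i u'` to `j + ι j u`. -/
theorem exists_chart_eq_of_lt (h : FlatAtlas X ε d ι C N B) {k l : ℕ} (hk : k < N) (hlk : l < k)
    {i j : E} (hi : i ∈ C k) (hj : j ∈ C l) {u : F} (hu : ‖u‖ < 1 / 4)
    (hnear : ‖chart ι C l j u - i‖ < 1 / 5) :
    ∃ u', ‖u'‖ < 21 / 100 ∧ chart ι C l j u = chart ι C k i u' := by
  have hiX := h.subset k hi
  have hjX := h.subset l hj
  have hTi := h.isometry i hiX
  have hTj := h.isometry j hjX
  have hd := h.small
  have hd0 := h.pos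
  set w : F → E := fun u' => flatten ι C (l + 1) (k - (l + 1)) (i + ι i u') with hw
  have hwn : NearFlat i (ι i) B d w := h.nearFlat i hiX (l + 1) (k - (l + 1)) (by omega)
  have hclose := h.norm_chart_sub_le' (by omega) hj hu
  have hji : ‖j + ι j u - i‖ < 202 / 1000 := by
    have := norm_sub_le (chart ι C l j u - i) (chart ι C l j u - (j + ι j u))
    rw [show chart ι C l j u - i - (chart ι C l j u - (j + ι j u)) = j + ι j u - i by abel] at this
    linarith
  have hij : ‖i - j‖ < 95 / 100 := by
    have := norm_sub_le (ι j u) (j + ι j u - i)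
    rw [show ι j u - (j + ι j u - i) = i - j by abel, hTj] at this
    linarith
  have hij' : ‖j - i‖ < 95 / 100 := by rwa [norm_sub_rev]
  have hper : ∀ u', ‖u'‖ < 1 / 4 → ‖perp (ι j) (w u' - j)‖ ≤ 2 / 1000 := by
    intro u' hu'
    have h1 := hwn.norm_sub_le hu'
    have h2 := h.norm_perp_apply_le_of_isometry h.eps_lt hd0 h.small' hjX hiX hij u'
    have h3 := h.near j hjX i hiX (by linarith)
    have h4 := norm_perp_apply_le hTj (w u' - (i + ι i u'))
    have e : perp (ι j) (w u' - j) = perp (ι j) (w u' - (i + ι i u')) + perp (ι j) (i - j) +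
        perp (ι j) (ι i u') := by
      rw [← map_add, ← map_add]; congr 1; abel
    have h5 := norm_add_le (perp (ι j) (w u' - (i + ι i u')) + perp (ι j) (i - j))
      (perp (ι j) (ι i u'))
    have h6 := norm_add_le (perp (ι j) (w u' - (i + ι i u'))) (perp (ι j) (i - j))
    have h7 := h.bound_zero
    rw [e]
    nlinarith
  set f : F → F := fun u' => u' - adjoint (ι i) (ι j (adjoint (ι j) (w u' - j) - u)) with hf
  have hfeq : ∀ u', f u' = adjoint (ι i) ((j + ι j u - i) - (w u' - (i + ι i u')) +
      perp (ι j) (w u' - j)) := by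
    intro u'
    simp only [hf]
    nth_rewrite 1 [← adjoint_apply_of_isometry hTi u']
    rw [← map_sub]
    congr 1
    rw [map_sub, perp_apply]
    abel
  obtain ⟨u', hu', hfix⟩ := exists_fixedPoint_closedBall (f := f) (r := 208 / 1000) (by norm_num)
    (fun u' hu' => by
      rw [hfeq]
      refine (norm_adjoint_apply_le hTi _).trans ?_
      have h1 := norm_add_le ((j + ι j u - i) - (w u' - (i + ι i u'))) (perp (ι j) (w u' - j))
      have h2 := norm_sub_le (j + ι j u - i) (w u' - (i + ι i u'))
      have h3 := hwn.norm_sub_le (u := u') (by linarith)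
      have h4 := hper u' (by linarith)
      have h5 := h.bound_zero
      linarith)
    (fun u₁ u₂ hu₁ hu₂ => by
      rw [hfeq, hfeq, ← map_sub]
      refine (norm_adjoint_apply_le hTi _).trans ?_
      have h1 := hwn.norm_sub_sub_le (u := u₁) (v := u₂) (by linarith) (by linarith)
      have e : (j + ι j u - i) - (w u₁ - (i + ι i u₁)) + perp (ι j) (w u₁ - j) -
          ((j + ι j u - i) - (w u₂ - (i + ι i u₂)) + perp (ι j) (w u₂ - j)) =
          perp (ι j) (w u₁ - w u₂ - ι i (u₁ - u₂)) + perp (ι j) (ι i (u₁ - u₂)) -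
            (w u₁ - w u₂ - ι i (u₁ - u₂)) := by
        rw [← map_add, sub_add_cancel]
        simp only [map_sub]
        abel
      rw [e]
      have h2 := norm_perp_apply_le hTj (w u₁ - w u₂ - ι i (u₁ - u₂))
      have h3 := h.norm_perp_apply_le_of_isometry h.eps_lt hd0 h.small' hjX hiX hij (u₁ - u₂)
      have h4 := norm_sub_le (perp (ι j) (w u₁ - w u₂ - ι i (u₁ - u₂)) +
        perp (ι j) (ι i (u₁ - u₂))) (w u₁ - w u₂ - ι i (u₁ - u₂))
      have h5 := norm_add_le (perp (ι j) (w u₁ - w u₂ - ι i (u₁ - u₂)))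
        (perp (ι j) (ι i (u₁ - u₂)))
      have h6 := mul_le_mul_of_nonneg_right h.bound_one (norm_nonneg (u₁ - u₂))
      have h7 : 80 * d * ‖u₁ - u₂‖ ≤ 80 * (1 / 100000) * ‖u₁ - u₂‖ := by gcongr
      linarith [norm_nonneg (u₁ - u₂)])
  set v := adjoint (ι j) (w u' - j) - u with hv
  -- The fixed point equation says that `ι j v` is orthogonal to the flat at `i`; since the flats
  -- at `i` and `j` are close, `v` vanishes.
  have hv0 : v = 0 := by
    have h1 : adjoint (ι i) (ι j v) = 0 := by
      have : u' - adjoint (ι i) (ι j v) = u' := hfix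
      simpa using this
    have h2 : perp (ι i) (ι j v) = ι j v := by rw [perp_apply, h1, map_zero, sub_zero]
    have h3 := h.norm_perp_apply_le_of_isometry h.eps_lt hd0 h.small' hiX hjX hij' v
    rw [h2, hTj] at h3
    have h4 : 80 * d * ‖v‖ ≤ 80 * (1 / 100000) * ‖v‖ := by gcongr
    have h5 := norm_nonneg v
    exact norm_le_zero_iff.1 (by linarith)
  refine ⟨u', by linarith, ?_⟩
  have hproj : j + ι j u = j + ι j (adjoint (ι j) (w u' - j)) := by
    rw [sub_eq_zero.1 hv0]
  have hwj : ‖w u' - j‖ ≤ 3 / 10 := by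
    have e : w u' - j = ι j u + perp (ι j) (w u' - j) := by
      rw [perp_apply, ← sub_eq_zero.1 hv0]; abel
    have h1 := norm_add_le (ι j u) (perp (ι j) (w u' - j))
    rw [← e, hTj] at h1
    have h2 := hper u' (by linarith)
    linarith
  rw [chart, chart, flatten_eq_of_lt ι C hlk, hproj]
  congr 1
  exact (flatStep_eq_projection ι (h.separated l) hj hwj).symm

/-- If `j` belongs to a higher class `l` than `i`, the chart at `j` is projected to the flat at `i`
on the way, hence runs inside the chart at `i` when it is close to `i`. -/
theorem exists_chart_eq_of_gt (h : FlatAtlas X ε d ι C N B) {k l : ℕ} (hl : l < N) (hkl : k < l)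
    {i j : E} (hi : i ∈ C k) (hj : j ∈ C l) {u : F} (hu : ‖u‖ < 1 / 4)
    (hnear : ‖chart ι C l j u - i‖ < 1 / 5) :
    ∃ u', ‖u'‖ < 21 / 100 ∧ chart ι C l j u = chart ι C k i u' := by
  set w := flatten ι C (k + 1) (l - (k + 1)) (j + ι j u) with hw
  have hwn : ‖w - (j + ι j u)‖ ≤ B 0 * d :=
    (h.nearFlat j (h.subset l hj) (k + 1) (l - (k + 1)) (by omega)).norm_sub_le hu
  have hwi : ‖w - i‖ < 21 / 100 := by
    have h1 := h.norm_chart_sub_le' hl hj hu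
    have h2 := h.bound_zero
    have e : w - i = (w - (j + ι j u)) - (chart ι C l j u - (j + ι j u)) +
      (chart ι C l j u - i) := by abel
    have h3 := norm_add_le ((w - (j + ι j u)) - (chart ι C l j u - (j + ι j u)))
      (chart ι C l j u - i)
    have h4 := norm_sub_le (w - (j + ι j u)) (chart ι C l j u - (j + ι j u))
    rw [e]
    linarith
  refine ⟨adjoint (ι i) (w - i),
    (norm_adjoint_apply_le (h.isometry_of_mem hi) _).trans_lt hwi, ?_⟩
  rw [chart, chart, flatten_eq_of_lt ι C hkl]
  congr 1
  exact flatStep_eq_projection ι (h.separated k) hi (by linarith)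

/-- Near a centre, the glued manifold is given by the chart at that centre. -/
theorem exists_chart_eq (h : FlatAtlas X ε d ι C N B) {k : ℕ} (hk : k < N) {i : E} (hi : i ∈ C k)
    {m : E} (hm : m ∈ gluedManifold ι C N) (hmi : ‖m - i‖ < 1 / 5) :
    ∃ u, ‖u‖ < 21 / 100 ∧ m = chart ι C k i u := by
  obtain ⟨l, hl, j, hj, u, hu, rfl⟩ := hm
  rcases lt_trichotomy l k with hlk | rfl | hkl
  · exact h.exists_chart_eq_of_lt hk hlk hi hj hu hmi
  · have h1 := h.norm_chart_sub_le' hl hj hu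
    have hij : i = j := by
      by_contra hne
      have h2 := h.separated l i hi j hj hne
      have e : i - j = (chart ι C l j u - (j + ι j u)) + ι j u - (chart ι C l j u - i) := by abel
      have h3 := norm_sub_le ((chart ι C l j u - (j + ι j u)) + ι j u) (chart ι C l j u - i)
      have h4 := norm_add_le (chart ι C l j u - (j + ι j u)) (ι j u)
      rw [h.isometry_of_mem hj] at h4
      rw [e] at h2
      linarith
    subst hij
    refine ⟨u, ?_, rfl⟩
    have e : ι i u = (chart ι C l i u - i) - (chart ι C l i u - (i + ι i u)) := by abel
    have h3 := norm_sub_le (chart ι C l i u - i) (chart ι C l i u - (i + ι i u))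
    rw [← e, h.isometry_of_mem hi] at h3
    linarith
  · exact h.exists_chart_eq_of_gt hl hkl hi hj hu hmi

/-- Around every `i ∈ X`, the glued manifold lies within `O(d)` of the flat at `i`. -/
theorem norm_perp_sub_le_of_mem (h : FlatAtlas X ε d ι C N B) {i : E} (hi : i ∈ X) {m : E}
    (hm : m ∈ gluedManifold ι C N) (hmi : ‖m - i‖ < 83 / 100) :
    ‖perp (ι i) (m - i)‖ ≤ (B 0 + 11) * d := by
  obtain ⟨l, hl, j, hj, hmj⟩ := h.exists_centre hm
  obtain ⟨u, hu, rfl⟩ := h.exists_chart_eq hl hj hm (by linarith)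
  have hij : ‖j - i‖ < 95 / 100 := by
    have := norm_sub_le (chart ι C l j u - i) (chart ι C l j u - j)
    rw [sub_sub_sub_cancel_left] at this
    linarith
  have hjX := h.subset l hj
  have hd0 := h.pos
  have h1 := h.norm_perp_sub_apply_le h.eps_lt hd0 h.small' hi hjX hij (chart ι C l j u)
  have h2 := norm_perp_le_norm_sub (h.isometry j hjX) (chart ι C l j u - j) u
  have h3 := h.norm_chart_sub_le hl hj (u := u) (by linarith)
  rw [sub_sub] at h2
  nlinarith

theorem norm_perp_sub_le_of_mem' (h : FlatAtlas X ε d ι C N B) {i : E} (hi : i ∈ X) {m : E}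
    (hm : m ∈ gluedManifold ι C N) (hmi : ‖m - i‖ < 83 / 100) :
    ‖perp (ι i) (m - i)‖ ≤ 2 / 1000 := by
  have h1 := h.norm_perp_sub_le_of_mem hi hm hmi
  have h2 := h.bound_zero
  have h3 := h.small
  linarith

/-- Every point of `X` lies within `O(d)` of the glued manifold. -/
theorem exists_mem_gluedManifold_near (h : FlatAtlas X ε d ι C N B) {x : E} (hx : x ∈ X) :
    ∃ m ∈ gluedManifold ι C N, ‖x - m‖ ≤ (B 0 + 1) * d := by
  obtain ⟨k, hk, i, hi, hxi⟩ := h.cover x hx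
  set u := adjoint (ι i) (x - i) with hu
  have hu' : ‖u‖ < 1 / 4 := by
    have := norm_adjoint_apply_le (h.isometry_of_mem hi) (x - i)
    linarith
  refine ⟨chart ι C k i u, mem_gluedManifold hk hi hu', ?_⟩
  have h1 := h.norm_chart_sub_le hk hi hu'
  have h2 := h.near i (h.subset k hi) x hx (by linarith)
  have e : x - chart ι C k i u = perp (ι i) (x - i) - (chart ι C k i u - (i + ι i u)) := by
    rw [perp_apply, ← hu]; abel
  have h3 := norm_sub_le (perp (ι i) (x - i)) (chart ι C k i u - (i + ι i u))
  rw [e]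
  linarith

/-- The points of the glued manifold that are `O(d)`-close to `X` form an `ε`-net of it. The net
point obtained from the flat is moved by `O(d)` towards the given point to compensate the
distortion of the chart, so that the distance stays below `ε`. -/
theorem exists_net_point (h : FlatAtlas X ε d ι C N B) {m : E} (hm : m ∈ gluedManifold ι C N) :
    ∃ m' ∈ gluedManifold ι C N, ‖m - m'‖ < ε ∧ ∃ y ∈ X, ‖m' - y‖ ≤ (B 0 + B 1 + 1) * d := by
  obtain ⟨k, hk, i, hi, hmi⟩ := h.exists_centre hm
  obtain ⟨u, hu, rfl⟩ := h.exists_chart_eq hk hi hm (by linarith)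
  have hiX := h.subset k hi
  have hTi := h.isometry i hiX
  have hu2 : ‖u‖ < 12 / 100 := by
    have e : ι i u = (chart ι C k i u - i) - (chart ι C k i u - (i + ι i u)) := by abel
    have h1 := h.norm_chart_sub_le' hk hi (u := u) (by linarith)
    have h3 := norm_sub_le (chart ι C k i u - i) (chart ι C k i u - (i + ι i u))
    rw [← e, hTi] at h3
    linarith
  obtain ⟨t, y, hy, hut, hty⟩ := h.net i hiX u (by linarith)
  have hε := h.eps_lt
  have hb1 := h.bound_one
  have hb1' : 0 ≤ B 1 * d := mul_nonneg (h.nonneg 1) h.pos.le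
  have htn : ‖t‖ < 22 / 100 := by
    have := norm_sub_norm_le t u
    rw [norm_sub_rev] at this
    linarith
  set s := t + (B 1 * d) • (u - t) with hs
  have hus : u - s = (1 - B 1 * d) • (u - t) := by rw [hs]; module
  have hsn : ‖s‖ < 1 / 4 := by
    have := norm_add_le t ((B 1 * d) • (u - t))
    rw [← hs, norm_smul, Real.norm_of_nonneg hb1'] at this
    nlinarith [norm_nonneg (u - t)]
  refine ⟨chart ι C k i s, mem_gluedManifold hk hi hsn, ?_, y, hy, ?_⟩
  · have h1 := h.norm_chart_sub_chart_le hk hi (u := u) (v := s) (by linarith) hsn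
    rw [hus, norm_smul, Real.norm_of_nonneg (by linarith)] at h1
    have h2 : (1 + B 1 * d) * ((1 - B 1 * d) * ‖u - t‖) ≤ ‖u - t‖ := by
      have : (1 + B 1 * d) * (1 - B 1 * d) ≤ 1 := by nlinarith
      rw [← mul_assoc]
      exact mul_le_of_le_one_left (norm_nonneg _) this
    linarith
  · have h1 := h.norm_chart_sub_le hk hi hsn
    have e : chart ι C k i s - y = (chart ι C k i s - (i + ι i s)) + (i + ι i t - y) +
        ι i ((B 1 * d) • (u - t)) := by rw [hs, map_add]; abel
    have h2 := norm_add_le ((chart ι C k i s - (i + ι i s)) + (i + ι i t - y))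
      (ι i ((B 1 * d) • (u - t)))
    have h3 := norm_add_le (chart ι C k i s - (i + ι i s)) (i + ι i t - y)
    rw [hTi, norm_smul, Real.norm_of_nonneg hb1'] at h2
    rw [e]
    nlinarith [norm_nonneg (u - t)]

end FlatAtlas

end Charts

/-! ### The glued manifold is a closed submanifold -/

section Submanifold

variable {E F : Type*} [NormedAddCommGroup E] [InnerProductSpace ℝ E] [CompleteSpace E]
  [NormedAddCommGroup F] [InnerProductSpace ℝ F] [CompleteSpace F]

open ContinuousLinearMap (adjoint)

/-- The deviation of a chart from the affine parametrization of its flat. -/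
noncomputable def chartError (ι : E → F →L[ℝ] E) (C : ℕ → Set E) (k : ℕ) (i : E) (u : F) : E :=
  chart ι C k i u - (i + ι i u)

theorem chart_eq_add_chartError (ι : E → F →L[ℝ] E) (C : ℕ → Set E) (k : ℕ) (i : E) (u : F) :
    chart ι C k i u = (i + ι i u) + chartError ι C k i u := by
  rw [chartError]; abel

namespace FlatAtlas

variable {X : Set E} {ε d : ℝ} {ι : E → F →L[ℝ] E} {C : ℕ → Set E} {N : ℕ} {B : ℕ → ℝ}
  {k : ℕ} {i : E}

theorem chartError_bounds (h : FlatAtlas X ε d ι C N B) (hk : k < N) (hi : i ∈ C k) :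
    HasDerivBounds (chartError ι C k i) (Metric.ball 0 (1 / 4)) (fun k => B k * d) :=
  h.nearFlat_chart hk hi

theorem contDiffOn_chart (h : FlatAtlas X ε d ι C N B) (hk : k < N) (hi : i ∈ C k) :
    ContDiffOn ℝ ∞ (chart ι C k i) (Metric.ball 0 (1 / 4)) := by
  have h1 : ContDiffOn ℝ ∞ (fun u => (i + ι i u) + chartError ι C k i u)
      (Metric.ball 0 (1 / 4)) :=
    (contDiff_const.add (ι i).contDiff).contDiffOn.add (h.chartError_bounds hk hi).1
  exact h1.congr fun u _ => chart_eq_add_chartError ι C k i u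

theorem hasFDerivAt_chart (h : FlatAtlas X ε d ι C N B) (hk : k < N) (hi : i ∈ C k) {u : F}
    (hu : ‖u‖ < 1 / 4) :
    HasFDerivAt (chart ι C k i) (ι i + fderiv ℝ (chartError ι C k i) u) u := by
  have h1 := ((h.chartError_bounds hk hi).differentiableAt Metric.isOpen_ball
    (mem_ball_zero_iff.2 hu)).hasFDerivAt
  have h2 := ((ι i).hasFDerivAt (x := u)).const_add i |>.add h1
  exact h2.congr_of_eventuallyEq (.of_forall fun v => chart_eq_add_chartError ι C k i v)

theorem norm_fderiv_chartError_le (h : FlatAtlas X ε d ι C N B) (hk : k < N) (hi : i ∈ C k) {u : F}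
    (hu : ‖u‖ < 1 / 4) : ‖fderiv ℝ (chartError ι C k i) u‖ ≤ 1 / 1000 :=
  ((h.chartError_bounds hk hi).norm_fderiv_le (mem_ball_zero_iff.2 hu)).trans h.bound_one

theorem isClosed_gluedManifold [FiniteDimensional ℝ F] (h : FlatAtlas X ε d ι C N B) :
    IsClosed (gluedManifold ι C N) := by
  refine isClosed_of_closure_subset fun z hz => ?_
  obtain ⟨m, hm, hzm⟩ := Metric.mem_closure_iff.1 hz (1 / 100) (by norm_num)
  obtain ⟨k, hk, i, hi, hmi⟩ := h.exists_centre hm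
  rw [dist_eq_norm] at hzm
  have hzi : z ∈ Metric.ball i (1 / 5) := by
    rw [mem_ball_iff_norm]
    have := norm_add_le (z - m) (m - i)
    rw [sub_add_sub_cancel] at this
    linarith
  have hcl : z ∈ closure (Metric.ball i (1 / 5) ∩ gluedManifold ι C N) :=
    Metric.isOpen_ball.inter_closure ⟨hzi, hz⟩
  set K : Set E := chart ι C k i '' Metric.closedBall 0 (21 / 100) with hK
  have hKc : IsCompact K := by
    refine (isCompact_closedBall 0 _).image_of_continuousOn ?_
    refine (h.nearFlat_chart hk hi).continuousOn.mono ?_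
    exact Metric.closedBall_subset_ball (by norm_num)
  have hsub : Metric.ball i (1 / 5) ∩ gluedManifold ι C N ⊆ K := by
    rintro y ⟨hy, hyM⟩
    obtain ⟨u, hu, rfl⟩ := h.exists_chart_eq hk hi hyM (mem_ball_iff_norm.1 hy)
    exact ⟨u, mem_closedBall_zero_iff.2 hu.le, rfl⟩
  obtain ⟨u, hu, rfl⟩ := hKc.isClosed.closure_subset_iff.2 hsub hcl
  have := mem_closedBall_zero_iff.1 hu
  exact mem_gluedManifold hk hi (by linarith)

theorem isLocalParametrization_chart {n : ℕ} {ι : E → EuclideanSpace ℝ (Fin n) →L[ℝ] E}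
    (h : FlatAtlas X ε d ι C N B) (hk : k < N) (hi : i ∈ C k) :
    IsLocalParametrization n (gluedManifold ι C N) (chart ι C k i)
      (Metric.ball 0 (1 / 4) ∩ chart ι C k i ⁻¹' Metric.ball i (1 / 5)) := by
  set V := Metric.ball 0 (1 / 4) ∩ chart ι C k i ⁻¹' Metric.ball i (1 / 5) with hV
  have hmem : ∀ {v}, v ∈ V → ‖v‖ < 1 / 4 := fun hv => mem_ball_zero_iff.1 hv.1
  refine ⟨?_, (h.contDiffOn_chart hk hi).mono Set.inter_subset_left, fun u hu => ?_,
    fun u hu v hv huv => ?_, fun W hWV hW => ?_⟩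
  · exact (h.nearFlat_chart hk hi).continuousOn.isOpen_inter_preimage Metric.isOpen_ball
      Metric.isOpen_ball
  · rw [(h.hasFDerivAt_chart hk hi (hmem hu)).fderiv, injective_iff_map_eq_zero]
    intro a ha
    have h1 := (fderiv ℝ (chartError ι C k i) u).le_opNorm a
    have h2 := mul_le_mul_of_nonneg_right (h.norm_fderiv_chartError_le hk hi (hmem hu))
      (norm_nonneg a)
    have h3 : ι i a = -fderiv ℝ (chartError ι C k i) u a := eq_neg_of_add_eq_zero_left ha
    have h4 := h.isometry_of_mem hi a
    rw [h3, norm_neg] at h4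
    exact norm_le_zero_iff.1 (by linarith [norm_nonneg a])
  · have h1 := h.le_norm_chart_sub_chart hk hi (hmem hu) (hmem hv)
    rw [huv, sub_self, norm_zero] at h1
    have : ‖u - v‖ ≤ 0 := by linarith
    exact sub_eq_zero.1 (norm_le_zero_iff.1 this)
  · -- The chart expands distances by at least `9/10`, so balls around image points of radius
    -- `9/10` times that of a ball contained in `W` cut `M` inside the image of `W`.
    have hball : ∀ u ∈ W, ∃ r > 0, Metric.ball u r ⊆ W := fun u hu => Metric.isOpen_iff.1 hW u hu
    choose! r hr hrW using hball
    refine ⟨Metric.ball i (1 / 5) ∩ ⋃ u ∈ W, Metric.ball (chart ι C k i u) (9 / 10 * r u),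
      Metric.isOpen_ball.inter (isOpen_biUnion fun _ _ => Metric.isOpen_ball), ?_⟩
    ext m
    constructor
    · rintro ⟨u, hu, rfl⟩
      have hrpos : 0 < 9 / 10 * r u := mul_pos (by norm_num) (hr u hu)
      exact ⟨mem_gluedManifold hk hi (hmem (hWV hu)), (hWV hu).2,
        Set.mem_biUnion hu (Metric.mem_ball_self hrpos)⟩
    · rintro ⟨hm, hmi, hmW⟩
      obtain ⟨u, hu, hmu⟩ := Set.mem_iUnion₂.1 hmW
      obtain ⟨u', hu', rfl⟩ := h.exists_chart_eq hk hi hm (mem_ball_iff_norm.1 hmi)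
      refine ⟨u', hrW u hu (mem_ball_iff_norm.2 ?_), rfl⟩
      have h1 := h.le_norm_chart_sub_chart hk hi (u := u') (v := u) (by linarith)
        (hmem (hWV hu))
      have h2 := mem_ball_iff_norm.1 hmu
      linarith

theorem isClosedSubmanifold_gluedManifold {n : ℕ} {ι : E → EuclideanSpace ℝ (Fin n) →L[ℝ] E}
    (h : FlatAtlas X ε d ι C N B) : IsClosedSubmanifold n (gluedManifold ι C N) := by
  refine ⟨h.isClosed_gluedManifold, fun p hp => ?_⟩
  obtain ⟨k, hk, i, hi, hpi⟩ := h.exists_centre hp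
  obtain ⟨u, hu, rfl⟩ := h.exists_chart_eq hk hi hp (by linarith)
  refine ⟨_, _, h.isLocalParametrization_chart hk hi, u, ⟨mem_ball_zero_iff.2 (by linarith), ?_⟩,
    rfl⟩
  exact mem_ball_iff_norm.2 (by linarith)

/-- The derivative of a chart takes values in the tangent space. -/
theorem fderiv_chart_mem_tangentSpaceAt (h : FlatAtlas X ε d ι C N B) (hk : k < N) (hi : i ∈ C k)
    {u : F} (hu : ‖u‖ < 1 / 4) (a : F) :
    fderiv ℝ (chart ι C k i) u a ∈ tangentSpaceAt (gluedManifold ι C N) (chart ι C k i u) := by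
  -- A multiple `c • a` is so small that the curve `u + sin t • (c • a)` stays in the domain.
  set c : ℝ := (1 / 4 - ‖u‖) / (2 * (1 + ‖a‖)) with hc
  have ha := norm_nonneg a
  have hc0 : 0 < c := by
    have : 0 < 1 / 4 - ‖u‖ := by linarith
    positivity
  have hca : ‖c • a‖ < 1 / 4 - ‖u‖ := by
    rw [norm_smul, Real.norm_of_nonneg hc0.le, hc, div_mul_eq_mul_div, div_lt_iff₀ (by positivity)]
    nlinarith
  have hin : ∀ t : ℝ, ‖u + Real.sin t • (c • a)‖ < 1 / 4 := fun t => by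
    have h1 := norm_add_le u (Real.sin t • (c • a))
    have h2 : ‖Real.sin t • (c • a)‖ ≤ ‖c • a‖ := by
      rw [norm_smul]
      exact mul_le_of_le_one_left (norm_nonneg _) (Real.abs_sin_le_one t)
    linarith
  have hcurve : ContDiff ℝ ∞ (fun t : ℝ => u + Real.sin t • (c • a)) :=
    contDiff_const.add (Real.contDiff_sin.smul contDiff_const)
  have hmem : fderiv ℝ (chart ι C k i) u (c • a) ∈
      tangentSpaceAt (gluedManifold ι C N) (chart ι C k i u) := by
    refine Submodule.subset_span ⟨fun t => chart ι C k i (u + Real.sin t • (c • a)), ?_,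
      fun t => mem_gluedManifold hk hi (hin t), by simp, ?_⟩
    · rw [← contDiffOn_univ]
      exact (h.contDiffOn_chart hk hi).comp hcurve.contDiffOn
        fun t _ => mem_ball_zero_iff.2 (hin t)
    · have h1 : HasDerivAt (fun t : ℝ => u + Real.sin t • (c • a)) (c • a) 0 := by
        have := ((Real.hasDerivAt_sin 0).smul_const (c • a)).const_add u
        simpa using this
      have h2 : HasFDerivAt (chart ι C k i) (fderiv ℝ (chart ι C k i) u)
          (u + Real.sin 0 • (c • a)) := by
        simpa using (h.hasFDerivAt_chart hk hi hu).differentiableAt.hasFDerivAt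
      exact (h2.comp_hasDerivAt (0 : ℝ) h1).deriv
  rw [map_smul] at hmem
  have := Submodule.smul_mem _ c⁻¹ hmem
  rwa [smul_smul, inv_mul_cancel₀ hc0.ne', one_smul] at this

end FlatAtlas

end Submanifold

/-! ### The foot point map in a chart -/

section FootPoint

variable {E F : Type*} [NormedAddCommGroup E] [InnerProductSpace ℝ E] [CompleteSpace E]
  [NormedAddCommGroup F] [InnerProductSpace ℝ F] [CompleteSpace F]

open ContinuousLinearMap (adjoint)

/-- Passage to the adjoint, as a continuous linear map over `ℝ`. -/
noncomputable def adjointCLM : (F →L[ℝ] E) →L[ℝ] (E →L[ℝ] F) :=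
  LinearMap.mkContinuous
    { toFun := fun A => adjoint A
      map_add' := fun A A' => map_add _ A A'
      map_smul' := fun c A => by simp } 1
    (fun A => by simp)

theorem adjointCLM_apply (A : F →L[ℝ] E) : adjointCLM A = adjoint A := rfl

theorem norm_adjointCLM_le : ‖(adjointCLM : (F →L[ℝ] E) →L[ℝ] (E →L[ℝ] F))‖ ≤ 1 :=
  LinearMap.mkContinuous_norm_le _ zero_le_one _

/-- The points near the centre `i` whose nearest point on the manifold is sought in the chart
at `i`. -/
def footDomain (ι : E → F →L[ℝ] E) (i : E) : Set E :=
  {x | ‖x - i‖ < 48 / 100 ∧ ‖adjoint (ι i) (x - i)‖ < 125 / 1000}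

theorem isOpen_footDomain (ι : E → F →L[ℝ] E) (i : E) : IsOpen (footDomain ι i) :=
  (isOpen_lt (f := fun x : E => ‖x - i‖) (by fun_prop) continuous_const).inter
    (isOpen_lt (f := fun x : E => ‖adjoint (ι i) (x - i)‖) (by fun_prop) continuous_const)

theorem convex_footDomain (ι : E → F →L[ℝ] E) (i : E) : Convex ℝ (footDomain ι i) := by
  have h1 : footDomain ι i = Metric.ball i (48 / 100) ∩
      (adjoint (ι i)).toLinearMap ⁻¹' Metric.ball (adjoint (ι i) i) (125 / 1000) := by
    ext x
    simp [footDomain, dist_eq_norm, map_sub]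
  rw [h1]
  exact (convex_ball _ _).inter ((convex_ball _ _).linear_preimage _)

/-- The nonlinear part of the equation for the foot point: the condition that `x - g u` be
orthogonal to the derivative at `u` of the chart `g` at `i` reads
`u = adjoint (ι i) (x - i) + footRemainder (x, u)`. -/
noncomputable def footRemainder (ι : E → F →L[ℝ] E) (C : ℕ → Set E) (k : ℕ) (i : E)
    (q : E × F) : F :=
  adjoint (fderiv ℝ (chartError ι C k i) q.2) (q.1 - (i + ι i q.2) - chartError ι C k i q.2) -
    adjoint (ι i) (chartError ι C k i q.2)

theorem adjoint_fderiv_chart_apply {ι : E → F →L[ℝ] E} {C : ℕ → Set E} {k : ℕ} {i : E}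
    (hT : ∀ u, ‖ι i u‖ = ‖u‖) (x : E) (u : F) :
    adjoint (ι i + fderiv ℝ (chartError ι C k i) u) (x - chart ι C k i u) =
      adjoint (ι i) (x - i) + footRemainder ι C k i (x, u) - u := by
  have e : x - chart ι C k i u = x - (i + ι i u) - chartError ι C k i u := by
    rw [chart_eq_add_chartError]; abel
  rw [e, map_add, _root_.add_apply, footRemainder]
  have e2 : adjoint (ι i) (x - (i + ι i u) - chartError ι C k i u) =
      adjoint (ι i) (x - i) - u - adjoint (ι i) (chartError ι C k i u) := by
    rw [map_sub, ← sub_sub, map_sub _ (x - i), adjoint_apply_of_isometry hT]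
  rw [e2]
  abel

namespace FlatAtlas

variable {X : Set E} {ε d : ℝ} {ι : E → F →L[ℝ] E} {C : ℕ → Set E} {N : ℕ} {B : ℕ → ℝ}
  {k : ℕ} {i : E}

theorem footRemainder_bounds (h : FlatAtlas X ε d ι C N B) (hk : k < N) (hi : i ∈ C k) :
    HasDerivBounds (footRemainder ι C k i) (footDomain ι i ×ˢ Metric.ball 0 (1 / 4))
      (fun k => footBound B k * d) := by
  have hTi := h.isometry_of_mem hi
  have hd0 := h.pos
  have hd1 : d ≤ 1 := by linarith [h.small]
  set S : Set (E × F) := footDomain ι i ×ˢ Metric.ball 0 (1 / 4) with hS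
  have hSo : IsOpen S := (isOpen_footDomain ι i).prod Metric.isOpen_ball
  have hmaps : Set.MapsTo (fun q : E × F => 0 + ContinuousLinearMap.snd ℝ E F q) S
      (Metric.ball 0 (1 / 4)) := fun q hq => by simpa using hq.2
  have hsnd : HasDerivBounds (fun q : E × F => 0 + ContinuousLinearMap.snd ℝ E F q) S
      (affineBound 1 1) := by
    refine HasDerivBounds.affine _ _ (fun q hq => ?_) (ContinuousLinearMap.norm_snd_le ℝ E F)
    have := mem_ball_zero_iff.1 (hmaps hq)
    linarith
  have he := h.chartError_bounds hk hi
  have he1 := HasDerivBounds.comp' hSo Metric.isOpen_ball he hsnd hmaps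
  have he2 := HasDerivBounds.comp' hSo Metric.isOpen_ball (he.fderiv Metric.isOpen_ball) hsnd hmaps
  simp only [zero_add, ContinuousLinearMap.coe_snd'] at he1 he2
  rw [compBound_mul] at he1
  rw [compBound_mul (fun k => B (k + 1))] at he2
  have he3 := he2.clm_comp hSo adjointCLM norm_adjointCLM_le
  have haff : HasDerivBounds (fun q : E × F => -i + (ContinuousLinearMap.fst ℝ E F -
      ι i ∘L ContinuousLinearMap.snd ℝ E F) q) S (affineBound 1 2) := by
    refine HasDerivBounds.affine _ _ (fun q hq => ?_) ?_
    · have h1 := hq.1.1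
      have h2 := mem_ball_zero_iff.1 hq.2
      have h3 := norm_sub_le (q.1 - i) (ι i q.2)
      rw [hTi] at h3
      have e : -i + (ContinuousLinearMap.fst ℝ E F - ι i ∘L ContinuousLinearMap.snd ℝ E F) q =
          q.1 - i - ι i q.2 := by
        simp only [_root_.sub_apply, ContinuousLinearMap.coe_fst', ContinuousLinearMap.comp_apply,
          ContinuousLinearMap.coe_snd']
        abel
      rw [e]
      linarith
    · have h1 := ContinuousLinearMap.norm_fst_le ℝ E F
      have h2 := (ι i).opNorm_comp_le (ContinuousLinearMap.snd ℝ E F)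
      have h3 := ContinuousLinearMap.norm_snd_le ℝ E F
      have h4 := norm_le_one_of_isometry hTi
      have h5 := norm_sub_le (ContinuousLinearMap.fst ℝ E F) (ι i ∘L ContinuousLinearMap.snd ℝ E F)
      nlinarith [norm_nonneg (ι i), norm_nonneg (ContinuousLinearMap.snd ℝ E F)]
  have hvec := haff.sub hSo he1
  have hvec' := hvec.mono (B' := fun k => affineBound 1 2 k + compBound B (affineBound 1 1) k)
    fun k => by
      have h0 : 0 ≤ compBound B (affineBound 1 1) k :=
        compBound_nonneg h.nonneg (affineBound_nonneg zero_le_one zero_le_one) k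
      have := mul_le_of_le_one_right h0 hd1
      linarith
  have hprod := HasDerivBounds.bilin hSo he3 hvec' (ContinuousLinearMap.id ℝ (E →L[ℝ] F))
    ContinuousLinearMap.norm_id_le
  rw [leibnizBound_mul_left] at hprod
  have hlin := he1.clm_comp hSo (adjoint (ι i))
    (by rw [LinearIsometryEquiv.norm_map]; exact norm_le_one_of_isometry hTi)
  refine ((hprod.sub hSo hlin).congr hSo fun q _ => ?_).mono fun k => ?_
  · simp only [footRemainder, ContinuousLinearMap.id_apply, adjointCLM_apply, _root_.sub_apply,
      ContinuousLinearMap.coe_fst', ContinuousLinearMap.comp_apply, ContinuousLinearMap.coe_snd']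
    congr 2
    abel
  · rw [footBound]; linarith

theorem norm_footRemainder_le (h : FlatAtlas X ε d ι C N B) (hk : k < N) (hi : i ∈ C k) {x : E}
    (hx : x ∈ footDomain ι i) {u : F} (hu : ‖u‖ < 1 / 4) :
    ‖footRemainder ι C k i (x, u)‖ ≤ 1 / 1000 :=
  ((h.footRemainder_bounds hk hi).norm_le (x := (x, u))
    ⟨hx, mem_ball_zero_iff.2 hu⟩).trans h.foot_zero

theorem norm_footRemainder_sub_le (h : FlatAtlas X ε d ι C N B) (hk : k < N) (hi : i ∈ C k)
    {x y : E} (hx : x ∈ footDomain ι i) (hy : y ∈ footDomain ι i) {u v : F} (hu : ‖u‖ < 1 / 4)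
    (hv : ‖v‖ < 1 / 4) : ‖footRemainder ι C k i (y, v) - footRemainder ι C k i (x, u)‖ ≤
      1 / 4 * max ‖y - x‖ ‖v - u‖ := by
  have hSo := (isOpen_footDomain ι i).prod (Metric.isOpen_ball (x := (0 : F)) (ε := 1 / 4))
  have hc := (convex_footDomain ι i).prod (convex_ball (0 : F) (1 / 4))
  refine ((h.footRemainder_bounds hk hi).norm_sub_le hSo hc (x := (x, u)) (y := (y, v))
    ⟨hx, mem_ball_zero_iff.2 hu⟩ ⟨hy, mem_ball_zero_iff.2 hv⟩).trans ?_
  exact mul_le_mul_of_nonneg_right h.foot_one (norm_nonneg _)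

/-- The foot point equation has a solution, found by contraction. -/
theorem exists_foot (h : FlatAtlas X ε d ι C N B) (hk : k < N) (hi : i ∈ C k) {x : E}
    (hx : x ∈ footDomain ι i) : ∃ u : F, ‖u‖ ≤ 13 / 100 ∧
      u = adjoint (ι i) (x - i) + footRemainder ι C k i (x, u) := by
  obtain ⟨u, hu, hfix⟩ := exists_fixedPoint_closedBall
    (f := fun u => adjoint (ι i) (x - i) + footRemainder ι C k i (x, u)) (r := 13 / 100)
    (by norm_num)
    (fun u hu => by
      have h1 := norm_add_le (adjoint (ι i) (x - i)) (footRemainder ι C k i (x, u))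
      have h2 := h.norm_footRemainder_le hk hi hx (u := u) (by linarith)
      have h3 := hx.2
      linarith)
    (fun u v hu hv => by
      have h1 := h.norm_footRemainder_sub_le hk hi hx hx (u := v) (v := u) (by linarith)
        (by linarith)
      rw [sub_self, norm_zero, max_eq_right (norm_nonneg _)] at h1
      rw [add_sub_add_left_eq_sub]
      linarith [norm_nonneg (u - v)])
  exact ⟨u, hu, hfix.symm⟩

/-- The derivative bounds of the foot point map in a chart, relative to an affine map. -/
noncomputable def _root_.projectionBound (B : ℕ → ℝ) (k : ℕ) : ℝ :=
  implicitBound (footBound B) k +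
    compBound B (fun k => affineBound 1 1 k + implicitBound (footBound B) k) k

theorem _root_.projectionBound_nonneg {B : ℕ → ℝ} (hB : ∀ k, 0 ≤ B k) (k : ℕ) :
    0 ≤ projectionBound B k := by
  have h1 := implicitBound_nonneg (footBound_nonneg hB)
  exact add_nonneg (h1 k) (compBound_nonneg hB
    (fun k => add_nonneg (affineBound_nonneg zero_le_one zero_le_one k) (h1 k)) k)

/-- Around each centre there is a map to the manifold whose values are critical points of the
distance, and which differs from an affine map by `O(d)` in all derivatives. -/
theorem exists_footMap (h : FlatAtlas X ε d ι C N B) (hk : k < N) (hi : i ∈ C k) :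
    ∃ (u : E → F) (c : E) (L : E →L[ℝ] E) (e : E → E), ‖L‖ ≤ 1 ∧
      (∀ x ∈ footDomain ι i, ‖u x‖ ≤ 13 / 100 ∧
        ‖adjoint (ι i) (x - i) - u x‖ ≤ 1 / 1000 ∧
        ∀ a, inner ℝ (fderiv ℝ (chart ι C k i) (u x) a) (x - chart ι C k i (u x)) = 0) ∧
      (∀ x ∈ footDomain ι i, chart ι C k i (u x) = (c + L x) + e x) ∧
      HasDerivBounds e (footDomain ι i) (fun k => projectionBound B k * d) := by
  have hex : ∀ x ∈ footDomain ι i, ∃ u : F, ‖u‖ ≤ 13 / 100 ∧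
      u = adjoint (ι i) (x - i) + footRemainder ι C k i (x, u) := fun x hx => h.exists_foot hk hi hx
  choose! u hu13 hu using hex
  have hTi := h.isometry_of_mem hi
  have hd0 := h.pos
  have hd1 : d ≤ 1 := by linarith [h.small]
  set D := footDomain ι i with hD
  have hDo : IsOpen D := isOpen_footDomain ι i
  have hu4 : ∀ x ∈ D, ‖u x‖ < 1 / 4 := fun x hx => by linarith [hu13 x hx]
  have hA1 : ‖adjoint (ι i)‖ ≤ 1 := by
    rw [LinearIsometryEquiv.norm_map]; exact norm_le_one_of_isometry hTi
  have huc : ContinuousOn u D := by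
    refine (LipschitzOnWith.of_dist_le_mul (K := 2) fun x hx y hy => ?_).continuousOn
    rw [dist_eq_norm, dist_eq_norm]
    have e : u x - u y = adjoint (ι i) (x - y) +
        (footRemainder ι C k i (x, u x) - footRemainder ι C k i (y, u y)) := by
      rw [show x - y = (x - i) - (y - i) by abel, map_sub]
      nth_rewrite 1 [hu x hx]
      nth_rewrite 1 [hu y hy]
      abel
    have h1 := norm_add_le (adjoint (ι i) (x - y))
      (footRemainder ι C k i (x, u x) - footRemainder ι C k i (y, u y))
    rw [← e] at h1
    have h2 := norm_adjoint_apply_le hTi (x - y)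
    have h3 := h.norm_footRemainder_sub_le hk hi hy hx (hu4 y hy) (hu4 x hx)
    have h4 : max ‖x - y‖ ‖u x - u y‖ ≤ ‖x - y‖ + ‖u x - u y‖ :=
      max_le_add_of_nonneg (norm_nonneg _) (norm_nonneg _)
    have h5 := norm_nonneg (x - y)
    have h6 : ((2 : NNReal) : ℝ) = 2 := rfl
    rw [h6]
    linarith
  have huU : Set.MapsTo u D (Metric.ball 0 (1 / 4)) := fun x hx => mem_ball_zero_iff.2 (hu4 x hx)
  have hu' : ∀ x ∈ D, u x = (-adjoint (ι i) i + adjoint (ι i) x) +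
      footRemainder ι C k i (x, u x) := fun x hx => by
    rw [neg_add_eq_sub, ← map_sub]; exact hu x hx
  have hfb := footBound_nonneg h.nonneg
  have hw := hasDerivBounds_of_implicit hDo Metric.isOpen_ball hd0.le hd1 hfb
    (h.footRemainder_bounds hk hi) (by linarith [h.foot_one]) (adjoint (ι i)) hA1
    (-adjoint (ι i) i) huc huU hu'
  have hub : HasDerivBounds u D
      (fun k => affineBound 1 1 k + implicitBound (footBound B) k) := by
    have h1 : HasDerivBounds (fun x => -adjoint (ι i) i + adjoint (ι i) x) D (affineBound 1 1) := by
      refine HasDerivBounds.affine _ _ (fun x hx => ?_) hA1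
      rw [neg_add_eq_sub, ← map_sub]
      linarith [hx.2]
    refine ((h1.add hDo hw).congr hDo hu').mono fun k => ?_
    have := mul_le_of_le_one_right (implicitBound_nonneg hfb k) hd1
    linarith
  have he := HasDerivBounds.comp' hDo Metric.isOpen_ball (h.chartError_bounds hk hi) hub huU
  rw [compBound_mul] at he
  have hTw := hw.clm_comp hDo (ι i) (norm_le_one_of_isometry hTi)
  refine ⟨u, i + ι i (-adjoint (ι i) i), ι i ∘L adjoint (ι i),
    fun x => ι i (footRemainder ι C k i (x, u x)) + chartError ι C k i (u x), ?_, fun x hx => ?_,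
    fun x hx => ?_, (hTw.add hDo he).mono fun k => ?_⟩
  · refine ((ι i).opNorm_comp_le _).trans ?_
    exact mul_le_one₀ (norm_le_one_of_isometry hTi) (norm_nonneg _) hA1
  · refine ⟨hu13 x hx, ?_, fun a => ?_⟩
    · have h1 := h.norm_footRemainder_le hk hi hx (hu4 x hx)
      nth_rewrite 1 [hu x hx]
      rwa [sub_add_cancel_left, norm_neg]
    · rw [(h.hasFDerivAt_chart hk hi (hu4 x hx)).fderiv,
        ← ContinuousLinearMap.adjoint_inner_right, adjoint_fderiv_chart_apply hTi, ← hu x hx,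
        sub_self, inner_zero_right]
  · rw [chart_eq_add_chartError]
    nth_rewrite 1 [hu' x hx]
    simp only [map_add, ContinuousLinearMap.comp_apply]
    abel
  · rw [projectionBound, add_mul]

end FlatAtlas

end FootPoint

/-! ### Nearest points and the normal projection -/

section Reach

variable {E F : Type*} [NormedAddCommGroup E] [InnerProductSpace ℝ E] [CompleteSpace E]
  [NormedAddCommGroup F] [InnerProductSpace ℝ F] [CompleteSpace F]

open ContinuousLinearMap (adjoint)

namespace FlatAtlas

variable {X : Set E} {ε d : ℝ} {ι : E → F →L[ℝ] E} {C : ℕ → Set E} {N : ℕ} {B : ℕ → ℝ}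
  {k : ℕ} {i : E}

theorem norm_chart_sub_centre_le (h : FlatAtlas X ε d ι C N B) (hk : k < N) (hi : i ∈ C k) {u : F}
    (hu : ‖u‖ < 1 / 4) : ‖chart ι C k i u - i‖ ≤ ‖u‖ + 1 / 1000 := by
  have e : chart ι C k i u - i = (chart ι C k i u - (i + ι i u)) + ι i u := by abel
  have h1 := norm_add_le (chart ι C k i u - (i + ι i u)) (ι i u)
  have h2 := h.norm_chart_sub_le' hk hi hu
  rw [h.isometry_of_mem hi] at h1
  rw [e]
  linarith

/-- A normal vector is almost orthogonal to short chords: the chord deviates from the tangent space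
quadratically. At short distances this is Taylor's formula in a chart, at larger distances it
follows since the manifold stays close to the flat at the centre `i`. -/
theorem abs_inner_chord_le (h : FlatAtlas X ε d ι C N B) (hk : k < N) (hi : i ∈ C k) {u : F}
    (hu : ‖u‖ ≤ 13 / 100) {v : E} (hv : ∀ a, inner ℝ (fderiv ℝ (chart ι C k i) u a) v = 0) {q : E}
    (hq : q ∈ gluedManifold ι C N) (hqu : ‖q - chart ι C k i u‖ < 675 / 1000) :
    |inner ℝ v (q - chart ι C k i u)| ≤ ‖v‖ * ‖q - chart ι C k i u‖ ^ 2 := by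
  have hTi := h.isometry_of_mem hi
  have hiX := h.subset k hi
  have hu4 : ‖u‖ < 1 / 4 := by linarith
  set p := chart ι C k i u with hp
  set T' := fderiv ℝ (chart ι C k i) u with hT'
  have hT'e : T' = ι i + fderiv ℝ (chartError ι C k i) u := (h.hasFDerivAt_chart hk hi hu4).fderiv
  have hpi : ‖p - i‖ ≤ 131 / 1000 := by
    have := h.norm_chart_sub_centre_le hk hi hu4
    linarith
  -- A tangent vector may be subtracted from the chord.
  have hsub : ∀ (a : F) (κ : ℝ), ‖q - p - T' a‖ ≤ κ → |inner ℝ v (q - p)| ≤ ‖v‖ * κ := by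
    intro a κ hκ
    have e : inner ℝ v (q - p) = inner ℝ v (q - p - T' a) := by
      rw [inner_sub_right _ _ (T' a), real_inner_comm (T' a) v, hv a, sub_zero]
    rw [e]
    exact (abs_real_inner_le_norm _ _).trans (mul_le_mul_of_nonneg_left hκ (norm_nonneg _))
  rcases lt_or_ge ‖q - p‖ (65 / 1000) with hnear | hfar
  · have hqi : ‖q - i‖ < 1 / 5 := by
      have := norm_add_le (q - p) (p - i)
      rw [sub_add_sub_cancel] at this
      linarith
    obtain ⟨u', hu', rfl⟩ := h.exists_chart_eq hk hi hq hqi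
    refine hsub (u' - u) _ ?_
    have h1 := (h.chartError_bounds hk hi).norm_sub_sub_fderiv_le Metric.isOpen_ball
      (convex_ball _ _) (mem_ball_zero_iff.2 hu4)
      (mem_ball_zero_iff.2 (by linarith : ‖u'‖ < 1 / 4))
    have e : chart ι C k i u' - p - T' (u' - u) = chartError ι C k i u' - chartError ι C k i u -
        fderiv ℝ (chartError ι C k i) u (u' - u) := by
      rw [hT'e, _root_.add_apply, map_sub (ι i), hp, chart_eq_add_chartError,
        chart_eq_add_chartError ι C k i u]
      abel
    have h2 := h.le_norm_chart_sub_chart hk hi (u := u') (v := u) (by linarith) hu4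
    rw [e]
    have h3 := mul_le_mul_of_nonneg_right h.bound_two (sq_nonneg ‖u' - u‖)
    have h4 := norm_nonneg (u' - u)
    have h5 : (9 / 10 * ‖u' - u‖) ^ 2 ≤ ‖chart ι C k i u' - p‖ ^ 2 :=
      pow_le_pow_left₀ (by positivity) h2 2
    nlinarith
  · have hqi : ‖q - i‖ < 83 / 100 := by
      have := norm_add_le (q - p) (p - i)
      rw [sub_add_sub_cancel] at this
      linarith
    have h1 := h.norm_perp_sub_le_of_mem' hiX hq hqi
    have h2 : ‖perp (ι i) (p - i)‖ ≤ 1 / 1000 := by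
      have h3 := norm_perp_le_norm_sub hTi (p - i) u
      rw [sub_sub] at h3
      exact h3.trans (h.norm_chart_sub_le' hk hi hu4)
    set a := adjoint (ι i) (q - p) with ha
    have ha' : ‖a‖ ≤ 675 / 1000 := (norm_adjoint_apply_le hTi _).trans hqu.le
    have e : q - p - T' a = perp (ι i) (q - i) - perp (ι i) (p - i) -
        fderiv ℝ (chartError ι C k i) u a := by
      rw [← map_sub, sub_sub_sub_cancel_right, perp_apply, ← ha, hT'e, _root_.add_apply]
      abel
    refine (hsub a (37 / 10000) ?_).trans (mul_le_mul_of_nonneg_left ?_ (norm_nonneg _))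
    · have h3 := norm_sub_le (perp (ι i) (q - i) - perp (ι i) (p - i))
        (fderiv ℝ (chartError ι C k i) u a)
      have h4 := norm_sub_le (perp (ι i) (q - i)) (perp (ι i) (p - i))
      have h5 := (fderiv ℝ (chartError ι C k i) u).le_opNorm a
      have h6 := mul_le_mul (h.norm_fderiv_chartError_le hk hi hu4) ha' (norm_nonneg a)
        (by norm_num)
      rw [e]
      linarith
    · nlinarith

/-- The end point of a normal vector of length less than `0.3375` is closer to its foot point than
to any other point of the manifold. -/
theorem norm_lt_norm_sub (h : FlatAtlas X ε d ι C N B) (hk : k < N) (hi : i ∈ C k) {u : F}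
    (hu : ‖u‖ ≤ 13 / 100) {v : E} (hv : ∀ a, inner ℝ (fderiv ℝ (chart ι C k i) u a) v = 0)
    (hvn : ‖v‖ < 3375 / 10000) {q : E} (hq : q ∈ gluedManifold ι C N)
    (hqu : q ≠ chart ι C k i u) : ‖v‖ < ‖chart ι C k i u + v - q‖ := by
  set p := chart ι C k i u with hp
  have hpos : 0 < ‖q - p‖ := norm_pos_iff.2 (sub_ne_zero.2 hqu)
  have e : p + v - q = v - (q - p) := by abel
  rw [e]
  rcases lt_or_ge ‖q - p‖ (675 / 1000) with hnear | hfar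
  · have h1 := h.abs_inner_chord_le hk hi hu hv hq hnear
    have h2 := norm_sub_sq_real v (q - p)
    have h3 := (abs_le.1 h1).2
    have h4 : ‖v‖ * ‖q - p‖ ^ 2 ≤ 3375 / 10000 * ‖q - p‖ ^ 2 := by gcongr
    have h5 : 0 < ‖q - p‖ ^ 2 := by positivity
    exact lt_of_pow_lt_pow_left₀ 2 (norm_nonneg _) (by nlinarith)
  · have := norm_sub_norm_le (q - p) v
    rw [norm_sub_rev (q - p) v] at this
    linarith

/-- Every point at distance less than `1/3` from the manifold lies well inside the foot domain of
some centre. -/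
theorem exists_ball_subset_footDomain (h : FlatAtlas X ε d ι C N B) {x : E}
    (hx : x ∈ Metric.thickening (1 / 3) (gluedManifold ι C N)) :
    ∃ k < N, ∃ i ∈ C k, Metric.ball x (1 / 100) ⊆ footDomain ι i := by
  obtain ⟨m, hm, hxm⟩ := Metric.mem_thickening_iff.1 hx
  rw [dist_eq_norm] at hxm
  obtain ⟨l, hl, j, hj, hmj⟩ := h.exists_centre hm
  have hjX := h.subset l hj
  have hTj := h.isometry j hjX
  -- The centre is chosen near the projection `j + ι j a` of `x` to the flat at `j`.
  set a := adjoint (ι j) (x - j) with ha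
  have hxj : ‖x - j‖ < 449 / 1000 := by
    have := norm_add_le (x - m) (m - j)
    rw [sub_add_sub_cancel] at this
    linarith
  have han : ‖a‖ < 449 / 1000 := (norm_adjoint_apply_le hTj _).trans_lt hxj
  obtain ⟨t, y, hy, hat, hty⟩ := h.net j hjX a (by linarith)
  obtain ⟨k, hk, i, hi, hyi⟩ := h.cover y hy
  have hiX := h.subset k hi
  have hTi := h.isometry i hiX
  have hd := h.small
  have hd0 := h.pos
  have hε := h.eps_lt
  have hzi : ‖j + ι j a - i‖ < 1101 / 10000 := by
    have e : j + ι j a - i = ι j (a - t) + (j + ι j t - y) + (y - i) := by rw [map_sub]; abel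
    have h1 := norm_add_le (ι j (a - t) + (j + ι j t - y)) (y - i)
    have h2 := norm_add_le (ι j (a - t)) (j + ι j t - y)
    rw [hTj] at h2
    rw [e]
    linarith
  have hji : ‖i - j‖ < 95 / 100 := by
    have h1 := norm_sub_le (ι j a) (j + ι j a - i)
    rw [show ι j a - (j + ι j a - i) = i - j by abel, hTj] at h1
    linarith
  have hdec : x - i = (j + ι j a - i) + perp (ι j) (x - j) := by
    rw [perp_apply, ← ha]; abel
  have hperp : ‖perp (ι j) (x - j)‖ ≤ 336 / 1000 := by
    have e : perp (ι j) (x - j) = perp (ι j) (x - m) + perp (ι j) (m - j) := by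
      rw [← map_add, sub_add_sub_cancel]
    have h1 := norm_add_le (perp (ι j) (x - m)) (perp (ι j) (m - j))
    have h2 := norm_perp_apply_le hTj (x - m)
    have h3 := h.norm_perp_sub_le_of_mem' hjX hm (by linarith)
    rw [e]
    linarith
  have hxi : ‖x - i‖ < 46 / 100 := by
    have := norm_add_le (j + ι j a - i) (perp (ι j) (x - j))
    rw [hdec]
    linarith
  have hAperp : ‖adjoint (ι i) (perp (ι j) (x - j))‖ ≤ 1 / 1000 := by
    set v := perp (ι j) (x - j) with hv
    have hvv : perp (ι j) v = v := perp_perp hTj _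
    have h1 : ι i (adjoint (ι i) v) = (perp (ι j) - perp (ι i)) v := by
      rw [_root_.sub_apply, hvv, perp_apply (ι i)]; abel
    rw [← hTi, h1]
    have h2 := (perp (ι j) - perp (ι i)).le_opNorm v
    have h3 := h.norm_perp_sub_le hε hd0 h.small' hjX hiX hji
    have h4 : ‖perp (ι j) - perp (ι i)‖ * ‖v‖ ≤ 80 * d * (336 / 1000) :=
      mul_le_mul h3 hperp (norm_nonneg _) (by positivity)
    linarith
  have hAx : ‖adjoint (ι i) (x - i)‖ < 115 / 1000 := by
    rw [hdec, map_add]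
    have h1 := norm_add_le (adjoint (ι i) (j + ι j a - i)) (adjoint (ι i) (perp (ι j) (x - j)))
    have h2 := norm_adjoint_apply_le hTi (j + ι j a - i)
    linarith
  refine ⟨k, hk, i, hi, fun z hz => ?_⟩
  have hzx := mem_ball_iff_norm.1 hz
  have e : z - i = (z - x) + (x - i) := by abel
  constructor
  · have := norm_add_le (z - x) (x - i)
    rw [e]
    linarith
  · have h1 := norm_add_le (adjoint (ι i) (z - x)) (adjoint (ι i) (x - i))
    have h2 := norm_adjoint_apply_le hTi (z - x)
    rw [e, map_add]
    linarith

/-- The foot point map of a centre sends the points of its domain that are close to the manifold to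
their nearest points. -/
theorem foot_isNearest (h : FlatAtlas X ε d ι C N B) (hk : k < N) (hi : i ∈ C k) {x : E}
    (hxD : x ∈ footDomain ι i) (hx : x ∈ Metric.thickening (1 / 3) (gluedManifold ι C N)) {u : F}
    (hu : ‖u‖ ≤ 13 / 100) (hu' : ‖adjoint (ι i) (x - i) - u‖ ≤ 1 / 1000)
    (hcrit : ∀ a, inner ℝ (fderiv ℝ (chart ι C k i) u a) (x - chart ι C k i u) = 0) :
    ∀ q ∈ gluedManifold ι C N, q ≠ chart ι C k i u → dist x (chart ι C k i u) < dist x q := by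
  intro q hq hne
  obtain ⟨m, hm, hxm⟩ := Metric.mem_thickening_iff.1 hx
  rw [dist_eq_norm] at hxm
  have hiX := h.subset k hi
  have hTi := h.isometry i hiX
  have hvn : ‖x - chart ι C k i u‖ < 3375 / 10000 := by
    have hmi : ‖m - i‖ < 83 / 100 := by
      have h1 := norm_add_le (m - x) (x - i)
      rw [sub_add_sub_cancel, norm_sub_rev m x] at h1
      have := hxD.1
      linarith
    have e : x - chart ι C k i u = ι i (adjoint (ι i) (x - i) - u) + perp (ι i) (x - m) +
        perp (ι i) (m - i) - (chart ι C k i u - (i + ι i u)) := by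
      rw [add_assoc, ← map_add, sub_add_sub_cancel, perp_apply, map_sub (ι i)]
      abel
    have h1 := norm_sub_le (ι i (adjoint (ι i) (x - i) - u) + perp (ι i) (x - m) +
      perp (ι i) (m - i)) (chart ι C k i u - (i + ι i u))
    have h2 := norm_add_le (ι i (adjoint (ι i) (x - i) - u) + perp (ι i) (x - m))
      (perp (ι i) (m - i))
    have h3 := norm_add_le (ι i (adjoint (ι i) (x - i) - u)) (perp (ι i) (x - m))
    have h4 := norm_perp_apply_le hTi (x - m)
    have h5 := h.norm_perp_sub_le_of_mem' hiX hm hmi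
    have h6 := h.norm_chart_sub_le' hk hi (u := u) (by linarith)
    rw [hTi] at h3
    rw [e]
    linarith
  have := h.norm_lt_norm_sub hk hi hu hcrit hvn hq hne
  rwa [add_sub_cancel, ← dist_eq_norm, ← dist_eq_norm] at this

/-- The normal projection of the glued manifold at scale `1`. -/
theorem exists_normalProjection (h : FlatAtlas X ε d ι C N B) :
    ∃ P : E → E, IsNormalProjection (gluedManifold ι C N) (1 / 3) P ∧
      ContDiffOn ℝ ∞ P (Metric.thickening (1 / 3) (gluedManifold ι C N)) ∧
      (∀ x ∈ Metric.thickening (1 / 3) (gluedManifold ι C N),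
        ∀ y ∈ Metric.thickening (1 / 3) (gluedManifold ι C N),
          ‖P x - P y‖ ≤ (100 + projectionBound B 1) * ‖x - y‖) ∧
      (∀ k, 2 ≤ k → ∀ x ∈ Metric.thickening (1 / 3) (gluedManifold ι C N),
        ‖iteratedFDeriv ℝ k P x‖ ≤ projectionBound B k * d) ∧
      ∀ p ∈ gluedManifold ι C N, ∀ v ∈ normalSpaceAt (gluedManifold ι C N) p, ‖v‖ < 1 / 3 →
        P (p + v) = p := by
  set M := gluedManifold ι C N with hM
  set U := Metric.thickening (1 / 3) M with hU
  have hUo : IsOpen U := Metric.isOpen_thickening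
  -- The local foot point maps.
  have hloc : ∀ x ∈ U, ∃ (Q : E → E) (D : Set E) (c : E) (L : E →L[ℝ] E) (e : E → E), IsOpen D ∧
      Convex ℝ D ∧ Metric.ball x (1 / 100) ⊆ D ∧ ‖L‖ ≤ 1 ∧
      (∀ z ∈ D, z ∈ U → Q z ∈ M ∧ ∀ q ∈ M, q ≠ Q z → dist z (Q z) < dist z q) ∧
      (∀ z ∈ D, Q z = (c + L z) + e z) ∧ HasDerivBounds e D (fun k => projectionBound B k * d) := by
    intro x hx
    obtain ⟨k, hk, i, hi, hD⟩ := h.exists_ball_subset_footDomain hx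
    obtain ⟨u, c, L, e, hL, hu, hQ, he⟩ := h.exists_footMap hk hi
    refine ⟨fun z => chart ι C k i (u z), footDomain ι i, c, L, e, isOpen_footDomain ι i,
      convex_footDomain ι i, hD, hL, fun z hz hzU => ?_, hQ, he⟩
    obtain ⟨h1, h2, h3⟩ := hu z hz
    exact ⟨mem_gluedManifold hk hi (by linarith), h.foot_isNearest hk hi hz hzU h1 h2 h3⟩
  have hex : ∀ x ∈ U, ∃ p ∈ M, ∀ q ∈ M, q ≠ p → dist x p < dist x q := fun x hx => by
    obtain ⟨Q, D, c, L, e, -, -, hD, -, hQ, -⟩ := hloc x hx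
    have := hQ x (hD (Metric.mem_ball_self (by norm_num))) hx
    exact ⟨Q x, this⟩
  choose! P hPM hP using hex
  have huniq : ∀ x ∈ U, ∀ p ∈ M, (∀ q ∈ M, q ≠ p → dist x p < dist x q) → P x = p := by
    intro x hx p hp hpq
    by_contra hne
    exact lt_asymm (hP x hx p hp (Ne.symm hne)) (hpq _ (hPM x hx) hne)
  have hPdist : ∀ x ∈ U, ‖x - P x‖ < 1 / 3 := by
    intro x hx
    obtain ⟨m, hm, hxm⟩ := Metric.mem_thickening_iff.1 hx
    rw [← dist_eq_norm]
    rcases eq_or_ne m (P x) with rfl | hne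
    · exact hxm
    · exact (hP x hx m hm hne).trans hxm
  -- Near each point, the projection is the sum of an affine map and a small smooth map.
  have hlocP : ∀ x ∈ U, ∃ (D : Set E) (c : E) (L : E →L[ℝ] E) (e : E → E), IsOpen D ∧
      Convex ℝ D ∧ Metric.ball x (1 / 100) ⊆ D ∧ ‖L‖ ≤ 1 ∧
      (∀ z ∈ D, z ∈ U → P z = (c + L z) + e z) ∧
      HasDerivBounds e D (fun k => projectionBound B k * d) := by
    intro x hx
    obtain ⟨Q, D, c, L, e, hDo, hDc, hD, hL, hQ, hQe, he⟩ := hloc x hx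
    exact ⟨D, c, L, e, hDo, hDc, hD, hL, fun z hz hzU =>
      (huniq z hzU _ (hQ z hz hzU).1 (hQ z hz hzU).2).trans (hQe z hz), he⟩
  have hev : ∀ x ∈ U, ∃ (D : Set E) (c : E) (L : E →L[ℝ] E) (e : E → E), IsOpen D ∧ x ∈ D ∧
      (P =ᶠ[nhds x] fun z => (c + L z) + e z) ∧
      HasDerivBounds e D (fun k => projectionBound B k * d) := by
    intro x hx
    obtain ⟨D, c, L, e, hDo, -, hD, -, hPe, he⟩ := hlocP x hx
    have hxD := hD (Metric.mem_ball_self (by norm_num))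
    refine ⟨D, c, L, e, hDo, hxD, ?_, he⟩
    filter_upwards [hDo.mem_nhds hxD, hUo.mem_nhds hx] with z hz hzU using hPe z hz hzU
  have hMU : ∀ p ∈ M, p ∈ U := fun p hp => Metric.self_subset_thickening (by norm_num) M hp
  refine ⟨P, fun x hx => ⟨hPM x hx, hP x hx⟩, fun x hx => ?_, fun x hx y hy => ?_,
    fun k hk2 x hx => ?_, fun p hp v hv hvn => ?_⟩
  · obtain ⟨D, c, L, e, hDo, hxD, hPe, he⟩ := hev x hx
    refine (ContDiffAt.congr_of_eventuallyEq ?_ hPe).contDiffWithinAt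
    exact (contDiff_const.add L.contDiff).contDiffAt.add (he.contDiffAt hDo hxD)
  · rcases lt_or_ge ‖x - y‖ (1 / 100) with hlt | hge
    · obtain ⟨D, c, L, e, hDo, hDc, hD, hL, hPe, he⟩ := hlocP x hx
      have hxD := hD (Metric.mem_ball_self (by norm_num))
      have hyD : y ∈ D := hD (mem_ball_iff_norm'.2 hlt)
      have h1 := he.norm_sub_le hDo hDc hyD hxD
      have h2 := L.le_opNorm (x - y)
      have h3 : P x - P y = L (x - y) + (e x - e y) := by
        rw [hPe x hxD hx, hPe y hyD hy, map_sub]; abel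
      have h4 := norm_add_le (L (x - y)) (e x - e y)
      have h5 := norm_nonneg (x - y)
      have h6 : projectionBound B 1 * d ≤ projectionBound B 1 :=
        mul_le_of_le_one_right (projectionBound_nonneg h.nonneg 1) (by linarith [h.small])
      rw [h3]
      nlinarith
    · -- Far apart points: both are moved by less than `1/3`.
      have h1 := hPdist x hx
      have h2 := hPdist y hy
      have e : P x - P y = (x - y) - (x - P x) + (y - P y) := by abel
      have h3 := norm_add_le ((x - y) - (x - P x)) (y - P y)
      have h4 := _root_.norm_sub_le (x - y) (x - P x)
      have h5 := projectionBound_nonneg h.nonneg 1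
      rw [e]
      nlinarith
  · obtain ⟨D, c, L, e, hDo, hxD, hPe, he⟩ := hev x hx
    rw [(hPe.iteratedFDeriv ℝ k).eq_of_nhds]
    exact he.iteratedFDeriv_affine_add hDo L c hk2 hxD
  · obtain ⟨k, hk, i, hi, hpi⟩ := h.exists_centre hp
    obtain ⟨u, hu, rfl⟩ := h.exists_chart_eq hk hi hp (by linarith)
    have hu13 : ‖u‖ ≤ 13 / 100 := by
      have e : ι i u = (chart ι C k i u - i) - (chart ι C k i u - (i + ι i u)) := by abel
      have h1 := h.norm_chart_sub_le' hk hi (u := u) (by linarith)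
      have h3 := _root_.norm_sub_le (chart ι C k i u - i) (chart ι C k i u - (i + ι i u))
      rw [← e, h.isometry_of_mem hi] at h3
      linarith
    have hv' : ∀ a, inner ℝ (fderiv ℝ (chart ι C k i) u a) v = 0 := fun a =>
      (Submodule.mem_orthogonal _ _).1 hv _
        (h.fderiv_chart_mem_tangentSpaceAt hk hi (by linarith) a)
    refine huniq _ (Metric.mem_thickening_iff.2 ⟨_, hp, ?_⟩) _ hp fun q hq hne => ?_
    · rw [dist_eq_norm, add_sub_cancel_left]; exact hvn
    · rw [dist_eq_norm, dist_eq_norm, add_sub_cancel_left]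
      exact h.norm_lt_norm_sub hk hi hu13 hv' (by linarith) hq hne

end FlatAtlas

end Reach

/-! ### Consequences of a smooth normal projection -/

section NormalProjection

variable {E : Type*} [NormedAddCommGroup E] {M : Set E} {ρ : ℝ} {P : E → E}

namespace IsNormalProjection

theorem apply_of_mem (hP : IsNormalProjection M ρ P) (hρ : 0 < ρ) {p : E} (hp : p ∈ M) :
    P p = p := by
  by_contra hne
  have := (hP p (Metric.self_subset_thickening hρ M hp)).2 p hp (Ne.symm hne)
  rw [dist_self] at this
  exact this.not_ge dist_nonneg

theorem norm_sub_le (hP : IsNormalProjection M ρ P) {x y : E} (hx : x ∈ Metric.thickening ρ M)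
    (hy : y ∈ M) : ‖x - P x‖ ≤ ‖x - y‖ := by
  rcases eq_or_ne y (P x) with rfl | hne
  · exact le_rfl
  · simpa only [dist_eq_norm] using ((hP x hx).2 y hy hne).le

theorem norm_sub_lt (hP : IsNormalProjection M ρ P) {x : E} (hx : x ∈ Metric.thickening ρ M) :
    ‖x - P x‖ < ρ := by
  obtain ⟨y, hy, hxy⟩ := Metric.mem_thickening_iff.1 hx
  rw [dist_eq_norm] at hxy
  exact (hP.norm_sub_le hx hy).trans_lt hxy

variable [InnerProductSpace ℝ E]

/-- The derivative of the normal projection at a point of `M` takes values in the tangent space: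
the projection carries a curve through the point to a curve in `M`. -/
theorem fderiv_mem_tangentSpaceAt (hP : IsNormalProjection M ρ P) (hρ : 0 < ρ)
    (hs : ContDiffOn ℝ ∞ P (Metric.thickening ρ M)) {p : E} (hp : p ∈ M) (w : E) :
    fderiv ℝ P p w ∈ tangentSpaceAt M p := by
  have hpU := Metric.self_subset_thickening hρ M hp
  -- A multiple `c • w` is so small that the curve `p + sin t • (c • w)` stays in the domain.
  set c : ℝ := ρ / (2 * (1 + ‖w‖)) with hc
  have hw := norm_nonneg w
  have hc0 : 0 < c := by positivity
  have hcw : ‖c • w‖ < ρ := by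
    rw [norm_smul, Real.norm_of_nonneg hc0.le, hc, div_mul_eq_mul_div, div_lt_iff₀ (by positivity)]
    nlinarith
  have hin : ∀ t : ℝ, p + Real.sin t • (c • w) ∈ Metric.thickening ρ M := fun t => by
    refine Metric.mem_thickening_iff.2 ⟨p, hp, ?_⟩
    rw [dist_eq_norm, add_sub_cancel_left, norm_smul]
    exact (mul_le_of_le_one_left (norm_nonneg _) (Real.abs_sin_le_one t)).trans_lt hcw
  have hcurve : ContDiff ℝ ∞ (fun t : ℝ => p + Real.sin t • (c • w)) :=
    contDiff_const.add (Real.contDiff_sin.smul contDiff_const)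
  have hmem : fderiv ℝ P p (c • w) ∈ tangentSpaceAt M p := by
    refine Submodule.subset_span ⟨fun t => P (p + Real.sin t • (c • w)), ?_,
      fun t => (hP _ (hin t)).1, by simpa using hP.apply_of_mem hρ hp, ?_⟩
    · rw [← contDiffOn_univ]
      exact hs.comp hcurve.contDiffOn fun t _ => hin t
    · have h1 : HasDerivAt (fun t : ℝ => p + Real.sin t • (c • w)) (c • w) 0 := by
        have := ((Real.hasDerivAt_sin 0).smul_const (c • w)).const_add p
        simpa using this
      have h2 : HasFDerivAt P (fderiv ℝ P p) (p + Real.sin 0 • (c • w)) := by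
        have : DifferentiableAt ℝ P p :=
          (hs.contDiffAt (Metric.isOpen_thickening.mem_nhds hpU)).differentiableAt (by simp)
        simpa using this.hasFDerivAt
      exact (h2.comp_hasDerivAt (0 : ℝ) h1).deriv
  rw [map_smul] at hmem
  have := Submodule.smul_mem _ c⁻¹ hmem
  rwa [smul_smul, inv_mul_cancel₀ hc0.ne', one_smul] at this

/-- The segment from a point to its nearest point of `M` is normal to `M`, by the first variation
of the distance along curves in `M`. -/
theorem sub_mem_normalSpaceAt (hP : IsNormalProjection M ρ P) {x : E}
    (hx : x ∈ Metric.thickening ρ M) : x - P x ∈ normalSpaceAt M (P x) := by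
  have hle : tangentSpaceAt M (P x) ≤ (ℝ ∙ (x - P x))ᗮ := by
    refine Submodule.span_le.2 ?_
    rintro v ⟨γ, hγ, hM, h0, hv⟩
    rw [SetLike.mem_coe, Submodule.mem_orthogonal_singleton_iff_inner_right]
    have hd : HasDerivAt γ v 0 := by
      rw [← hv]; exact (hγ.differentiable (by simp) 0).hasDerivAt
    have h1 := (hd.const_sub x).norm_sq
    have hmin : IsLocalMin (fun t => ‖x - γ t‖ ^ 2) 0 := by
      refine Filter.Eventually.of_forall fun t => ?_
      have := hP.norm_sub_le hx (hM t)
      simp only [h0]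
      gcongr
    have := hmin.hasDerivAt_eq_zero h1
    rw [h0, inner_neg_right] at this
    linarith
  refine (Submodule.mem_orthogonal _ _).2 fun v hv => ?_
  rw [real_inner_comm]
  exact (Submodule.mem_orthogonal_singleton_iff_inner_right).1 (hle hv)

/-- If every normal vector of length less than `ρ` is collapsed to its foot by the normal
projection `P`, then `x ↦ (P x, x - P x)` is a smooth inverse of the normal exponential map. -/
theorem normalExpDiffeoOn (hP : IsNormalProjection M ρ P)
    (hs : ContDiffOn ℝ ∞ P (Metric.thickening ρ M))
    (ht : ∀ p ∈ M, ∀ v ∈ normalSpaceAt M p, ‖v‖ < ρ → P (p + v) = p) :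
    NormalExpDiffeoOn M ρ := by
  have himage : normalExp '' normalTube M ρ = Metric.thickening ρ M := by
    ext x
    constructor
    · rintro ⟨⟨p, v⟩, ⟨hp, -, hv⟩, rfl⟩
      refine Metric.mem_thickening_iff.2 ⟨p, hp, ?_⟩
      rw [dist_eq_norm, normalExp, add_sub_cancel_left]
      exact hv
    · intro hx
      exact ⟨(P x, x - P x), ⟨(hP x hx).1, hP.sub_mem_normalSpaceAt hx, hP.norm_sub_lt hx⟩,
        add_sub_cancel _ _⟩
  have hinv : ∀ q ∈ normalTube M ρ, (P (normalExp q), normalExp q - P (normalExp q)) = q := by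
    rintro ⟨p, v⟩ ⟨hp, hv, hlt⟩
    rw [normalExp, ht p hp v hv hlt, add_sub_cancel_left]
  refine ⟨fun q hq q' hq' h => ?_, himage ▸ Metric.isOpen_thickening,
    fun x => (P x, x - P x), ?_, hinv⟩
  · rw [← hinv q hq, ← hinv q' hq', h]
  · rw [himage]
    exact hs.prodMk (contDiffOn_id.sub hs)

/-- A parametrization satisfies `φ = P ∘ φ`. Differentiating this identity twice expresses the
normal component of `d²φ` through the second derivative of `P`. -/
theorem secondFundamentalFormBoundedBy [CompleteSpace E] {n : ℕ} {κ : ℝ}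
    (hP : IsNormalProjection M ρ P) (hρ : 0 < ρ) (hs : ContDiffOn ℝ ∞ P (Metric.thickening ρ M))
    (hκ : ∀ p ∈ M, ‖iteratedFDeriv ℝ 2 P p‖ ≤ κ) : SecondFundamentalFormBoundedBy n M κ := by
  intro φ V hφ u hu a b
  have hMV : ∀ v ∈ V, φ v ∈ M := fun v hv => by
    obtain ⟨U, -, h⟩ := hφ.image_open V subset_rfl hφ.isOpen
    exact (h ▸ Set.mem_image_of_mem φ hv : φ v ∈ M ∩ U).1
  have hPs : ∀ p ∈ M, ContDiffAt ℝ ∞ P p := fun p hp =>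
    hs.contDiffAt (Metric.isOpen_thickening.mem_nhds (Metric.self_subset_thickening hρ M hp))
  have hφs : ∀ v ∈ V, ContDiffAt ℝ ∞ φ v := fun v hv =>
    hφ.contDiffOn.contDiffAt (hφ.isOpen.mem_nhds hv)
  have hfirst : ∀ v ∈ V, fderiv ℝ φ v = (fderiv ℝ P (φ v)).comp (fderiv ℝ φ v) := fun v hv => by
    have h1 : HasFDerivAt φ (fderiv ℝ φ v) v := ((hφs v hv).differentiableAt (by simp)).hasFDerivAt
    have h2 : HasFDerivAt P (fderiv ℝ P (φ v)) (φ v) :=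
      ((hPs _ (hMV v hv)).differentiableAt (by simp)).hasFDerivAt
    refine ((h2.comp v h1).congr_of_eventuallyEq ?_).unique h1 |>.symm
    filter_upwards [hφ.isOpen.mem_nhds hv] with w hw
    exact (hP.apply_of_mem hρ (hMV w hw)).symm
  have hd1 : HasFDerivAt φ (fderiv ℝ φ u) u := ((hφs u hu).differentiableAt (by simp)).hasFDerivAt
  have hd2 : HasFDerivAt (fderiv ℝ φ) (fderiv ℝ (fderiv ℝ φ) u) u :=
    (((hφs u hu).fderiv_right (m := 1) (by norm_cast)).differentiableAt (by simp)).hasFDerivAt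
  have hdP : HasFDerivAt (fderiv ℝ P) (fderiv ℝ (fderiv ℝ P) (φ u)) (φ u) :=
    (((hPs _ (hMV u hu)).fderiv_right (m := 1) (by norm_cast)).differentiableAt
      (by simp)).hasFDerivAt
  have hcomp := ((hdP.comp u hd1).clm_comp hd2).congr_of_eventuallyEq
    (Filter.eventually_of_mem (hφ.isOpen.mem_nhds hu) hfirst)
  have hsecond : fderiv ℝ (fderiv ℝ φ) u a b =
      fderiv ℝ P (φ u) (fderiv ℝ (fderiv ℝ φ) u a b) +
        fderiv ℝ (fderiv ℝ P) (φ u) (fderiv ℝ φ u a) (fderiv ℝ φ u b) := by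
    conv_lhs => rw [hcomp.fderiv]
    simp
  have hnorm : ‖fderiv ℝ (fderiv ℝ P) (φ u)‖ ≤ κ := by
    refine le_trans (le_of_eq ?_) (hκ _ (hMV u hu))
    rw [← norm_iteratedFDeriv_fderiv, ← norm_iteratedFDeriv_fderiv, norm_iteratedFDeriv_zero]
  have htangent : (normalSpaceAt M (φ u)).starProjection
      (fderiv ℝ P (φ u) (fderiv ℝ (fderiv ℝ φ) u a b)) = 0 := by
    rw [Submodule.starProjection_apply_eq_zero_iff]
    exact Submodule.le_orthogonal_orthogonal _ (hP.fderiv_mem_tangentSpaceAt hρ hs (hMV u hu) _)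
  rw [secondFundamentalForm, hsecond, map_add, htangent, zero_add]
  calc _ ≤ ‖fderiv ℝ (fderiv ℝ P) (φ u) (fderiv ℝ φ u a) (fderiv ℝ φ u b)‖ :=
        Submodule.norm_starProjection_apply_le _ _
    _ ≤ ‖fderiv ℝ (fderiv ℝ P) (φ u)‖ * ‖fderiv ℝ φ u a‖ * ‖fderiv ℝ φ u b‖ :=
        ContinuousLinearMap.le_opNorm₂ _ _ _
    _ ≤ κ * ‖fderiv ℝ φ u a‖ * ‖fderiv ℝ φ u b‖ := by gcongr

end IsNormalProjection

end NormalProjection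

/-! ### Change of scale -/

section Dilation

variable {E : Type*} [NormedAddCommGroup E] [InnerProductSpace ℝ E] {M : Set E} {P : E → E}
  {r ρ : ℝ}

/-- The image of `M` under the homothety `z ↦ r • z`, for `r ≠ 0`. -/
noncomputable def dilation (r : ℝ) (M : Set E) : Set E := {z | r⁻¹ • z ∈ M}

/-- The conjugate of `P` by the homothety `z ↦ r • z`. -/
noncomputable def dilationConj (r : ℝ) (P : E → E) (x : E) : E := r • P (r⁻¹ • x)

theorem mem_dilation {z : E} : z ∈ dilation r M ↔ r⁻¹ • z ∈ M := Iff.rfl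

theorem smul_mem_dilation (hr : 0 < r) {z : E} : r • z ∈ dilation r M ↔ z ∈ M := by
  rw [mem_dilation, inv_smul_smul₀ hr.ne']

theorem dist_eq_mul_dist_inv_smul (hr : 0 < r) (x y : E) :
    dist x y = r * dist (r⁻¹ • x) (r⁻¹ • y) := by
  rw [dist_smul₀, norm_inv, Real.norm_of_nonneg hr.le, mul_inv_cancel_left₀ hr.ne']

theorem thickening_dilation (hr : 0 < r) :
    Metric.thickening (r * ρ) (dilation r M) = (r⁻¹ • ·) ⁻¹' Metric.thickening ρ M := by
  ext x
  simp only [Set.mem_preimage, Metric.mem_thickening_iff]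
  constructor
  · rintro ⟨y, hy, hxy⟩
    rw [dist_eq_mul_dist_inv_smul hr] at hxy
    exact ⟨_, hy, lt_of_mul_lt_mul_left hxy hr.le⟩
  · rintro ⟨y, hy, hxy⟩
    refine ⟨r • y, (smul_mem_dilation hr).2 hy, ?_⟩
    rw [dist_eq_mul_dist_inv_smul hr, inv_smul_smul₀ hr.ne']
    exact mul_lt_mul_of_pos_left hxy hr

theorem IsLocalParametrization.dilation {n : ℕ} {φ : EuclideanSpace ℝ (Fin n) → E}
    {V : Set (EuclideanSpace ℝ (Fin n))} (h : IsLocalParametrization n M φ V) (hr : 0 < r) :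
    IsLocalParametrization n (dilation r M) (fun u => r • φ u) V where
  isOpen := h.isOpen
  contDiffOn := h.contDiffOn.const_smul r
  immersion u hu := by
    have hd : DifferentiableAt ℝ φ u :=
      (h.contDiffOn.contDiffAt (h.isOpen.mem_nhds hu)).differentiableAt (by simp)
    have he : fderiv ℝ (fun u => r • φ u) u = r • fderiv ℝ φ u :=
      (hd.hasFDerivAt.const_smul r).fderiv
    rw [he]
    exact (smul_right_injective E hr.ne').comp (h.immersion u hu)
  injOn u hu v hv huv := h.injOn hu hv (smul_right_injective E hr.ne' huv)
  image_open W hW hWo := by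
    obtain ⟨U, hU, hφ⟩ := h.image_open W hW hWo
    refine ⟨_root_.dilation r U, hU.preimage (continuous_const_smul r⁻¹), ?_⟩
    ext z
    rw [Set.mem_inter_iff, mem_dilation, mem_dilation, ← Set.mem_inter_iff, ← hφ]
    exact exists_congr fun u => and_congr_right fun _ => (eq_inv_smul_iff₀ hr.ne').symm

theorem IsClosedSubmanifold.dilation {n : ℕ} (h : IsClosedSubmanifold n M) (hr : 0 < r) :
    IsClosedSubmanifold n (dilation r M) := by
  refine ⟨h.1.preimage (continuous_const_smul r⁻¹), fun p hp => ?_⟩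
  obtain ⟨φ, V, hφ, u, hu, he⟩ := h.2 _ hp
  exact ⟨_, V, hφ.dilation hr, u, hu, by simp only [he, smul_inv_smul₀ hr.ne']⟩

theorem IsNormalProjection.dilation (h : IsNormalProjection M ρ P) (hr : 0 < r) :
    IsNormalProjection (dilation r M) (r * ρ) (dilationConj r P) := by
  intro x hx
  rw [thickening_dilation hr] at hx
  refine ⟨(smul_mem_dilation hr).2 (h _ hx).1, fun y hy hne => ?_⟩
  rw [dist_eq_mul_dist_inv_smul hr, dist_eq_mul_dist_inv_smul hr x y, dilationConj,
    inv_smul_smul₀ hr.ne']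
  refine mul_lt_mul_of_pos_left ((h _ hx).2 _ hy fun he => hne ?_) hr
  rw [dilationConj, ← he, smul_inv_smul₀ hr.ne']

theorem contDiffOn_dilationConj (hr : 0 < r) (h : ContDiffOn ℝ ∞ P (Metric.thickening ρ M)) :
    ContDiffOn ℝ ∞ (dilationConj r P) (Metric.thickening (r * ρ) (dilation r M)) := by
  rw [thickening_dilation hr]
  have h1 : ContDiff ℝ ∞ fun x : E => r⁻¹ • x := contDiff_const_smul r⁻¹
  have h2 : ContDiffOn ℝ ∞ (fun x => P (r⁻¹ • x)) ((r⁻¹ • ·) ⁻¹' Metric.thickening ρ M) :=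
    h.comp h1.contDiffOn fun _ hx => hx
  exact h2.const_smul r

theorem norm_dilationConj_sub_le (hr : 0 < r) {C : ℝ} {U : Set E}
    (h : ∀ x ∈ U, ∀ y ∈ U, ‖P x - P y‖ ≤ C * ‖x - y‖) {x y : E} (hx : r⁻¹ • x ∈ U)
    (hy : r⁻¹ • y ∈ U) : ‖dilationConj r P x - dilationConj r P y‖ ≤ C * ‖x - y‖ := by
  have h1 := mul_le_mul_of_nonneg_left (h _ hx _ hy) hr.le
  rwa [mul_left_comm, ← norm_smul_of_nonneg hr.le, ← norm_smul_of_nonneg hr.le, smul_sub, smul_sub,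
    smul_inv_smul₀ hr.ne', smul_inv_smul₀ hr.ne'] at h1

theorem norm_iteratedFDeriv_dilationConj_le (hr : 0 < r) {U : Set E} (hU : IsOpen U)
    (h : ContDiffOn ℝ ∞ P U) (k : ℕ) {x : E} (hx : r⁻¹ • x ∈ U) :
    ‖iteratedFDeriv ℝ k (dilationConj r P) x‖ ≤ r * r⁻¹ ^ k * ‖iteratedFDeriv ℝ k P (r⁻¹ • x)‖ := by
  set g : E →L[ℝ] E := r⁻¹ • ContinuousLinearMap.id ℝ E with hg
  have hk : (k : ℕ∞ω) ≤ (∞ : ℕ∞ω) := by exact_mod_cast le_top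
  have hUg : IsOpen (g ⁻¹' U) := hU.preimage g.continuous
  have hgx : g x ∈ U := hx
  have hcomp := g.iteratedFDerivWithin_comp_right h hU.uniqueDiffOn hUg.uniqueDiffOn hgx hk
  rw [iteratedFDerivWithin_of_isOpen k hUg hgx, iteratedFDerivWithin_of_isOpen k hU hgx] at hcomp
  have hs : ContDiffAt ℝ k (P ∘ g) x :=
    (((h.comp g.contDiff.contDiffOn fun _ hy => hy).contDiffAt (hUg.mem_nhds hgx)).of_le hk :)
  have hconj : dilationConj r P = r • (P ∘ g) := rfl
  have hgn : ‖g‖ ≤ r⁻¹ := by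
    rw [hg, norm_smul, norm_inv, Real.norm_of_nonneg hr.le]
    exact mul_le_of_le_one_right (inv_nonneg.2 hr.le) ContinuousLinearMap.norm_id_le
  rw [hconj, iteratedFDeriv_const_smul_apply hs, norm_smul, Real.norm_of_nonneg hr.le, hcomp,
    mul_assoc]
  refine mul_le_mul_of_nonneg_left ?_ hr.le
  refine (ContinuousMultilinearMap.norm_compContinuousLinearMap_le _ _).trans ?_
  rw [Finset.prod_const, Finset.card_univ, Fintype.card_fin, mul_comm]
  exact mul_le_mul_of_nonneg_right (pow_le_pow_left₀ (norm_nonneg g) hgn k) (norm_nonneg _)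

theorem tangentSpaceAt_le_dilation (hr : 0 < r) (p : E) :
    tangentSpaceAt M p ≤ tangentSpaceAt (dilation r M) (r • p) := by
  refine Submodule.span_le.2 ?_
  rintro v ⟨γ, hγ, hM, h0, hv⟩
  have hmem : r • v ∈ tangentSpaceAt (dilation r M) (r • p) := by
    refine Submodule.subset_span ⟨fun t => r • γ t, hγ.const_smul r,
      fun t => (smul_mem_dilation hr).2 (hM t), by simp only [h0], ?_⟩
    have hd : HasDerivAt γ v 0 := by
      rw [← hv]; exact (hγ.differentiable (by simp) 0).hasDerivAt
    exact (hd.const_smul r).deriv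
  simpa only [inv_smul_smul₀ hr.ne', SetLike.mem_coe] using Submodule.smul_mem _ r⁻¹ hmem

theorem dilationConj_add_of_mem_normalSpaceAt (hr : 0 < r)
    (h : ∀ p ∈ M, ∀ v ∈ normalSpaceAt M p, ‖v‖ < ρ → P (p + v) = p) {p : E}
    (hp : p ∈ dilation r M) {v : E} (hv : v ∈ normalSpaceAt (dilation r M) p) (hlt : ‖v‖ < r * ρ) :
    dilationConj r P (p + v) = p := by
  have h1 : v ∈ normalSpaceAt M (r⁻¹ • p) := by
    refine Submodule.orthogonal_le ?_ hv
    simpa only [smul_inv_smul₀ hr.ne'] using tangentSpaceAt_le_dilation (M := M) hr (r⁻¹ • p)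
  have h2 : ‖r⁻¹ • v‖ < ρ := by
    rw [norm_smul, norm_inv, Real.norm_of_nonneg hr.le, inv_mul_lt_iff₀ hr]
    exact hlt
  rw [dilationConj, smul_add, h _ hp _ (Submodule.smul_mem _ _ h1) h2, smul_inv_smul₀ hr.ne']

end Dilation

/-! ### From approximating flats to a field of flats -/

section FlatApproximation

variable {E : Type*} [NormedAddCommGroup E]

theorem HausdorffWithin.exists_dist_lt {A B : Set E} {δ δ' : ℝ} (h : HausdorffWithin δ A B)
    (hδ : 0 ≤ δ) (hδ' : δ < δ') {x : E} (hx : x ∈ A) : ∃ y ∈ B, dist x y < δ' := by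
  obtain ⟨y, hy, hxy⟩ := Metric.exists_edist_lt_of_hausdorffEDist_lt hx
    (h.trans_lt ((ENNReal.ofReal_lt_ofReal_iff (hδ.trans_lt hδ')).2 hδ'))
  exact ⟨y, hy, edist_lt_ofReal.1 hxy⟩

theorem HausdorffWithin.symm {A B : Set E} {δ : ℝ} (h : HausdorffWithin δ A B) :
    HausdorffWithin δ B A := by
  rwa [HausdorffWithin, Metric.hausdorffEDist_comm]

variable [InnerProductSpace ℝ E]

/-- An affine flat of dimension `n` has an isometric linear parametrization of its direction. -/
theorem IsAffineFlat.exists_isometry {n : ℕ} {A : AffineSubspace ℝ E} (h : IsAffineFlat n A) :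
    ∃ T : EuclideanSpace ℝ (Fin n) →L[ℝ] E, (∀ u, ‖T u‖ = ‖u‖) ∧ (∀ u, T u ∈ A.direction) ∧
      ∀ v ∈ A.direction, ∃ u, T u = v := by
  have := h.2.1
  let e := ((stdOrthonormalBasis ℝ A.direction).reindex (finCongr h.2.2)).repr
  refine ⟨(A.direction.subtypeₗᵢ.comp e.symm.toLinearIsometry).toContinuousLinearMap,
    fun u => LinearIsometry.norm_map _ u, fun u => (e.symm u).2, fun v hv => ⟨e ⟨v, hv⟩, ?_⟩⟩
  simp

variable [CompleteSpace E]

/-- If near every point, at scale `r`, the set `X` is approximated by a net of a flat, then the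
rescaled set carries a field of flats; at each point the approximating flat is translated so as to
pass through it. -/
theorem exists_flatField {n : ℕ} {X : Set E} {r ε δ : ℝ} (hr : 0 < r) (hδ : 0 < δ)
    (hδr : δ ≤ r / 100)
    (hX : ∀ x ∈ X, ∃ A : AffineSubspace ℝ E, IsAffineFlat n A ∧
      ∃ S : Set E, IsNet ε S ((A : Set E) ∩ Metric.ball x r) ∧
        HausdorffWithin δ (X ∩ Metric.ball x r) S) :
    ∃ ι : E → EuclideanSpace ℝ (Fin n) →L[ℝ] E,
      FlatField (dilation r⁻¹ X) (ε / r) (4 * δ / r) ι := by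
  have hlocal : ∀ x ∈ dilation r⁻¹ X, ∃ T : EuclideanSpace ℝ (Fin n) →L[ℝ] E,
      (∀ u, ‖T u‖ = ‖u‖) ∧
      (∀ y ∈ dilation r⁻¹ X, ‖y - x‖ < 1 → ‖perp T (y - x)‖ ≤ 4 * δ / r) ∧
      ∀ w, ‖w‖ < 9 / 10 → ∃ t, ∃ y ∈ dilation r⁻¹ X, ‖w - t‖ < ε / r ∧
        ‖x + T t - y‖ < 4 * δ / r := by
    intro x hx
    rw [mem_dilation, inv_inv] at hx
    obtain ⟨A, hA, S, hS, hXS⟩ := hX _ hx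
    obtain ⟨T, hT, hTA, hTs⟩ := hA.exists_isometry
    have hnear : ∀ y ∈ X ∩ Metric.ball (r • x) r, ∃ s ∈ S, dist y s < 2 * δ := fun y hy =>
      hXS.exists_dist_lt hδ.le (by linarith) hy
    obtain ⟨s₀, hs₀, hxs₀⟩ := hnear _ ⟨hx, Metric.mem_ball_self hr⟩
    have hs₀A : s₀ ∈ A := (hS.1 hs₀).1
    rw [dist_eq_norm] at hxs₀
    have hT' : ∀ s ∈ A, ∃ t, s = s₀ + r • T t := fun s hs => by
      obtain ⟨t, ht⟩ := hTs _ (AffineSubspace.vsub_mem_direction hs hs₀A)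
      refine ⟨r⁻¹ • t, ?_⟩
      rw [map_smul, smul_inv_smul₀ hr.ne', ht, vsub_eq_sub, add_sub_cancel]
    refine ⟨T, hT, fun y hy hyx => ?_, fun w hw => ?_⟩
    · rw [mem_dilation, inv_inv] at hy
      obtain ⟨s, hs, hys⟩ := hnear _ ⟨hy, by
        rw [mem_ball_iff_norm, ← smul_sub, norm_smul, Real.norm_of_nonneg hr.le]
        exact mul_lt_of_lt_one_right hr hyx⟩
      rw [dist_eq_norm] at hys
      obtain ⟨t, ht⟩ := hT' s (hS.1 hs).1
      refine (norm_perp_le_norm_sub hT _ t).trans ?_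
      rw [le_div_iff₀' hr, ← norm_smul_of_nonneg hr.le]
      have e : r • (y - x - T t) = (r • y - s) - (r • x - s₀) := by
        rw [ht, smul_sub, smul_sub]; abel
      rw [e]
      linarith [norm_sub_le (r • y - s) (r • x - s₀)]
    · have hz : s₀ + r • T w ∈ (A : Set E) ∩ Metric.ball (r • x) r := by
        constructor
        · rw [add_comm]
          exact AffineSubspace.vadd_mem_of_mem_direction (Submodule.smul_mem _ r (hTA w)) hs₀A
        · have h1 := norm_sub_le (r • T w) (r • x - s₀)
          rw [norm_smul, hT, Real.norm_of_nonneg hr.le] at h1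
          have e : s₀ + r • T w - r • x = r • T w - (r • x - s₀) := by abel
          rw [mem_ball_iff_norm, e]
          have := mul_lt_mul_of_pos_left hw hr
          linarith
      obtain ⟨s, hs, hzs⟩ := Metric.mem_thickening_iff.1 (hS.2 hz)
      obtain ⟨t, rfl⟩ := hT' s (hS.1 hs).1
      obtain ⟨y, hy, hsy⟩ := hXS.symm.exists_dist_lt hδ.le (δ' := 2 * δ) (by linarith) hs
      refine ⟨t, r⁻¹ • y, ?_, ?_, ?_⟩
      · rw [mem_dilation, inv_inv, smul_inv_smul₀ hr.ne']
        exact hy.1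
      · rw [lt_div_iff₀' hr, ← hT, map_sub, ← norm_smul_of_nonneg hr.le, smul_sub]
        rwa [dist_eq_norm, add_sub_add_left_eq_sub] at hzs
      · rw [lt_div_iff₀' hr, ← norm_smul_of_nonneg hr.le]
        have e : r • (x + T t - r⁻¹ • y) = (r • x - s₀) + (s₀ + r • T t - y) := by
          rw [smul_sub, smul_inv_smul₀ hr.ne', smul_add]; abel
        rw [e]
        rw [dist_eq_norm] at hsy
        linarith [norm_add_le (r • x - s₀) (s₀ + r • T t - y)]
  choose! ι h1 h2 h3 using hlocal
  exact ⟨ι, h1, h2, h3⟩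

end FlatApproximation

/-! ### Assembly of the estimates at scale `r` -/

theorem mainTheorem6 (n : ℕ) :
    ∃ (σ₀ C : ℝ) (C' : ℕ → ℝ), 0 < σ₀ ∧ 0 < C ∧
      ∀ (E : Type*) [NormedAddCommGroup E] [InnerProductSpace ℝ E] [CompleteSpace E]
        (X : Set E) (r ε δ : ℝ),
        0 < ε → ε < r / 10 → 0 < δ → δ < σ₀ * r →
        (∀ x ∈ X, ∃ A : AffineSubspace ℝ E, IsAffineFlat n A ∧
          ∃ S : Set E, IsNet ε S ((A : Set E) ∩ Metric.ball x r) ∧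
            HausdorffWithin δ (X ∩ Metric.ball x r) S) →
        ∃ M : Set E, IsClosedSubmanifold n M ∧
          SecondFundamentalFormBoundedBy n M (C * δ / r ^ 2) ∧
          ENNReal.ofReal (r / 3) ≤ normalInjectivityRadius M ∧
          (∃ P : E → E, IsNormalProjection M (r / 3) P ∧
            ContDiffOn ℝ ∞ P (Metric.thickening (r / 3) M) ∧
            (∀ x ∈ Metric.thickening (r / 3) M, ∀ y ∈ Metric.thickening (r / 3) M,
              ‖P x - P y‖ ≤ C * ‖x - y‖) ∧
            (∀ k : ℕ, 2 ≤ k → ∀ x ∈ Metric.thickening (r / 3) M,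
              ‖iteratedFDeriv ℝ k P x‖ < C' k * δ / r ^ k)) ∧
          ∃ S : Set E, IsNet ε S M ∧ HausdorffWithin (C * δ) X S := by
  obtain ⟨N, B, σ, hσ, hB, hatlas⟩ := exists_flatAtlas (EuclideanSpace ℝ (Fin n))
  have hp := projectionBound_nonneg hB
  have hB0 := hB 0
  have hB1 := hB 1
  -- Constants of the normalized situation pick up a factor `4`, as the approximation error of the
  -- rescaled field of flats is `4 * δ / r`.
  set C : ℝ := 100 + projectionBound B 1 + 4 * projectionBound B 2 + 4 * (B 0 + B 1 + 1) with hC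
  have hC0 : 0 < C := by linarith [hp 1, hp 2]
  refine ⟨min (σ / 4) (1 / 100), C, fun k => 4 * projectionBound B k + 1,
    lt_min (by linarith) (by norm_num), hC0, ?_⟩
  intro E _ _ _ X r ε δ hε hεr hδ hδσ hX
  have hr : 0 < r := by linarith
  have hδ1 : δ < σ / 4 * r := hδσ.trans_le (mul_le_mul_of_nonneg_right (min_le_left _ _) hr.le)
  have hδ2 : δ < 1 / 100 * r := hδσ.trans_le (mul_le_mul_of_nonneg_right (min_le_right _ _) hr.le)
  obtain ⟨ι, hι⟩ := exists_flatField hr hδ (by linarith) hX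
  set d : ℝ := 4 * δ / r with hd
  have hd0 : 0 < d := by positivity
  have hrd : r * d = 4 * δ := mul_div_cancel₀ _ hr.ne'
  obtain ⟨Z, h⟩ := hatlas E _ (ε / r) d ι (by rw [div_lt_iff₀ hr]; linarith) hd0
    (by rw [hd, div_le_iff₀ hr]; linarith) hι
  obtain ⟨P, hP, hPs, hPL, hPd, hPt⟩ := h.exists_normalProjection
  set M₁ : Set E := gluedManifold ι Z N with hM₁
  have hr3 : r / 3 = r * (1 / 3) := by ring
  have hQ := hP.dilation hr
  have hQs := contDiffOn_dilationConj hr hPs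
  have hth := thickening_dilation (M := M₁) (ρ := 1 / 3) hr
  have hr30 : 0 < r * (1 / 3) := by linarith
  have hQd : ∀ k, 2 ≤ k → ∀ x ∈ Metric.thickening (r * (1 / 3)) (dilation r M₁),
      ‖iteratedFDeriv ℝ k (dilationConj r P) x‖ ≤ 4 * projectionBound B k * δ / r ^ k := by
    intro k hk x hx
    rw [hth] at hx
    refine (norm_iteratedFDeriv_dilationConj_le hr Metric.isOpen_thickening hPs k hx).trans ?_
    calc r * r⁻¹ ^ k * ‖iteratedFDeriv ℝ k P (r⁻¹ • x)‖
        ≤ r * r⁻¹ ^ k * (projectionBound B k * d) := by gcongr; exact hPd k hk _ hx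
      _ = r⁻¹ ^ k * projectionBound B k * (r * d) := by ring
      _ = 4 * projectionBound B k * δ / r ^ k := by rw [hrd, inv_pow]; ring
  rw [hr3]
  refine ⟨dilation r M₁, h.isClosedSubmanifold_gluedManifold.dilation hr, ?_, ?_,
    ⟨dilationConj r P, hQ, hQs, fun x hx y hy => ?_, fun k hk x hx => ?_⟩, ?_⟩
  · refine hQ.secondFundamentalFormBoundedBy hr30 hQs fun p hpM => ?_
    refine (hQd 2 le_rfl p (Metric.self_subset_thickening hr30 _ hpM)).trans ?_
    have : 4 * projectionBound B 2 ≤ C := by linarith [hp 1]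
    gcongr
  · exact le_sSup ⟨_, hr30, hQ.normalExpDiffeoOn hQs fun p hpM v hv hlt =>
      dilationConj_add_of_mem_normalSpaceAt hr hPt hpM hv hlt, rfl⟩
  · rw [hth] at hx hy
    refine (norm_dilationConj_sub_le hr hPL hx hy).trans ?_
    have : 100 + projectionBound B 1 ≤ C := by linarith [hp 2]
    gcongr
  · refine (hQd k hk x hx).trans_lt ?_
    gcongr
    linarith
  · -- All points of `M` that are close to `X`.
    refine ⟨{m | m ∈ dilation r M₁ ∧ ∃ x ∈ X, ‖m - x‖ ≤ C * δ}, ⟨fun m hm => hm.1, fun m hm => ?_⟩,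
      Metric.hausdorffEDist_le_of_mem_edist (fun x hx => ?_) ?_⟩
    · obtain ⟨m', hm', hmm, y, hy, hmy⟩ := h.exists_net_point hm
      refine Metric.mem_thickening_iff.2 ⟨r • m', ⟨(smul_mem_dilation hr).2 hm', r • y, ?_, ?_⟩, ?_⟩
      · rwa [mem_dilation, inv_inv] at hy
      · rw [← smul_sub, norm_smul_of_nonneg hr.le]
        have h1 := mul_le_mul_of_nonneg_left hmy hr.le
        rw [mul_left_comm, hrd] at h1
        have h2 : 4 * (B 0 + B 1 + 1) * δ ≤ C * δ := by
          refine mul_le_mul_of_nonneg_right ?_ hδ.le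
          linarith [hp 1, hp 2]
        linarith
      · rwa [dist_eq_mul_dist_inv_smul hr, inv_smul_smul₀ hr.ne', ← lt_div_iff₀' hr, dist_eq_norm]
    · have hx' : r⁻¹ • x ∈ dilation r⁻¹ X := (smul_mem_dilation (inv_pos.2 hr)).2 hx
      obtain ⟨m, hm, hxm⟩ := h.exists_mem_gluedManifold_near hx'
      have h1 : ‖x - r • m‖ ≤ C * δ := by
        have e : x - r • m = r • (r⁻¹ • x - m) := by rw [smul_sub, smul_inv_smul₀ hr.ne']
        rw [e, norm_smul_of_nonneg hr.le]
        have h1 := mul_le_mul_of_nonneg_left hxm hr.le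
        rw [mul_left_comm, hrd] at h1
        have h2 : 4 * (B 0 + 1) * δ ≤ C * δ := by
          refine mul_le_mul_of_nonneg_right ?_ hδ.le
          linarith [hp 1, hp 2]
        linarith
      refine ⟨r • m, ⟨(smul_mem_dilation hr).2 hm, x, hx, by rwa [norm_sub_rev]⟩, ?_⟩
      rw [edist_dist, dist_eq_norm]
      exact ENNReal.ofReal_le_ofReal h1
    · rintro m ⟨-, x, hx, hmx⟩
      refine ⟨x, hx, ?_⟩
      rw [edist_dist, dist_eq_norm]
      exact ENNReal.ofReal_le_ofReal hmx
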